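/- Let $d\ge 1$ be an integer and let $\alpha$ satisfy $\frac{d+2}{2}<\alpha<d+2$ if $d\ge 2$, and $2\le\alpha<3$ if $d=1$. Put $$c_{d,\alpha}=\frac{\Gamma((d-\alpha)/2)}{\pi^{d/2}2^{\alpha}\Gamma(\alpha/2)}\quad(\alpha\neq d),\qquad c(d,\alpha)=\alpha^{-\alpha/2}e^{\alpha/2}(2\pi)^{-d/2},$$ $$C(d,\alpha)=\Big(\frac{e}{d+2-\alpha}\Big)^{\frac{d+2-\alpha}{2}}c_{d,\alpha}\,(d-\alpha),$$ where for $\alpha=d$ the product $c_{d,\alpha}(d-\alpha)$ is understood as its limit $\frac{2}{\pi^{d/2}2^{\alpha}\Gamma(\alpha/2)}$. For $0<\lambda<1$ and $c_W>0$ define $W:\mathbb R^d\to(-\infty,\infty]$ by $$W(x)=c_{d,\alpha}|x|^{\alpha-d}+\frac{|x|^2}{2}-c_W\sum_{k=1}^{\infty}\lambda^{(\alpha-d)k}\exp\Big(-\frac{|x|^2}{2\lambda^{2k}}\Big),$$ where $c_{d,\alpha}|x|^{\alpha-d}$ is replaced by $-\frac{2}{\pi^{d/2}2^{\alpha}\Gamma(\alpha/2)}\ln|x|$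 if $\alpha=d$, and where $W(0)=\infty$ if $\alpha\le d$. For a Borel probability measure $\rho$ on $\mathbb R^d$ let $E[\rho]=\frac12\iint W(x-y)\,d\rho(y)\,d\rho(x)$, and for compactly supported $\mu,\nu$ let $d_\infty(\mu,\nu)=\inf_{\pi}\sup_{(x,y)\in\operatorname{supp}\pi}|x-y|$, the infimum being over all transport plans $\pi$ between $\mu$ and $\nu$. A compactly supported probability measure $\rho$ is a $d_\infty$-local minimizer if there is $\varepsilon>0$ such that $E[\rho]\le E[\nu]$ for every compactly supported probability measure $\nu$ with $d_\infty(\rho,\nu)<\varepsilon$. Suppose $c(d,\alpha)<c_W<C(d,\alpha)$. Then there is $\lambda_0>0$, depending only on $d$, $\alpha$ and $c_W$, such that for every $\lambda\in(0,1)$ with $\lambda\le\lambda_0$, every compactly supported $d_\infty$-local minimizer $\rho$ of $E$ is almost fractal: $\operatorname{supp}\rho$ has no isolated points, and for every $\varepsilon>0$ and every representative $g$ of the density of the absolutely continuous part of $\rho$ with respect to Lebesgue measure, the superlevel set $\{x: g(x)\ge\varepsilon\}$ has empty interior. -/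

import Mathlib

open MeasureTheory Set Topology Filter
open scoped ENNReal

noncomputable section

namespace InteractionEnergy

/-- The constant `c_{d,α} = Γ((d-α)/2) / (π^{d/2} 2^α Γ(α/2))`, used for `α ≠ d`. -/
def rieszConst (d : ℕ) (α : ℝ) : ℝ :=
  Real.Gamma (((d : ℝ) - α) / 2) /
    (Real.pi ^ ((d : ℝ) / 2) * (2 : ℝ) ^ α * Real.Gamma (α / 2))

/-- The constant `2 / (π^{d/2} 2^α Γ(α/2))`, used for `α = d`. -/
def logConst (d : ℕ) (α : ℝ) : ℝ :=
  2 / (Real.pi ^ ((d : ℝ) / 2) * (2 : ℝ) ^ α * Real.Gamma (α / 2))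

/-- The function `c_{d,α} |x|^{α-d}`, with the logarithmic convention at `α = d`. -/
def rieszKernel (d : ℕ) (α : ℝ) (x : EuclideanSpace ℝ (Fin d)) : ℝ :=
  if α = d then -logConst d α * Real.log ‖x‖ else rieszConst d α * ‖x‖ ^ (α - (d : ℝ))

/-- The lower threshold `c(d,α) = α^{-α/2} e^{α/2} (2π)^{-d/2}`. -/
def lowerThreshold (d : ℕ) (α : ℝ) : ℝ :=
  α ^ (-α / 2) * Real.exp (α / 2) * (2 * Real.pi) ^ (-(d : ℝ) / 2)

/-- The upper threshold
`C(d,α) = (e / (d+2-α))^{(d+2-α)/2} · c_{d,α} (d-α)`.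
At `α = d` the product `c_{d,α} (d-α)`, which is minus the coefficient of `r^{α-d-1}` in the
derivative of the radial profile of the kernel, is read off the logarithmic kernel (it is also
the limit of `c_{d,α} (d-α)` as `α → d`). -/
def upperThreshold (d : ℕ) (α : ℝ) : ℝ :=
  (Real.exp 1 / ((d : ℝ) + 2 - α)) ^ (((d : ℝ) + 2 - α) / 2) *
    (if α = d then logConst d α else rieszConst d α * ((d : ℝ) - α))

/-- The potential
`W(x) = c_{d,α}|x|^{α-d} + |x|²/2 - c_W ∑_{k ≥ 1} λ^{(α-d)k} exp(-|x|²/(2λ^{2k}))`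
with values in `(-∞, ∞]`. For `α ≤ d` the formula has no meaning at `x = 0` (both the kernel and
the series are infinite there), and `W(0) = ∞`. -/
def potential (d : ℕ) (α cW lam : ℝ) (x : EuclideanSpace ℝ (Fin d)) : EReal :=
  if x = 0 ∧ α ≤ d then ⊤
  else
    ((rieszKernel d α x + ‖x‖ ^ 2 / 2 -
        cW * ∑' k : ℕ, lam ^ ((α - (d : ℝ)) * ((k : ℝ) + 1)) *
          Real.exp (-‖x‖ ^ 2 / (2 * lam ^ (2 * (k + 1)))) : ℝ) : EReal)

/-- The interaction energy `E[ρ] = ½ ∬ W(x-y) dρ(y) dρ(x)`. The integral of an extended-real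
function is the integral of its positive part minus that of its negative part (the latter is
finite if `W` is bounded below and `ρ` is finite). -/
def energy {d : ℕ} (W : EuclideanSpace ℝ (Fin d) → EReal)
    (ρ : Measure (EuclideanSpace ℝ (Fin d))) : EReal :=
  ((1 / 2 : ℝ) : EReal) *
    (((∫⁻ p, (W (p.1 - p.2)).toENNReal ∂(ρ.prod ρ) : ℝ≥0∞) : EReal) -
      ((∫⁻ p, (-W (p.1 - p.2)).toENNReal ∂(ρ.prod ρ) : ℝ≥0∞) : EReal))

/-- The transport plans between `μ` and `ν`. -/
def transportPlans {d : ℕ} (μ ν : Measure (EuclideanSpace ℝ (Fin d))) :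
    Set (Measure (EuclideanSpace ℝ (Fin d) × EuclideanSpace ℝ (Fin d))) :=
  {π | IsProbabilityMeasure π ∧ π.map Prod.fst = μ ∧ π.map Prod.snd = ν}

/-- The `∞`-Wasserstein distance
`d_∞(μ,ν) = inf_{π ∈ Π(μ,ν)} sup_{(x,y) ∈ supp π} |y - x|`. -/
def dInfty {d : ℕ} (μ ν : Measure (EuclideanSpace ℝ (Fin d))) : ℝ≥0∞ :=
  ⨅ π ∈ transportPlans μ ν, ⨆ p ∈ π.support, edist p.1 p.2

/-- `ρ` is a compactly supported probability measure that minimizes the energy among all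
compactly supported probability measures in some `d_∞`-ball centred at `ρ`. -/
def IsCompactlySupportedDInftyLocalMinimizer {d : ℕ}
    (W : EuclideanSpace ℝ (Fin d) → EReal)
    (ρ : Measure (EuclideanSpace ℝ (Fin d))) : Prop :=
  IsProbabilityMeasure ρ ∧ IsCompact ρ.support ∧
    ∃ ε : ℝ≥0∞, 0 < ε ∧ ∀ ν : Measure (EuclideanSpace ℝ (Fin d)),
      IsProbabilityMeasure ν → IsCompact ν.support → dInfty ρ ν < ε →
        energy W ρ ≤ energy W ν

/-- `ρ` is almost fractal: its support has no isolated points, and every superlevel set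
`{ρ ≥ ε}`, `ε > 0`, has empty interior. The superlevel sets are those of the density of the
absolutely continuous part of `ρ` (with respect to Lebesgue measure), for every
representative `g` of this density. -/
def AlmostFractal {d : ℕ} (ρ : Measure (EuclideanSpace ℝ (Fin d))) : Prop :=
  Preperfect ρ.support ∧
    ∀ g : EuclideanSpace ℝ (Fin d) → ℝ,
      g =ᵐ[volume] (fun x => (ρ.rnDeriv volume x).toReal) →
        ∀ ε : ℝ, 0 < ε → interior {x | ε ≤ g x} = ∅

end InteractionEnergy

end

namespace InteractionEnergy

variable {d : ℕ}

/-! The two halves of almost fractality come from two different perturbations of a local minimizer.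
Both are small in `dInfty` because they move mass only a short way, however much mass they move.

No isolated points. An isolated point of the support is an atom. If `α ≤ d`, then `W 0 = ⊤` makes an
atom cost infinite energy, whereas spreading the measure uniformly over small balls gives a nearby
competitor of finite energy. If `α > d`, an atom at `x₀` is split into halves at `x₀ ± v`. The rest
of the measure stays away from `x₀`, so it feels only a symmetric second difference of the
potential, of order `‖v‖²`. The self-interaction gains order `‖v‖^(α-d)` with `α - d < 2`, because
the Riesz coefficient is negative and, at radii midway (logarithmically) between consecutive scales
`lam^k`, the Gaussian series is almost flat once `lam` is small (`eventually_realPotential_sub_le`).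

No solid superlevel sets. If the density is at least `ε` on a ball, mean-zero perturbations `±g`
supported there are admissible, so the quadratic form of `W` at `g` is nonnegative. On mean-zero
functions the Riesz kernel has symbol `|ζ|^(-α)`, the quadratic term is nonpositive, and each
Gaussian contributes a negative symbol. The Gaussian of width `t` outweighs the Riesz symbol at
frequency `√α / t` exactly when `cW` exceeds the lower threshold. All widths `lam^k` occur, so an
oscillation of that kind fits into any ball (`exists_integral_pairing_neg`), which is a
contradiction.

For `α ≤ d` finiteness of the energy also needs `W` bounded below. The scales hardly interact for
small `lam`: if `α < d` a single Gaussian competes with the Riesz kernel, and the upper threshold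
makes the kernel win; if `α = d` the logarithm beats the number of active scales. -/

/-! ### The distance `dInfty` and the energy as a real integral -/

theorem dInfty_le_of_ae_edist_le {μ ν : Measure (EuclideanSpace ℝ (Fin d))}
    {π : Measure (EuclideanSpace ℝ (Fin d) × EuclideanSpace ℝ (Fin d))}
    (hπ : π ∈ transportPlans μ ν) {r : ℝ≥0∞} (h : ∀ᵐ p ∂π, edist p.1 p.2 ≤ r) :
    dInfty μ ν ≤ r :=
  iInf₂_le_of_le π hπ <| iSup₂_le fun _ hp =>
    Measure.support_subset_of_isClosed
      (isClosed_le (continuous_fst.edist continuous_snd) continuous_const) h hp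

/-- The plan leaves the common part `ρ` on the diagonal and couples `σ` to `σ'` by their normalised
product. Only the diameter of `s` matters, not the mass moved. -/
theorem dInfty_add_le {ρ σ σ' : Measure (EuclideanSpace ℝ (Fin d))}
    [IsProbabilityMeasure (ρ + σ)] [IsFiniteMeasure ρ] [IsFiniteMeasure σ] [IsFiniteMeasure σ']
    (hmass : σ univ = σ' univ) (h0 : σ univ ≠ 0) {s : Set (EuclideanSpace ℝ (Fin d))}
    (hs : ∀ᵐ x ∂σ, x ∈ s) (hs' : ∀ᵐ x ∂σ', x ∈ s) {r : ℝ≥0∞}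
    (hr : ∀ x ∈ s, ∀ y ∈ s, edist x y ≤ r) :
    dInfty (ρ + σ) (ρ + σ') ≤ r := by
  have hinv : (σ univ)⁻¹ * σ univ = 1 := ENNReal.inv_mul_cancel h0 (measure_ne_top _ _)
  have hdiag : Measurable fun x : EuclideanSpace ℝ (Fin d) => (x, x) :=
    measurable_id.prodMk measurable_id
  have hfst : (ρ.map (fun x => (x, x)) + (σ univ)⁻¹ • σ.prod σ').map Prod.fst = ρ + σ := by
    rw [Measure.map_add _ _ measurable_fst, Measure.map_map measurable_fst hdiag,
      Measure.map_smul, Measure.map_fst_prod, ← hmass, smul_smul, hinv, one_smul]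
    congr 1
    exact Measure.map_id
  refine dInfty_le_of_ae_edist_le (π := ρ.map (fun x => (x, x)) + (σ univ)⁻¹ • σ.prod σ')
    ⟨⟨?_⟩, hfst, ?_⟩ ?_
  · have h := measure_univ (μ := ρ + σ)
    rwa [← hfst, Measure.map_apply measurable_fst MeasurableSet.univ, preimage_univ] at h
  · rw [Measure.map_add _ _ measurable_snd, Measure.map_map measurable_snd hdiag,
      Measure.map_smul, Measure.map_snd_prod, smul_smul, hinv, one_smul]
    congr 1
    exact Measure.map_id
  · rw [ae_add_measure_iff]
    constructor
    · rw [ae_map_iff hdiag.aemeasurable (measurableSet_le measurable_edist measurable_const)]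
      simp
    · refine Measure.ae_smul_measure ?_ _
      have h1 : ∀ᵐ p ∂σ.prod σ', p.1 ∈ s := Measure.quasiMeasurePreserving_fst.ae hs
      have h2 : ∀ᵐ p ∂σ.prod σ', p.2 ∈ s := Measure.quasiMeasurePreserving_snd.ae hs'
      filter_upwards [h1, h2] with p hp1 hp2 using hr _ hp1 _ hp2

theorem energy_eq_of_integrable {W : EuclideanSpace ℝ (Fin d) → EReal}
    {w : EuclideanSpace ℝ (Fin d) → ℝ} {ν : Measure (EuclideanSpace ℝ (Fin d))}
    (hw : Integrable (fun p => w (p.1 - p.2)) (ν.prod ν))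
    (hW : ∀ᵐ p ∂ν.prod ν, W (p.1 - p.2) = (w (p.1 - p.2) : EReal)) :
    energy W ν = ((1 / 2 * ∫ p, w (p.1 - p.2) ∂ν.prod ν : ℝ) : EReal) := by
  have h1 : ∫⁻ p, (W (p.1 - p.2)).toENNReal ∂ν.prod ν
      = ∫⁻ p, ENNReal.ofReal (w (p.1 - p.2)) ∂ν.prod ν :=
    lintegral_congr_ae (hW.mono fun p hp => by simp [hp])
  have h2 : ∫⁻ p, (-W (p.1 - p.2)).toENNReal ∂ν.prod ν
      = ∫⁻ p, ENNReal.ofReal (-w (p.1 - p.2)) ∂ν.prod ν :=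
    lintegral_congr_ae (hW.mono fun p hp => by simp [hp, ← EReal.coe_neg])
  have f1 : ∫⁻ p, ENNReal.ofReal (w (p.1 - p.2)) ∂ν.prod ν ≠ ⊤ := hw.lintegral_lt_top.ne
  have f2 : ∫⁻ p, ENNReal.ofReal (-w (p.1 - p.2)) ∂ν.prod ν ≠ ⊤ := hw.neg.lintegral_lt_top.ne
  rw [energy, h1, h2, integral_eq_lintegral_pos_part_sub_lintegral_neg_part hw,
    ← EReal.coe_ennreal_toReal f1, ← EReal.coe_ennreal_toReal f2]
  norm_cast

theorem energy_ne_top {W : EuclideanSpace ℝ (Fin d) → EReal}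
    {ν : Measure (EuclideanSpace ℝ (Fin d))}
    (h : ∫⁻ p, (W (p.1 - p.2)).toENNReal ∂ν.prod ν ≠ ⊤) : energy W ν ≠ ⊤ := by
  rw [energy, ← EReal.coe_ennreal_toReal h]
  generalize (∫⁻ p, (-W (p.1 - p.2)).toENNReal ∂ν.prod ν) = b
  rcases eq_or_ne b ⊤ with rfl | hb
  · rw [EReal.coe_ennreal_top, EReal.sub_top, EReal.coe_mul_bot_of_pos (by norm_num)]
    exact bot_ne_top
  · rw [← EReal.coe_ennreal_toReal hb, ← EReal.coe_sub, ← EReal.coe_mul]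
    exact EReal.coe_ne_top _

theorem lintegral_ne_top_of_energy_ne_top {W : EuclideanSpace ℝ (Fin d) → EReal}
    {ν : Measure (EuclideanSpace ℝ (Fin d))} [IsProbabilityMeasure ν] {C : ℝ}
    (hlow : ∀ x, ((-C : ℝ) : EReal) ≤ W x) (h : energy W ν ≠ ⊤) :
    ∫⁻ p, (W (p.1 - p.2)).toENNReal ∂ν.prod ν ≠ ⊤ := by
  have hneg : ∫⁻ p, (-W (p.1 - p.2)).toENNReal ∂ν.prod ν ≠ ⊤ := by
    refine ne_top_of_le_ne_top (b := ENNReal.ofReal C) ENNReal.ofReal_ne_top ?_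
    calc _ ≤ ∫⁻ _, ENNReal.ofReal C ∂ν.prod ν := by
          refine lintegral_mono fun p => ?_
          rw [← EReal.real_coe_toENNReal]
          refine EReal.toENNReal_le_toENNReal ?_
          rw [EReal.neg_le, ← EReal.coe_neg]
          exact hlow _
      _ = _ := by simp
  intro htop
  refine h ?_
  rw [energy, htop, ← EReal.coe_ennreal_toReal hneg, EReal.coe_ennreal_top, EReal.top_sub_coe,
    EReal.coe_mul_top_of_pos (by norm_num)]

/-- The lower bound makes the negative part integrable, so finite energy forces the positive part to
be integrable too. That positive part is infinite on the diagonal, which must therefore be null. -/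
theorem integrable_of_energy_ne_top {W : EuclideanSpace ℝ (Fin d) → EReal}
    {w : EuclideanSpace ℝ (Fin d) → ℝ} (hw : Measurable w)
    (hW0 : W 0 = ⊤) (hW : ∀ x, x ≠ 0 → W x = (w x : EReal))
    {ν : Measure (EuclideanSpace ℝ (Fin d))} [IsProbabilityMeasure ν] {C : ℝ}
    (hlow : ∀ x, ((-C : ℝ) : EReal) ≤ W x) (h : energy W ν ≠ ⊤) :
    (∀ᵐ p ∂ν.prod ν, p.1 - p.2 ≠ 0) ∧ Integrable (fun p => w (p.1 - p.2)) (ν.prod ν) := by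
  have hpos := lintegral_ne_top_of_energy_ne_top hlow h
  have hWm : Measurable W := by
    have : W = fun x => if x = 0 then ⊤ else (w x : EReal) := by
      funext x
      split_ifs with hx
      · rw [hx, hW0]
      · exact hW x hx
    rw [this]
    exact Measurable.ite (measurableSet_singleton 0) measurable_const hw.coe_real_ereal
  have hsub : Measurable fun p : EuclideanSpace ℝ (Fin d) × EuclideanSpace ℝ (Fin d) =>
    p.1 - p.2 := measurable_fst.sub measurable_snd
  have hne : ∀ᵐ p ∂ν.prod ν, p.1 - p.2 ≠ 0 := by
    filter_upwards [ae_lt_top (hWm.comp hsub).ereal_toENNReal hpos] with p hp h0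
    simp [h0, hW0] at hp
  refine ⟨hne, (hw.comp hsub).aestronglyMeasurable, ?_⟩
  calc ∫⁻ p, ‖w (p.1 - p.2)‖ₑ ∂ν.prod ν
      ≤ ∫⁻ p, ((W (p.1 - p.2)).toENNReal + ENNReal.ofReal (|C|)) ∂ν.prod ν := by
        refine lintegral_mono_ae (hne.mono fun p hp => ?_)
        have h1 := hlow (p.1 - p.2)
        rw [hW _ hp] at h1 ⊢
        rw [EReal.coe_le_coe_iff] at h1
        rw [EReal.real_coe_toENNReal, Real.enorm_eq_ofReal_abs]
        rcases le_total 0 (w (p.1 - p.2)) with h2 | h2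
        · rw [abs_of_nonneg h2]
          exact le_self_add
        · rw [abs_of_nonpos h2]
          refine le_add_left (ENNReal.ofReal_le_ofReal ?_)
          exact (by linarith [le_abs_self C])
    _ = ∫⁻ p, (W (p.1 - p.2)).toENNReal ∂ν.prod ν + ENNReal.ofReal (|C|) := by
        rw [lintegral_add_right _ measurable_const]
        simp
    _ < ⊤ := ENNReal.add_lt_top.2 ⟨hpos.lt_top, ENNReal.ofReal_lt_top⟩

/-! ### The real-valued potential, its Gaussian series and the thresholds -/

/-- The Gaussian profile `lam^{γ(k+1)} exp(-r²/(2 lam^{2(k+1)}))` of the series in the potential. -/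
noncomputable def gaussTerm (γ lam : ℝ) (k : ℕ) (r : ℝ) : ℝ :=
  lam ^ (γ * ((k : ℝ) + 1)) * Real.exp (-r ^ 2 / (2 * lam ^ (2 * (k + 1))))

/-- The real-valued formula that defines the potential away from its singularity. -/
noncomputable def realPotential (d : ℕ) (α cW lam : ℝ) (x : EuclideanSpace ℝ (Fin d)) : ℝ :=
  rieszKernel d α x + ‖x‖ ^ 2 / 2 - cW * ∑' k : ℕ, gaussTerm (α - d) lam k ‖x‖

variable {α cW lam : ℝ}

theorem potential_zero (h : α ≤ d) : potential d α cW lam 0 = ⊤ := by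
  simp [potential, h]

theorem potential_of_ne {x : EuclideanSpace ℝ (Fin d)} (hx : x ≠ 0) :
    potential d α cW lam x = (realPotential d α cW lam x : EReal) := by
  simp [potential, hx, realPotential, gaussTerm]

theorem potential_of_lt (h : (d : ℝ) < α) (x : EuclideanSpace ℝ (Fin d)) :
    potential d α cW lam x = (realPotential d α cW lam x : EReal) := by
  simp [potential, not_le.2 h, realPotential, gaussTerm]

theorem gaussTerm_nonneg (hl : 0 < lam) (γ : ℝ) (k : ℕ) (r : ℝ) : 0 ≤ gaussTerm γ lam k r := by
  unfold gaussTerm; positivity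

theorem measurable_gaussTerm (γ lam : ℝ) (k : ℕ) : Measurable (gaussTerm γ lam k) := by
  unfold gaussTerm; fun_prop

theorem measurable_rieszKernel (d : ℕ) (α : ℝ) : Measurable (rieszKernel d α) := by
  unfold rieszKernel
  split_ifs
  · fun_prop
  · exact (measurable_norm.pow_const _).const_mul _

theorem measurable_realPotential (hl : 0 < lam) : Measurable (realPotential d α cW lam) := by
  -- This holds even where the series diverges: both the real `tsum` and `toReal` of infinity then
  -- default to `0`.
  have h : ∀ x : EuclideanSpace ℝ (Fin d), ∑' k : ℕ, gaussTerm (α - d) lam k ‖x‖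
      = (∑' k : ℕ, ENNReal.ofReal (gaussTerm (α - d) lam k ‖x‖)).toReal := fun x => by
    rw [ENNReal.tsum_toReal_eq fun _ => ENNReal.ofReal_ne_top]
    exact tsum_congr fun k => (ENNReal.toReal_ofReal (gaussTerm_nonneg hl _ _ _)).symm
  unfold realPotential
  simp_rw [h]
  have hm : Measurable fun x : EuclideanSpace ℝ (Fin d) =>
      ∑' k : ℕ, ENNReal.ofReal (gaussTerm (α - d) lam k ‖x‖) :=
    Measurable.tsum fun k =>
      ((measurable_gaussTerm _ _ k).comp measurable_norm).ennreal_ofReal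
  have := measurable_rieszKernel d α
  have := hm.ennreal_toReal
  fun_prop

/-- The right side is the maximum over `s`, attained at `s = √a`. It follows from `t ≤ exp (t - 1)`
at `t = s² / a`, raised to the power `a / 2`. -/
theorem rpow_mul_exp_le {a s : ℝ} (ha : 0 < a) (hs : 0 < s) :
    s ^ a * Real.exp (-s ^ 2 / 2) ≤ (a / Real.exp 1) ^ (a / 2) := by
  have hu : s ^ 2 / a ≤ Real.exp (s ^ 2 / a - 1) := by
    have := Real.add_one_le_exp (s ^ 2 / a - 1); linarith
  have h1 : (s ^ 2 / a) ^ (a / 2) ≤ Real.exp (s ^ 2 / 2 - a / 2) := by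
    calc (s ^ 2 / a) ^ (a / 2) ≤ (Real.exp (s ^ 2 / a - 1)) ^ (a / 2) :=
          Real.rpow_le_rpow (by positivity) hu (by positivity)
      _ = _ := by rw [← Real.exp_mul]; congr 1; field_simp
  have h2 : s ^ a = a ^ (a / 2) * (s ^ 2 / a) ^ (a / 2) := by
    rw [← Real.mul_rpow ha.le (by positivity), mul_div_cancel₀ _ ha.ne', ← Real.rpow_natCast,
      ← Real.rpow_mul hs.le]
    congr 1; push_cast; ring
  have h3 : (a / Real.exp 1) ^ (a / 2) = a ^ (a / 2) * Real.exp (-(a / 2)) := by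
    rw [Real.div_rpow ha.le (Real.exp_pos _).le, ← Real.exp_mul, Real.exp_neg, one_mul]
    rfl
  rw [h2, h3, mul_assoc]
  refine mul_le_mul_of_nonneg_left ?_ (by positivity)
  calc _ ≤ Real.exp (s ^ 2 / 2 - a / 2) * Real.exp (-s ^ 2 / 2) := by gcongr
    _ = _ := by rw [← Real.exp_add]; congr 1; ring

theorem logConst_pos (hα : 0 < α) : 0 < logConst d α := by
  have := Real.Gamma_pos_of_pos (half_pos hα)
  unfold logConst
  positivity

theorem rieszConst_neg (hα : (d : ℝ) < α) (h : α < d + 2) : rieszConst d α < 0 := by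
  have h0 : 0 < α := lt_of_le_of_lt (Nat.cast_nonneg d) hα
  have h1 := Real.Gamma_pos_of_pos (half_pos h0)
  have h2 : 0 < Real.Gamma (((d : ℝ) - α) / 2 + 1) := Real.Gamma_pos_of_pos (by linarith)
  rw [Real.Gamma_add_one (by linarith)] at h2
  have h3 : Real.Gamma (((d : ℝ) - α) / 2) < 0 := by
    by_contra! h4
    exact absurd (mul_nonpos_of_nonpos_of_nonneg (by linarith : ((d : ℝ) - α) / 2 ≤ 0) h4)
      (not_le.2 h2)
  unfold rieszConst
  exact div_neg_of_neg_of_pos h3 (by positivity)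

theorem lowerThreshold_pos (hα : 0 < α) : 0 < lowerThreshold d α := by
  unfold lowerThreshold; positivity

/-- The threshold is stated through the maximum `B` of `s^(q+2) exp(-s²/2)`, with `q = d - α`. The
positivity of `W` needs the maximum `A` of `s^q exp(-s²/2)`, and `q * A ≤ B` because `q * A` is a
value of the first function. -/
theorem mul_lt_rieszConst (hc : 0 < cW) (hα : α < d) (h : cW < upperThreshold d α) :
    cW * (((d : ℝ) - α) / Real.exp 1) ^ (((d : ℝ) - α) / 2) < rieszConst d α := by
  obtain ⟨q, hq⟩ : ∃ q : ℝ, q = d - α := ⟨_, rfl⟩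
  have hq0 : 0 < q := by linarith
  have e1 : (d : ℝ) + 2 - α = q + 2 := by linarith
  rw [upperThreshold, if_neg hα.ne, e1, ← hq] at h
  rw [← hq]
  -- The point `√q` is the maximizer of `s^q exp(-s²/2)`; the extra factor `s²` there equals `q`.
  have h1 := rpow_mul_exp_le (a := q + 2) (s := √q) (by linarith) (Real.sqrt_pos.2 hq0)
  rw [Real.sq_sqrt hq0.le, Real.sqrt_eq_rpow, ← Real.rpow_mul hq0.le] at h1
  have h2 : q ^ (1 / 2 * (q + 2)) * Real.exp (-q / 2) = q * (q / Real.exp 1) ^ (q / 2) := by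
    rw [Real.div_rpow hq0.le (Real.exp_pos _).le, ← Real.exp_mul,
      show 1 / 2 * (q + 2) = q / 2 + 1 by ring, Real.rpow_add hq0, Real.rpow_one, neg_div,
      Real.exp_neg, one_mul]
    ring
  rw [h2] at h1
  set A := (q / Real.exp 1) ^ (q / 2)
  have hB : (Real.exp 1 / (q + 2)) ^ ((q + 2) / 2)
      = (((q + 2) / Real.exp 1) ^ ((q + 2) / 2))⁻¹ := by
    rw [← Real.inv_rpow (by positivity), inv_div]
  rw [hB] at h
  have hBpos : 0 < ((q + 2) / Real.exp 1) ^ ((q + 2) / 2) := by positivity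
  set B := ((q + 2) / Real.exp 1) ^ ((q + 2) / 2)
  have h3 : cW * B < rieszConst d α * q := by
    have := mul_lt_mul_of_pos_right h hBpos
    calc cW * B < B⁻¹ * (rieszConst d α * q) * B := this
      _ = _ := by field_simp
  nlinarith [mul_le_mul_of_nonneg_left h1 hc.le]

theorem exp_neg_le_factorial_div_pow {x : ℝ} (hx : 0 < x) (n : ℕ) :
    Real.exp (-x) ≤ n.factorial / x ^ n := by
  have := Real.pow_div_factorial_le_exp x hx.le n
  rw [Real.exp_neg, inv_le_comm₀ (Real.exp_pos _) (by positivity), inv_div]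
  exact this

theorem summable_gaussTerm_of_pos {γ : ℝ} (hγ : 0 < γ) (hl : 0 < lam) (hl1 : lam < 1) (r : ℝ) :
    Summable fun k => gaussTerm γ lam k r := by
  have hq1 : lam ^ γ < 1 := Real.rpow_lt_one hl.le hl1 hγ
  refine Summable.of_nonneg_of_le (fun k => gaussTerm_nonneg hl _ _ _) (fun k => ?_)
    (((summable_geometric_of_lt_one (by positivity) hq1).comp_injective
      (add_left_injective 1)))
  calc gaussTerm γ lam k r ≤ lam ^ (γ * ((k : ℝ) + 1)) * 1 := by
        unfold gaussTerm
        gcongr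
        exact Real.exp_le_one_iff.2 (div_nonpos_of_nonpos_of_nonneg (by nlinarith) (by positivity))
    _ = _ := by
        rw [mul_one, Real.rpow_mul hl.le]
        simp [← Real.rpow_natCast]

/-- For `γ ≤ 0` the prefactors do not decay. Bounding the exponential by the `n`-th inverse power of
its argument gains `lam^(2n(k+1))`, and `n` is chosen with `γ + 2n > 0`. -/
theorem summable_gaussTerm_of_ne (γ : ℝ) (hl : 0 < lam) (hl1 : lam < 1) {r : ℝ} (hr : r ≠ 0) :
    Summable fun k => gaussTerm γ lam k r := by
  obtain ⟨n, hn⟩ := exists_nat_gt (-γ / 2)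
  have hγn : 0 < γ + 2 * n := by linarith
  have hq1 : lam ^ (γ + 2 * n) < 1 := Real.rpow_lt_one hl.le hl1 hγn
  refine Summable.of_nonneg_of_le (fun k => gaussTerm_nonneg hl _ _ _) (fun k => ?_)
    ((((summable_geometric_of_lt_one (by positivity) hq1).comp_injective
      (add_left_injective 1))).mul_left (n.factorial * (2 / r ^ 2) ^ n))
  have hx : 0 < r ^ 2 / (2 * lam ^ (2 * (k + 1))) := by positivity
  have e1 : lam ^ (γ * ((k : ℝ) + 1)) * (lam ^ (2 * (k + 1))) ^ n
      = (lam ^ (γ + 2 * n)) ^ (k + 1) := by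
    rw [← Real.rpow_natCast, ← Real.rpow_natCast, ← Real.rpow_natCast, ← Real.rpow_mul hl.le,
      ← Real.rpow_mul hl.le, ← Real.rpow_add hl]
    congr 1; push_cast; ring
  calc gaussTerm γ lam k r
      ≤ lam ^ (γ * ((k : ℝ) + 1)) * (n.factorial / (r ^ 2 / (2 * lam ^ (2 * (k + 1)))) ^ n) := by
        unfold gaussTerm
        rw [neg_div]
        gcongr
        exact exp_neg_le_factorial_div_pow hx n
    _ = n.factorial * (2 / r ^ 2) ^ n *
        (lam ^ (γ * ((k : ℝ) + 1)) * (lam ^ (2 * (k + 1))) ^ n) := by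
        rw [div_pow, div_pow, mul_pow]
        field_simp
    _ = _ := by rw [e1]; rfl

theorem realPotential_le (hl : 0 < lam) (hc : 0 < cW) (x : EuclideanSpace ℝ (Fin d)) :
    realPotential d α cW lam x ≤ rieszKernel d α x + ‖x‖ ^ 2 / 2 := by
  have : 0 ≤ ∑' k : ℕ, gaussTerm (α - d) lam k ‖x‖ := tsum_nonneg fun k => gaussTerm_nonneg hl _ _ _
  unfold realPotential
  nlinarith [mul_nonneg hc.le this]

theorem abs_realPotential_le_of_lt (hα : (d : ℝ) < α) (hl : 0 < lam) (hl1 : lam < 1) (hc : 0 < cW)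
    {R : ℝ} {x : EuclideanSpace ℝ (Fin d)} (hx : ‖x‖ ≤ R) :
    |realPotential d α cW lam x| ≤
      |rieszConst d α| * R ^ (α - d) + R ^ 2 / 2 + cW * ∑' k : ℕ, gaussTerm (α - d) lam k 0 := by
  have hs := summable_gaussTerm_of_pos (sub_pos.2 hα) hl hl1
  have h0 : 0 ≤ ∑' k : ℕ, gaussTerm (α - d) lam k ‖x‖ :=
    tsum_nonneg fun k => gaussTerm_nonneg hl _ _ _
  have h1 : ∑' k : ℕ, gaussTerm (α - d) lam k ‖x‖ ≤ ∑' k : ℕ, gaussTerm (α - d) lam k 0 := by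
    refine (hs _).tsum_le_tsum (fun k => ?_) (hs _)
    unfold gaussTerm
    gcongr
    simp
  have h2 : |rieszKernel d α x| ≤ |rieszConst d α| * R ^ (α - d) := by
    rw [rieszKernel, if_neg hα.ne', abs_mul, abs_of_nonneg (a := ‖x‖ ^ (α - (d : ℝ))) (by positivity)]
    gcongr
  have h3 : ‖x‖ ^ 2 ≤ R ^ 2 := by gcongr
  have h4 := mul_le_mul_of_nonneg_left h1 hc.le
  have h5 := mul_nonneg hc.le h0
  have h6 := abs_le.1 h2
  rw [abs_le]
  unfold realPotential
  constructor <;> nlinarith [sq_nonneg ‖x‖]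

/-! ### Separation of scales for small `lam` -/

/-- The argument of `f` is the ratio of the radius `lam^θ` to the scale `lam^(k+1)`. Only the scale
nearest to the radius, `k + 1 = round θ`, is not small. A scale `j` steps from it has exponent at
least `|j| - 1/2` in absolute value, so the decay of `f` at `0` and `∞` bounds the other terms by
two geometric series, which vanish as `lam → 0`. -/
theorem tsum_scales_le {f : ℝ → ℝ} {q θ M C : ℝ} (hq : 0 < q) (hl : 0 < lam) (hl1 : lam < 1)
    (hC : 0 ≤ C) (hf0 : ∀ s, 0 < s → 0 ≤ f s) (hf1 : ∀ s, 0 < s → f s ≤ C * s ^ q)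
    (hf2 : ∀ s, 0 < s → f s ≤ C * s ^ (-q))
    (hM : ∀ k : ℕ, (k : ℤ) + 1 = round θ → f (lam ^ (θ - ((k : ℝ) + 1))) ≤ M) (hM0 : 0 ≤ M) :
    ∑' k : ℕ, f (lam ^ (θ - ((k : ℝ) + 1))) ≤ M + 2 * C * lam ^ (q / 2) / (1 - lam ^ q) := by
  have hq1 : lam ^ q < 1 := Real.rpow_lt_one hl.le hl1 hq
  set a : ℤ → ℝ := fun j => if j = 0 then M else C * lam ^ (q * (|(j : ℝ)| - 1 / 2)) with ha
  have hgeo : HasSum (fun n : ℕ => C * lam ^ (q / 2) * (lam ^ q) ^ n)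
      (C * lam ^ (q / 2) * (1 - lam ^ q)⁻¹) :=
    (hasSum_geometric_of_lt_one (by positivity) hq1).mul_left _
  have key : ∀ n : ℕ, C * lam ^ (q * (|((n : ℝ) + 1)| - 1 / 2))
      = C * lam ^ (q / 2) * (lam ^ q) ^ n := fun n => by
    rw [abs_of_nonneg (by positivity), ← Real.rpow_natCast, ← Real.rpow_mul hl.le, mul_assoc,
      ← Real.rpow_add hl]
    congr 2; ring
  have hpos : HasSum (fun n : ℕ => a n) (C * lam ^ (q / 2) * (1 - lam ^ q)⁻¹ + M) := by
    have h1 : HasSum (fun n : ℕ => a ((n + 1 : ℕ) : ℤ)) (C * lam ^ (q / 2) * (1 - lam ^ q)⁻¹) := by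
      refine hgeo.congr_fun ?_
      intro n
      have : ((n + 1 : ℕ) : ℤ) ≠ 0 := by positivity
      simp only [ha, if_neg this]
      rw [← key n]; push_cast; rfl
    have h2 := (hasSum_nat_add_iff (f := fun n : ℕ => a n) 1).1 h1
    simpa [ha] using h2
  have hneg : HasSum (fun n : ℕ => a (-((n : ℤ) + 1))) (C * lam ^ (q / 2) * (1 - lam ^ q)⁻¹) := by
    refine hgeo.congr_fun ?_
    intro n
    have : -((n : ℤ) + 1) ≠ 0 := by omega
    simp only [ha, if_neg this]
    rw [← key n]; push_cast; rw [abs_neg]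
  have hsum := HasSum.of_nat_of_neg_add_one hpos hneg
  have ha0 : ∀ j, 0 ≤ a j := fun j => by
    simp only [ha]; split_ifs <;> positivity
  have hinj : Function.Injective fun k : ℕ => (k : ℤ) + 1 - round θ := fun k l h => by
    simpa using h
  have hle : ∀ k : ℕ, f (lam ^ (θ - ((k : ℝ) + 1))) ≤ a ((k : ℤ) + 1 - round θ) := fun k => by
    have hs : 0 < lam ^ (θ - ((k : ℝ) + 1)) := by positivity
    have hr := abs_le.1 (abs_sub_round θ)
    rcases lt_trichotomy ((k : ℤ) + 1 - round θ) 0 with h | h | h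
    · simp only [ha, if_neg h.ne]
      refine (hf1 _ hs).trans ?_
      rw [← Real.rpow_mul hl.le]
      refine mul_le_mul_of_nonneg_left (Real.rpow_le_rpow_of_exponent_ge hl hl1.le ?_) hC
      rw [abs_of_neg (by exact_mod_cast h), mul_comm]
      push_cast
      nlinarith
    · simp only [ha, if_pos h]
      exact hM k (by omega)
    · simp only [ha, if_neg h.ne']
      refine (hf2 _ hs).trans ?_
      rw [← Real.rpow_mul hl.le]
      refine mul_le_mul_of_nonneg_left (Real.rpow_le_rpow_of_exponent_ge hl hl1.le ?_) hC
      rw [abs_of_pos (by exact_mod_cast h)]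
      push_cast
      nlinarith
  have hcomp : Summable fun k : ℕ => a ((k : ℤ) + 1 - round θ) := hsum.summable.comp_injective hinj
  calc _ ≤ ∑' k : ℕ, a ((k : ℤ) + 1 - round θ) :=
        (Summable.of_nonneg_of_le (fun k => hf0 _ (by positivity)) hle hcomp).tsum_le_tsum hle hcomp
    _ ≤ ∑' j, a j := tsum_comp_le_tsum_of_inj hsum.summable ha0 hinj
    _ = _ := by rw [hsum.tsum_eq]; ring

theorem tendsto_geometric_tail {q : ℝ} (hq : 0 < q) :
    Tendsto (fun lam : ℝ => lam ^ (q / 2) / (1 - lam ^ q)) (𝓝[>] 0) (𝓝 0) := by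
  have h : ∀ p : ℝ, 0 < p → Tendsto (fun lam : ℝ => lam ^ p) (𝓝[>] 0) (𝓝 0) := fun p hp => by
    have := (Real.continuousAt_rpow_const 0 p (Or.inr hp.le)).tendsto
    rw [Real.zero_rpow hp.ne'] at this
    exact this.mono_left nhdsWithin_le_nhds
  have h1 := (h (q / 2) (by positivity)).div ((h q hq).const_sub 1) (by norm_num)
  rw [zero_div] at h1
  exact h1

theorem gaussTerm_rpow (hl : 0 < lam) (γ θ : ℝ) (k : ℕ) :
    gaussTerm γ lam k (lam ^ θ) = (lam ^ θ) ^ γ *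
      ((lam ^ (θ - ((k : ℝ) + 1))) ^ (-γ) * Real.exp (-(lam ^ (θ - ((k : ℝ) + 1))) ^ 2 / 2)) := by
  have e1 : (lam ^ θ) ^ 2 / (2 * lam ^ (2 * (k + 1))) = (lam ^ (θ - ((k : ℝ) + 1))) ^ 2 / 2 := by
    have : lam ^ (k + 1) = lam ^ ((k : ℝ) + 1) := by
      rw [← Real.rpow_natCast]; push_cast; rfl
    rw [Real.rpow_sub hl, pow_mul', this]
    have : lam ^ ((k : ℝ) + 1) ≠ 0 := by positivity
    field_simp
  rw [gaussTerm, neg_div, e1, ← mul_assoc, ← Real.rpow_mul hl.le, ← Real.rpow_mul hl.le,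
    ← Real.rpow_add hl, neg_div]
  congr 2; ring

theorem exists_rpow_eq (hl : 0 < lam) (hl1 : lam < 1) {r : ℝ} (hr : 0 < r) :
    ∃ θ : ℝ, lam ^ θ = r :=
  ⟨Real.logb lam r, Real.rpow_logb hl hl1.ne hr⟩

/-- With `q = d - α`, factoring `‖x‖^(-q)` out of the series leaves `s^q exp(-s²/2)` at the scale
ratios. The nearest scale contributes at most the maximum `M`, the others are negligible, and `cW *
M` is below the Riesz constant. -/
theorem eventually_realPotential_nonneg (hα : α < d) (hc : 0 < cW)
    (h : cW < upperThreshold d α) :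
    ∀ᶠ lam in 𝓝[>] (0 : ℝ), ∀ x : EuclideanSpace ℝ (Fin d), x ≠ 0 →
      0 ≤ realPotential d α cW lam x := by
  obtain ⟨q, hq⟩ : ∃ q : ℝ, q = d - α := ⟨_, rfl⟩
  have hq0 : 0 < q := by linarith
  have hM := mul_lt_rieszConst hc hα h
  rw [← hq] at hM
  set M := (q / Real.exp 1) ^ (q / 2)
  have hM0 : 0 ≤ M := by positivity
  -- The first entry gives the decay `s^q` near zero. The second is the maximum of `s^(2q)
  -- exp(-s²/2)` and gives the decay `s^(-q)` at infinity.
  set C := max 1 (((2 * q) / Real.exp 1) ^ ((2 * q) / 2))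
  have hC0 : 0 ≤ C := zero_le_one.trans (le_max_left _ _)
  have hlim : Tendsto (fun lam : ℝ => cW * (M + 2 * C * (lam ^ (q / 2) / (1 - lam ^ q))))
      (𝓝[>] 0) (𝓝 (cW * (M + 2 * C * 0))) :=
    ((((tendsto_geometric_tail hq0).const_mul _).const_add _).const_mul _)
  rw [mul_zero, add_zero] at hlim
  filter_upwards [hlim.eventually_lt_const hM, self_mem_nhdsWithin,
    nhdsWithin_le_nhds (Iio_mem_nhds zero_lt_one)] with lam hlam hl hl1 x hx
  replace hl : 0 < lam := hl
  replace hl1 : lam < 1 := hl1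
  have hx0 : 0 < ‖x‖ := norm_pos_iff.2 hx
  obtain ⟨θ, hθ⟩ := exists_rpow_eq hl hl1 hx0
  have hsum := tsum_scales_le (f := fun s => s ^ q * Real.exp (-s ^ 2 / 2)) (q := q) (θ := θ)
    (M := M) (C := C) hq0 hl hl1 hC0 (fun s hs => by positivity)
    (fun s hs => by
      rw [mul_comm]
      refine mul_le_mul_of_nonneg_right ?_ (by positivity)
      exact (Real.exp_le_one_iff.2 (by nlinarith)).trans (le_max_left _ _))
    (fun s hs => by
      rw [Real.rpow_neg hs.le, ← div_eq_mul_inv, le_div_iff₀ (by positivity)]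
      calc s ^ q * Real.exp (-s ^ 2 / 2) * s ^ q = s ^ (2 * q) * Real.exp (-s ^ 2 / 2) := by
            rw [two_mul, Real.rpow_add hs]; ring
        _ ≤ C := (rpow_mul_exp_le (by positivity) hs).trans (le_max_right _ _))
    (fun k _ => rpow_mul_exp_le hq0 (by positivity)) hM0
  have e : α - d = -q := by linarith
  rw [realPotential, rieszKernel, if_neg hα.ne, e, ← hθ]
  simp_rw [gaussTerm_rpow hl, neg_neg]
  rw [tsum_mul_left]
  have hr : 0 < (lam ^ θ) ^ (-q) := by positivity
  rw [mul_div_assoc] at hsum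
  have h2 := mul_le_mul_of_nonneg_left hsum hc.le
  nlinarith [sq_nonneg (lam ^ θ)]

/-- About `θ = log ‖x‖ / log lam` scales exceed the radius, each costing at most `cW`, while the
logarithmic kernel equals `θ` times `logConst d α * |log lam|`. The kernel wins once `lam` is small
enough; the finer scales sum to a constant. -/
theorem eventually_realPotential_ge (hα0 : 0 < α) (hα : α = d) (hc : 0 < cW) :
    ∀ᶠ lam in 𝓝[>] (0 : ℝ), ∃ C : ℝ, ∀ x : EuclideanSpace ℝ (Fin d), x ≠ 0 →
      -C ≤ realPotential d α cW lam x := by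
  have hL : 0 < logConst d α := logConst_pos hα0
  filter_upwards [Real.tendsto_log_nhdsGT_zero.eventually_lt_atBot (-(cW / logConst d α)),
    self_mem_nhdsWithin, nhdsWithin_le_nhds (Iio_mem_nhds zero_lt_one)] with lam hlam hl hl1
  replace hl : 0 < lam := hl
  replace hl1 : lam < 1 := hl1
  have hlog : Real.log lam < 0 := Real.log_neg hl hl1
  have hq1 : lam ^ 2 < 1 := by nlinarith
  refine ⟨logConst d α ^ 2 / 2 + cW * (2 * (1 - lam ^ 2)⁻¹), fun x hx => ?_⟩
  have hx0 : 0 < ‖x‖ := norm_pos_iff.2 hx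
  obtain ⟨θ, hθ⟩ := exists_rpow_eq hl hl1 hx0
  have hlx : Real.log ‖x‖ = θ * Real.log lam := by rw [← hθ, Real.log_rpow hl]
  have hs := summable_gaussTerm_of_ne 0 hl hl1 hx0.ne'
  have hterm : ∀ k, gaussTerm 0 lam k ‖x‖ = Real.exp (-(lam ^ (θ - ((k : ℝ) + 1))) ^ 2 / 2) :=
    fun k => by rw [← hθ, gaussTerm_rpow hl]; simp
  have h1 : ∑ k ∈ Finset.range ⌊θ⌋₊, gaussTerm 0 lam k ‖x‖ ≤ ⌊θ⌋₊ := by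
    calc _ ≤ ∑ k ∈ Finset.range ⌊θ⌋₊, (1 : ℝ) := Finset.sum_le_sum fun k _ => by
          rw [hterm]
          exact Real.exp_le_one_iff.2 (by nlinarith [sq_nonneg (lam ^ (θ - ((k : ℝ) + 1)))])
      _ = _ := by simp
  have hgeo := (hasSum_geometric_of_lt_one (sq_nonneg lam) hq1).mul_left 2
  have h2 : ∑' k, gaussTerm 0 lam (k + ⌊θ⌋₊) ‖x‖ ≤ 2 * (1 - lam ^ 2)⁻¹ := by
    rw [← hgeo.tsum_eq]
    refine ((summable_nat_add_iff _).2 hs).tsum_le_tsum (fun k => ?_) hgeo.summable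
    rw [hterm, neg_div]
    have hpos : 0 < lam ^ (θ - (((k + ⌊θ⌋₊ : ℕ) : ℝ) + 1)) := by positivity
    refine (exp_neg_le_factorial_div_pow (by positivity) 1).trans ?_
    have h3 : (lam ^ k)⁻¹ ≤ lam ^ (θ - (((k + ⌊θ⌋₊ : ℕ) : ℝ) + 1)) := by
      rw [← Real.rpow_natCast, ← Real.rpow_neg hl.le]
      refine Real.rpow_le_rpow_of_exponent_ge hl hl1.le ?_
      push_cast
      linarith [Nat.lt_floor_add_one θ]
    have hk : 0 < lam ^ k := by positivity
    rw [Nat.factorial_one, Nat.cast_one, pow_one, one_div_div, ← pow_mul, mul_comm 2 k, pow_mul,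
      div_eq_mul_inv]
    refine mul_le_mul_of_nonneg_left ?_ (by norm_num)
    rw [← inv_pow]
    refine pow_le_pow_left₀ (by positivity) ?_ 2
    exact inv_le_of_inv_le₀ hk h3
  have hsplit := hs.sum_add_tsum_nat_add ⌊θ⌋₊
  have e : α - d = 0 := by linarith
  rw [realPotential, rieszKernel, if_pos hα, e, ← hsplit]
  have h5 : -(logConst d α ^ 2 / 2) ≤
      -logConst d α * Real.log ‖x‖ + ‖x‖ ^ 2 / 2 - cW * ⌊θ⌋₊ := by
    -- Here `θ ≤ 0` means `‖x‖ ≥ 1`: no coarse scale occurs, and the confining term `‖x‖² / 2`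
    -- absorbs the negative logarithm by completing the square.
    rcases le_total θ 0 with h | h
    · rw [Nat.floor_of_nonpos h, Nat.cast_zero, mul_zero]
      nlinarith [Real.log_le_self hx0.le, sq_nonneg (‖x‖ - logConst d α)]
    · have h6 : (⌊θ⌋₊ : ℝ) ≤ θ := Nat.floor_le h
      have h7 : cW < -(Real.log lam) * logConst d α := by
        rw [← div_lt_iff₀ hL]; linarith
      rw [hlx]
      nlinarith [mul_le_mul_of_nonneg_left h6 hc.le, mul_nonneg h (sub_nonneg.2 h7.le),
        sq_nonneg ‖x‖, sq_nonneg (logConst d α)]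
  nlinarith [mul_le_mul_of_nonneg_left (add_le_add h1 h2) hc.le]

/-- The radius `lam^(n+1/2)` is the geometric mean of `lam^n` and `lam^(n+1)`, so every scale ratio
is far from `1`. There `f s = s^(-γ) (1 - exp(-s²/2))` is small, by the first bound for large `s`
and the second for small `s` among `s^(-γ)` and `s^(2-γ)`. The increment of the series is thus
negligible against the negative Riesz term. -/
theorem eventually_realPotential_sub_le (hα : (d : ℝ) < α) (hα2 : α < d + 2) (hc : 0 < cW) :
    ∀ᶠ lam in 𝓝[>] (0 : ℝ), ∃ δ : ℝ, 0 < δ ∧ ∀ (n : ℕ) (x : EuclideanSpace ℝ (Fin d)),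
      ‖x‖ = lam ^ ((n : ℝ) + 1 / 2) →
        realPotential d α cW lam x - realPotential d α cW lam 0
          ≤ -δ * ‖x‖ ^ (α - d) + ‖x‖ ^ 2 / 2 := by
  obtain ⟨γ, hγ⟩ : ∃ γ : ℝ, γ = α - d := ⟨_, rfl⟩
  obtain ⟨q, hq0, hqγ, hq2⟩ : ∃ q : ℝ, 0 < q ∧ q ≤ γ ∧ q ≤ 2 - γ :=
    ⟨min γ (2 - γ), lt_min (by linarith) (by linarith), min_le_left _ _, min_le_right _ _⟩
  have hneg := rieszConst_neg hα hα2
  have hlim : Tendsto (fun lam : ℝ => cW * (lam ^ (q / 2) +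
      2 * 1 * (lam ^ (q / 2) / (1 - lam ^ q)))) (𝓝[>] 0) (𝓝 (cW * (0 + 2 * 1 * 0))) := by
    refine (Tendsto.add ?_ ((tendsto_geometric_tail hq0).const_mul _)).const_mul _
    have := (Real.continuousAt_rpow_const 0 (q / 2) (Or.inr (by positivity))).tendsto
    rw [Real.zero_rpow (by positivity)] at this
    exact this.mono_left nhdsWithin_le_nhds
  rw [mul_zero, add_zero, mul_zero] at hlim
  filter_upwards [hlim.eventually_lt_const (neg_pos.2 hneg), self_mem_nhdsWithin,
    nhdsWithin_le_nhds (Iio_mem_nhds zero_lt_one)] with lam hlam hl hl1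
  replace hl : 0 < lam := hl
  replace hl1 : lam < 1 := hl1
  refine ⟨-rieszConst d α - cW * (lam ^ (q / 2) + 2 * 1 * (lam ^ (q / 2) / (1 - lam ^ q))),
    by linarith, fun n x hx => ?_⟩
  obtain ⟨f, hf⟩ : ∃ f : ℝ → ℝ, f = fun s => s ^ (-γ) * (1 - Real.exp (-s ^ 2 / 2)) := ⟨_, rfl⟩
  have hexp : ∀ s : ℝ, 0 ≤ 1 - Real.exp (-s ^ 2 / 2) ∧ 1 - Real.exp (-s ^ 2 / 2) ≤ 1 ∧
      1 - Real.exp (-s ^ 2 / 2) ≤ s ^ 2 := fun s => by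
    refine ⟨?_, ?_, ?_⟩
    · linarith [Real.exp_le_one_iff.2 (by nlinarith : -s ^ 2 / 2 ≤ 0)]
    · linarith [Real.exp_pos (-s ^ 2 / 2)]
    · nlinarith [Real.add_one_le_exp (-s ^ 2 / 2)]
  have hfa : ∀ s, 0 < s → f s ≤ s ^ (-γ) := fun s hs => by
    have h0 : 0 ≤ s ^ (-γ) := by positivity
    rw [hf]
    nlinarith [mul_le_mul_of_nonneg_left (hexp s).2.1 h0]
  have hfb : ∀ s, 0 < s → f s ≤ s ^ (2 - γ) := fun s hs => by
    have h0 : 0 ≤ s ^ (-γ) := by positivity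
    have : s ^ (2 - γ) = s ^ (-γ) * s ^ 2 := by
      rw [← Real.rpow_natCast, ← Real.rpow_add hs]; congr 1; push_cast; ring
    rw [hf, this]
    exact mul_le_mul_of_nonneg_left (hexp s).2.2 h0
  have hf1 : ∀ s, 0 < s → f s ≤ 1 * s ^ q := fun s hs => by
    rw [one_mul]
    rcases le_total s 1 with h | h
    · exact (hfb s hs).trans (Real.rpow_le_rpow_of_exponent_ge hs h hq2)
    · exact (hfa s hs).trans (Real.rpow_le_rpow_of_exponent_le h (by linarith))
  have hf2 : ∀ s, 0 < s → f s ≤ 1 * s ^ (-q) := fun s hs => by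
    rw [one_mul]
    rcases le_total s 1 with h | h
    · exact (hfb s hs).trans (Real.rpow_le_rpow_of_exponent_ge hs h (by linarith))
    · exact (hfa s hs).trans (Real.rpow_le_rpow_of_exponent_le h (by linarith))
  have hsum := tsum_scales_le (f := f) (q := q) (θ := (n : ℝ) + 1 / 2) (M := lam ^ (q / 2))
    (C := 1) hq0 hl hl1 zero_le_one
    (fun s hs => by rw [hf]; exact mul_nonneg (by positivity) (hexp s).1) hf1 hf2
    (fun k hk => by
      have hk' : (k : ℝ) + 1 = n + 1 := by
        -- Rounding sends the half-integer upwards. The term singled out as nearest has ratio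
        -- `lam^(-1/2)`, so it too is bounded by `lam^(q/2)`.
        have : round ((n : ℝ) + 1 / 2) = (n : ℤ) + 1 := by
          rw [round_eq, add_assoc]; norm_num
        rw [this] at hk
        exact_mod_cast hk
      refine (hf2 _ (by positivity)).trans ?_
      rw [one_mul, ← Real.rpow_mul hl.le, hk']
      apply le_of_eq; congr 1; ring) (by positivity)
  have hs := summable_gaussTerm_of_pos (sub_pos.2 hα) hl hl1
  have hdiff : ∑' k, gaussTerm (α - d) lam k 0 - ∑' k, gaussTerm (α - d) lam k ‖x‖
      = ‖x‖ ^ (α - d) * ∑' k : ℕ, f (lam ^ ((n : ℝ) + 1 / 2 - ((k : ℝ) + 1))) := by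
    rw [← (hs 0).tsum_sub (hs _), ← tsum_mul_left]
    refine tsum_congr fun k => ?_
    rw [hx, gaussTerm_rpow hl, hf, ← hγ]
    have : gaussTerm γ lam k 0 = (lam ^ ((n : ℝ) + 1 / 2)) ^ γ *
        (lam ^ ((n : ℝ) + 1 / 2 - ((k : ℝ) + 1))) ^ (-γ) := by
      rw [← Real.rpow_mul hl.le, ← Real.rpow_mul hl.le, ← Real.rpow_add hl, gaussTerm]
      simp only [ne_eq, OfNat.ofNat_ne_zero, not_false_eq_true, zero_pow, neg_zero, zero_div,
        Real.exp_zero, mul_one]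
      congr 1; ring
    rw [this]; ring
  have h0 : rieszKernel d α (0 : EuclideanSpace ℝ (Fin d)) = 0 := by
    rw [rieszKernel, if_neg hα.ne', norm_zero, Real.zero_rpow (by linarith), mul_zero]
  rw [realPotential, realPotential, h0, norm_zero, rieszKernel, if_neg hα.ne']
  have hr : 0 ≤ ‖x‖ ^ (α - (d : ℝ)) := by positivity
  rw [mul_div_assoc] at hsum
  have h3 := mul_le_mul_of_nonneg_left (mul_le_mul_of_nonneg_left hsum hr) hc.le
  rw [← hdiff] at h3
  nlinarith

/-! ### Finite energy of local minimizers by mollification -/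

theorem ae_norm_le_of_isCompact_support {ρ : Measure (EuclideanSpace ℝ (Fin d))}
    (h : IsCompact ρ.support) : ∃ R : ℝ, 0 < R ∧ ∀ᵐ x ∂ρ, ‖x‖ ≤ R := by
  obtain ⟨R, hR0, hR⟩ := h.isBounded.subset_closedBall_lt 0 0
  refine ⟨R, hR0, ?_⟩
  filter_upwards [Measure.support_mem_ae (μ := ρ)] with x hx
  simpa using hR hx

theorem isCompact_support_of_ae_norm_le {ρ : Measure (EuclideanSpace ℝ (Fin d))} {R : ℝ}
    (h : ∀ᵐ x ∂ρ, ‖x‖ ≤ R) : IsCompact ρ.support :=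
  (isCompact_closedBall (0 : EuclideanSpace ℝ (Fin d)) R).of_isClosed_subset
    Measure.isClosed_support
    (Measure.support_subset_of_isClosed Metric.isClosed_closedBall
      (h.mono fun x hx => by simpa using hx))

theorem setLIntegral_ball_sub_le {F : EuclideanSpace ℝ (Fin d) → ℝ≥0∞} {r R : ℝ}
    {z : EuclideanSpace ℝ (Fin d)} (hz : ‖z‖ + r ≤ R) :
    ∫⁻ u in Metric.ball 0 r, F (z - u) ≤ ∫⁻ u in Metric.ball 0 R, F u := by
  rw [← lintegral_indicator Metric.isOpen_ball.measurableSet,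
    ← lintegral_indicator Metric.isOpen_ball.measurableSet,
    ← lintegral_sub_left_eq_self ((Metric.ball 0 R).indicator F) z]
  refine lintegral_mono fun u => ?_
  by_cases hu : u ∈ Metric.ball (0 : EuclideanSpace ℝ (Fin d)) r
  · have : z - u ∈ Metric.ball (0 : EuclideanSpace ℝ (Fin d)) R := by
      rw [mem_ball_zero_iff] at hu ⊢
      exact (norm_sub_le _ _).trans_lt (by linarith)
    rw [indicator_of_mem hu, indicator_of_mem this]
  · rw [indicator_of_notMem hu]
    exact zero_le

/-- The competitor is the convolution of `ρ` with the uniform measure on a ball of radius `r`. The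
coupling `(x, x + u)` shows that it is close, and the bounded density of the uniform measure reduces
its energy to the local integrability of `F`. -/
theorem exists_lintegral_ne_top_dInfty_le {F : EuclideanSpace ℝ (Fin d) → ℝ≥0∞}
    (hFm : Measurable F) (hF : ∀ R : ℝ, ∫⁻ z in Metric.ball 0 R, F z ≠ ⊤)
    {ρ : Measure (EuclideanSpace ℝ (Fin d))} [IsProbabilityMeasure ρ]
    (hρ : IsCompact ρ.support) {r : ℝ} (hr : 0 < r) :
    ∃ ν : Measure (EuclideanSpace ℝ (Fin d)), IsProbabilityMeasure ν ∧ IsCompact ν.support ∧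
      dInfty ρ ν ≤ ENNReal.ofReal r ∧ ∫⁻ p, F (p.1 - p.2) ∂ν.prod ν ≠ ⊤ := by
  obtain ⟨R, hR0, hR⟩ := ae_norm_le_of_isCompact_support hρ
  set B := Metric.ball (0 : EuclideanSpace ℝ (Fin d)) r with hB
  have hB0 : volume B ≠ 0 := (Metric.measure_ball_pos volume _ hr).ne'
  have hBt : volume B ≠ ⊤ := measure_ball_lt_top.ne
  set η : Measure (EuclideanSpace ℝ (Fin d)) := (volume B)⁻¹ • volume.restrict B with hη
  have hηp : IsProbabilityMeasure η := ⟨by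
    simp [hη, ENNReal.inv_mul_cancel hB0 hBt]⟩
  have hηB : ∀ᵐ u ∂η, ‖u‖ < r := by
    refine Measure.ae_smul_measure ?_ _
    filter_upwards [ae_restrict_mem Metric.isOpen_ball.measurableSet] with u hu
    simpa [hB] using hu
  have hadd : Measurable fun p : EuclideanSpace ℝ (Fin d) × EuclideanSpace ℝ (Fin d) =>
    p.1 + p.2 := measurable_fst.add measurable_snd
  set ν := (ρ.prod η).map fun p => p.1 + p.2 with hν
  have h1 : ∀ᵐ p ∂ρ.prod η, ‖p.1‖ ≤ R := Measure.quasiMeasurePreserving_fst.ae hR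
  have h2 : ∀ᵐ p ∂ρ.prod η, ‖p.2‖ < r := Measure.quasiMeasurePreserving_snd.ae hηB
  have hνp : IsProbabilityMeasure ν := Measure.isProbabilityMeasure_map hadd.aemeasurable
  have hνR : ∀ᵐ x ∂ν, ‖x‖ ≤ R + r := by
    rw [hν, ae_map_iff hadd.aemeasurable (measurableSet_le measurable_norm measurable_const)]
    filter_upwards [h1, h2] with p hp1 hp2
    exact (norm_add_le _ _).trans (by linarith)
  refine ⟨ν, hνp, isCompact_support_of_ae_norm_le hνR, ?_, ?_⟩
  · have hm : Measurable fun p : EuclideanSpace ℝ (Fin d) × EuclideanSpace ℝ (Fin d) =>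
      (p.1, p.1 + p.2) := measurable_fst.prodMk hadd
    refine dInfty_le_of_ae_edist_le (π := (ρ.prod η).map fun p => (p.1, p.1 + p.2))
      ⟨Measure.isProbabilityMeasure_map hm.aemeasurable, ?_, ?_⟩ ?_
    · rw [Measure.map_map measurable_fst hm]
      have := Measure.map_fst_prod (μ := ρ) (ν := η)
      rwa [measure_univ, one_smul] at this
    · rw [Measure.map_map measurable_snd hm]
      rfl
    · rw [ae_map_iff hm.aemeasurable (measurableSet_le measurable_edist measurable_const)]
      filter_upwards [h2] with p hp
      rw [edist_dist, dist_self_add_right]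
      exact ENNReal.ofReal_le_ofReal hp.le
  · set M := ∫⁻ u in Metric.ball 0 (2 * R + 2 * r), F u with hM
    have hsub : Measurable fun p : EuclideanSpace ℝ (Fin d) × EuclideanSpace ℝ (Fin d) =>
      p.1 - p.2 := measurable_fst.sub measurable_snd
    have key : ∀ᵐ x ∂ν, ∫⁻ y, F (x - y) ∂ν ≤ (volume B)⁻¹ * M := by
      filter_upwards [hνR] with x hx
      have hFx : Measurable fun y => F (x - y) := hFm.comp (measurable_const.sub measurable_id)
      rw [hν, lintegral_map hFx hadd, lintegral_prod (fun p => F (x - (p.1 + p.2))) (hFx.comp hadd).aemeasurable]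
      calc _ ≤ ∫⁻ _, (volume B)⁻¹ * M ∂ρ := by
            refine lintegral_mono_ae (hR.mono fun y hy => ?_)
            rw [hη, lintegral_smul_measure, smul_eq_mul]
            gcongr
            simp_rw [← sub_sub]
            exact setLIntegral_ball_sub_le (by
              have := norm_sub_le x y
              linarith)
        _ = _ := by simp
    rw [lintegral_prod (fun p => F (p.1 - p.2)) (hFm.comp hsub).aemeasurable]
    refine ne_top_of_le_ne_top (b := (volume B)⁻¹ * M) ?_ ?_
    · exact ENNReal.mul_ne_top (ENNReal.inv_ne_top.2 hB0) (hF _)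
    · calc _ ≤ ∫⁻ _, (volume B)⁻¹ * M ∂ν := lintegral_mono_ae key
        _ = _ := by simp

theorem rieszKernel_integrableOn_ball (hd : 1 ≤ d) (hα0 : 0 < α) (R : ℝ) :
    IntegrableOn (rieszKernel d α) (Metric.ball 0 R) := by
  have hpow : ∀ a : ℝ, -(d : ℝ) < a →
      IntegrableOn (fun x : EuclideanSpace ℝ (Fin d) => ‖x‖ ^ a) (Metric.ball 0 R) := fun a ha => by
    refine integrableOn_ball_of_norm_le_rpow (C := 1) (α := -a) (by simpa using hd)
      (by rw [finrank_euclideanSpace_fin]; linarith) (Eventually.of_forall fun x => ?_)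
      (measurable_norm.pow_const _).aestronglyMeasurable
    rw [neg_neg, one_mul, Real.norm_of_nonneg (by positivity)]
  have hd' : (1 : ℝ) ≤ d := by exact_mod_cast hd
  by_cases h : α = d
  · refine Integrable.mono' (g := fun x => logConst d α * (2 * ‖x‖ ^ (-(1 / 2) : ℝ) + ‖x‖ ^ (1 : ℝ)))
      ((((hpow _ (by linarith)).const_mul 2).add (hpow _ (by linarith))).const_mul _)
      (measurable_rieszKernel d α).aestronglyMeasurable (Eventually.of_forall fun x => ?_)
    rw [rieszKernel, if_pos h, norm_mul, norm_neg, Real.norm_of_nonneg (logConst_pos hα0).le]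
    refine mul_le_mul_of_nonneg_left ?_ (logConst_pos hα0).le
    have h1 := Real.log_le_rpow_div (inv_nonneg.2 (norm_nonneg x)) (one_half_pos (α := ℝ))
    rw [Real.log_inv, Real.inv_rpow (norm_nonneg x), ← Real.rpow_neg (norm_nonneg x)] at h1
    have h2 := Real.log_le_self (norm_nonneg x)
    have h3 : 0 ≤ ‖x‖ ^ (-(1 / 2) : ℝ) := by positivity
    rw [Real.rpow_one, Real.norm_eq_abs, abs_le]
    constructor <;> linarith [norm_nonneg x]
  · unfold rieszKernel
    simp_rw [if_neg h]
    exact (hpow _ (by linarith)).const_mul _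

theorem lintegral_ball_potential_ne_top (hd : 1 ≤ d) (hα0 : 0 < α) (hl : 0 < lam) (hc : 0 < cW)
    (R : ℝ) : ∫⁻ z in Metric.ball 0 R, (potential d α cW lam z).toENNReal ≠ ⊤ := by
  have hI : IntegrableOn (fun x : EuclideanSpace ℝ (Fin d) => rieszKernel d α x + ‖x‖ ^ 2 / 2)
      (Metric.ball 0 R) := by
    refine (rieszKernel_integrableOn_ball hd hα0 R).add ?_
    exact ((continuous_norm.pow 2).div_const 2).continuousOn.integrableOn_compact
      (isCompact_closedBall 0 R) |>.mono_set Metric.ball_subset_closedBall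
  have : Nontrivial (EuclideanSpace ℝ (Fin d)) :=
    Module.nontrivial_of_finrank_pos (R := ℝ) (by rw [finrank_euclideanSpace_fin]; omega)
  refine ne_top_of_le_ne_top hI.lintegral_lt_top.ne (lintegral_mono_ae ?_)
  have h0 : ∀ᵐ x : EuclideanSpace ℝ (Fin d) ∂volume.restrict (Metric.ball 0 R), x ≠ 0 :=
    ae_restrict_of_ae (Measure.ae_ne volume 0)
  filter_upwards [h0] with x hx
  rw [potential_of_ne hx, EReal.real_coe_toENNReal]
  exact ENNReal.ofReal_le_ofReal (realPotential_le hl hc x)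

theorem measurable_potential (hl : 0 < lam) : Measurable (potential d α cW lam) := by
  rcases le_or_gt α d with h | h
  · have : potential d α cW lam = fun x => if x = 0 then ⊤ else
        (realPotential d α cW lam x : EReal) := by
      funext x
      split_ifs with hx
      · rw [hx, potential_zero h]
      · exact potential_of_ne hx
    rw [this]
    exact Measurable.ite (measurableSet_singleton 0) measurable_const
      (measurable_realPotential hl).coe_real_ereal
  · rw [show potential d α cW lam = fun x => (realPotential d α cW lam x : EReal) from
      funext (potential_of_lt h)]
    exact (measurable_realPotential hl).coe_real_ereal

/-- A local minimizer has finite energy. -/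
theorem IsCompactlySupportedDInftyLocalMinimizer.integrable (hd : 1 ≤ d) (hα0 : 0 < α)
    (hl : 0 < lam) (hl1 : lam < 1) (hc : 0 < cW)
    (hlow : α ≤ d → ∃ C : ℝ, ∀ x : EuclideanSpace ℝ (Fin d), x ≠ 0 →
      -C ≤ realPotential d α cW lam x)
    {ρ : Measure (EuclideanSpace ℝ (Fin d))}
    (hρ : IsCompactlySupportedDInftyLocalMinimizer (potential d α cW lam) ρ) :
    (α ≤ d → ∀ᵐ p ∂ρ.prod ρ, p.1 - p.2 ≠ 0) ∧
      Integrable (fun p => realPotential d α cW lam (p.1 - p.2)) (ρ.prod ρ) := by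
  obtain ⟨hprob, hcomp, ε, hε, hmin⟩ := hρ
  rcases le_or_gt α d with h | h
  · obtain ⟨C, hC⟩ := hlow h
    obtain ⟨r, hr0, hr⟩ : ∃ r : ℝ, 0 < r ∧ ENNReal.ofReal r < ε := by
      obtain ⟨r, hr0, hr⟩ := ENNReal.lt_iff_exists_nnreal_btwn.1 hε
      exact ⟨r, by simpa using hr0, by simpa using hr⟩
    obtain ⟨ν, hν, hνc, hνd, hνf⟩ := exists_lintegral_ne_top_dInfty_le
      (measurable_potential (d := d) (α := α) (cW := cW) hl).ereal_toENNReal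
      (lintegral_ball_potential_ne_top hd hα0 hl hc) hcomp hr0
    have hE : energy (potential d α cW lam) ρ ≠ ⊤ :=
      ne_top_of_le_ne_top (energy_ne_top hνf) (hmin ν hν hνc (hνd.trans_lt hr))
    have := integrable_of_energy_ne_top (C := C) (measurable_realPotential hl) (potential_zero h)
      (fun x hx => potential_of_ne hx) (fun x => by
        rcases eq_or_ne x 0 with rfl | hx
        · rw [potential_zero h]; exact le_top
        · rw [potential_of_ne hx]; exact_mod_cast hC x hx) hE
    exact ⟨fun _ => this.1, this.2⟩
  · refine ⟨fun h' => absurd h (not_lt.2 h'), ?_⟩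
    obtain ⟨R, hR0, hR⟩ := ae_norm_le_of_isCompact_support hcomp
    refine Integrable.of_bound ((measurable_realPotential hl).comp
      (measurable_fst.sub measurable_snd)).aestronglyMeasurable
      (|rieszConst d α| * (2 * R) ^ (α - d) + (2 * R) ^ 2 / 2 +
        cW * ∑' k : ℕ, gaussTerm (α - d) lam k 0) ?_
    have h1 : ∀ᵐ p ∂ρ.prod ρ, ‖p.1‖ ≤ R := Measure.quasiMeasurePreserving_fst.ae hR
    have h2 : ∀ᵐ p ∂ρ.prod ρ, ‖p.2‖ ≤ R := Measure.quasiMeasurePreserving_snd.ae hR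
    filter_upwards [h1, h2] with p hp1 hp2
    exact abs_realPotential_le_of_lt h hl hl1 hc ((norm_sub_le _ _).trans (by linarith))

/-! ### Second differences of the potential away from the origin -/

/-- Bernoulli's inequality for the exponent `1 - p` bounds `(1 + τ)^p = (1 + τ) / (1 + τ)^(1 - p)`
from below by a rational function of `τ`. -/
theorem one_add_rpow_ge {p τ : ℝ} (hp0 : 0 ≤ p) (hp1 : p ≤ 1) (hτ : |τ| ≤ 1 / 2) :
    1 + p * τ - τ ^ 2 ≤ (1 + τ) ^ p := by
  have hτ' := abs_le.1 hτ
  have h1 : 0 < 1 + τ := by linarith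
  have hB : (1 + τ) ^ (1 - p) ≤ 1 + (1 - p) * τ :=
    rpow_one_add_le_one_add_mul_self (by linarith) (by linarith) (by linarith)
  have hD : 1 / 2 ≤ 1 + (1 - p) * τ := by nlinarith
  have h2 : (1 + τ) ^ p * (1 + τ) ^ (1 - p) = 1 + τ := by
    rw [← Real.rpow_add h1]; simp
  have h3 : 1 + τ ≤ (1 + τ) ^ p * (1 + (1 - p) * τ) := by
    calc 1 + τ = (1 + τ) ^ p * (1 + τ) ^ (1 - p) := h2.symm
      _ ≤ _ := by gcongr
  by_contra! h4
  have h5 := mul_lt_mul_of_pos_right h4 (by linarith : 0 < 1 + (1 - p) * τ)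
  nlinarith [mul_nonneg hp0 (sub_nonneg.2 hp1), sq_nonneg τ,
    mul_nonneg (sq_nonneg τ) (by linarith : 0 ≤ 1 + (1 - p) * τ - 1 / 2),
    mul_nonneg (sq_nonneg τ) (sq_nonneg (p - 1 / 2))]

/-- Write `‖z ± h‖² = ‖z‖² (1 + τ)` and expand `(1 + τ)^(γ/2)`: the terms linear in `h` cancel, and
`‖h‖ ≤ r / 8` keeps `|τ| ≤ 1/2`. A lower bound suffices, since the Riesz constant is negative. -/
theorem norm_rpow_second_difference {γ r R : ℝ} (hγ0 : 0 ≤ γ) (hγ : γ ≤ 2) (hr : 0 < r)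
    {z h : EuclideanSpace ℝ (Fin d)} (hz : r ≤ ‖z‖) (hzR : ‖z‖ ≤ R) (hh : ‖h‖ ≤ r / 8) :
    -(R ^ γ * (10 / r ^ 2) * ‖h‖ ^ 2) ≤ ‖z + h‖ ^ γ + ‖z - h‖ ^ γ - 2 * ‖z‖ ^ γ := by
  have hz0 : 0 < ‖z‖ := hr.trans_le hz
  obtain ⟨b, hb⟩ : ∃ b : ℝ, b = inner ℝ z h := ⟨_, rfl⟩
  have hbabs : |b| ≤ ‖z‖ * ‖h‖ := hb ▸ abs_real_inner_le_norm z h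
  have hb2 : b ^ 2 ≤ (‖z‖ * ‖h‖) ^ 2 := by rw [← sq_abs]; gcongr
  have hhz : ‖h‖ ≤ ‖z‖ / 8 := hh.trans (by linarith)
  have hn := norm_nonneg h
  have key : ∀ s : ℝ, |s| = 1 → ∀ y : EuclideanSpace ℝ (Fin d), ‖y‖ ^ 2 =
      ‖z‖ ^ 2 + ‖h‖ ^ 2 + 2 * (s * b) →
      ‖z‖ ^ γ * (1 + γ / 2 * ((‖h‖ ^ 2 + 2 * (s * b)) / ‖z‖ ^ 2)
        - ((‖h‖ ^ 2 + 2 * (s * b)) / ‖z‖ ^ 2) ^ 2) ≤ ‖y‖ ^ γ := fun s hs y hy => by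
    have hτ : |(‖h‖ ^ 2 + 2 * (s * b)) / ‖z‖ ^ 2| ≤ 1 / 2 := by
      have h1 : |s * b| ≤ ‖z‖ * ‖h‖ := by rw [abs_mul, hs, one_mul]; exact hbabs
      have h2 := abs_le.1 h1
      rw [abs_div, abs_of_pos (by positivity : 0 < ‖z‖ ^ 2), div_le_iff₀ (by positivity), abs_le]
      constructor <;> nlinarith
    have hy' : ‖y‖ ^ γ = ‖z‖ ^ γ * (1 + (‖h‖ ^ 2 + 2 * (s * b)) / ‖z‖ ^ 2) ^ (γ / 2) := by
      have hp : ∀ t : ℝ, 0 ≤ t → t ^ γ = (t ^ 2) ^ (γ / 2) := fun t ht => by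
        rw [← Real.rpow_natCast, ← Real.rpow_mul ht]; congr 1; push_cast; ring
      rw [hp _ (norm_nonneg y), hp _ (norm_nonneg z), ← Real.mul_rpow (by positivity)
        (by linarith [(abs_le.1 hτ).1]), hy]
      congr 1
      field_simp
      ring
    rw [hy']
    exact mul_le_mul_of_nonneg_left (one_add_rpow_ge (by linarith) (by linarith) hτ) (by positivity)
  have h1 := key 1 (by simp) (z + h) (by rw [norm_add_sq_real, ← hb]; ring)
  have h2 := key (-1) (by simp) (z - h) (by rw [norm_sub_sq_real, ← hb]; ring)
  have hzR' : ‖z‖ ^ γ ≤ R ^ γ := by gcongr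
  have hQ : ((‖h‖ ^ 2 + 2 * (1 * b)) / ‖z‖ ^ 2) ^ 2 + ((‖h‖ ^ 2 + 2 * (-1 * b)) / ‖z‖ ^ 2) ^ 2
      ≤ 10 / r ^ 2 * ‖h‖ ^ 2 := by
    calc _ = (2 * ‖h‖ ^ 4 + 8 * b ^ 2) / ‖z‖ ^ 4 := by field_simp; ring
      _ ≤ (10 * ‖z‖ ^ 2 * ‖h‖ ^ 2) / ‖z‖ ^ 4 := by
          gcongr
          have : ‖h‖ ^ 2 ≤ ‖z‖ ^ 2 := by gcongr; linarith
          nlinarith [mul_le_mul_of_nonneg_left this (sq_nonneg ‖h‖)]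
      _ = 10 / ‖z‖ ^ 2 * ‖h‖ ^ 2 := by field_simp
      _ ≤ _ := by gcongr
  have hL : 0 ≤ γ / 2 * ((‖h‖ ^ 2 + 2 * (1 * b)) / ‖z‖ ^ 2)
      + γ / 2 * ((‖h‖ ^ 2 + 2 * (-1 * b)) / ‖z‖ ^ 2) := by
    rw [← mul_add, ← add_div]
    have : ‖h‖ ^ 2 + 2 * (1 * b) + (‖h‖ ^ 2 + 2 * (-1 * b)) = 2 * ‖h‖ ^ 2 := by ring
    rw [this]; positivity
  have hzγ : 0 ≤ ‖z‖ ^ γ := by positivity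
  have hRγ : 0 ≤ R ^ γ := hzγ.trans hzR'
  have h3 : ‖z‖ ^ γ * (((‖h‖ ^ 2 + 2 * (1 * b)) / ‖z‖ ^ 2) ^ 2 +
      ((‖h‖ ^ 2 + 2 * (-1 * b)) / ‖z‖ ^ 2) ^ 2) ≤ R ^ γ * (10 / r ^ 2 * ‖h‖ ^ 2) := by
    gcongr
  nlinarith [mul_nonneg hzγ hL]

/-- The curvature of a Gaussian grows like the inverse square of its width. Away from the origin
`exp(-x) * x ≤ 1` trades that factor for `1 / r²`, leaving a bound by the value at `0`, which is
summable in `k` when `γ > 0`. -/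
theorem gaussTerm_second_difference (hl : 0 < lam) {γ r : ℝ} (hr : 0 < r)
    {z h : EuclideanSpace ℝ (Fin d)} (hz : r ≤ ‖z‖) (k : ℕ) :
    2 * gaussTerm γ lam k ‖z‖ - gaussTerm γ lam k ‖z + h‖ - gaussTerm γ lam k ‖z - h‖
      ≤ gaussTerm γ lam k 0 * (2 / r ^ 2 * ‖h‖ ^ 2) := by
  have hz0 : 0 < ‖z‖ := hr.trans_le hz
  obtain ⟨v, hv⟩ : ∃ v : ℝ, v = lam ^ (2 * (k + 1)) := ⟨_, rfl⟩
  have hv0 : 0 < v := hv ▸ by positivity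
  obtain ⟨x, hx⟩ : ∃ x : ℝ, x = ‖z‖ ^ 2 / (2 * v) := ⟨_, rfl⟩
  obtain ⟨y, hy⟩ : ∃ y : ℝ, y = ‖h‖ ^ 2 / (2 * v) := ⟨_, rfl⟩
  obtain ⟨b, hb⟩ : ∃ b : ℝ, b = inner ℝ z h / v := ⟨_, rfl⟩
  have e1 : -‖z + h‖ ^ 2 / (2 * v) = -x + -y + -b := by
    rw [norm_add_sq_real, hx, hy, hb]; field_simp; ring
  have e2 : -‖z - h‖ ^ 2 / (2 * v) = -x + -y + b := by
    rw [norm_sub_sq_real, hx, hy, hb]; field_simp; ring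
  have e3 : -‖z‖ ^ 2 / (2 * v) = -x := by rw [hx, neg_div]
  have hx0 : 0 < x := by rw [hx]; positivity
  have hxe : Real.exp (-x) * x ≤ 1 := by
    have := exp_neg_le_factorial_div_pow hx0 1
    rw [pow_one, le_div_iff₀ hx0] at this
    simpa using this
  have hy1 : y ≤ x * (‖h‖ ^ 2 / r ^ 2) := by
    rw [hx, hy, div_mul_div_comm, div_le_div_iff₀ (by positivity) (by positivity)]
    have : r ^ 2 ≤ ‖z‖ ^ 2 := by gcongr
    nlinarith [mul_le_mul_of_nonneg_left this (by positivity : 0 ≤ ‖h‖ ^ 2 * (2 * v))]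
  have h1 : Real.exp (-x) * (2 * (1 - y)) ≤ Real.exp (-x + -y + -b) + Real.exp (-x + -y + b) := by
    rw [Real.exp_add, Real.exp_add, Real.exp_add (-x + -y), Real.exp_add, mul_assoc, mul_assoc,
      ← mul_add, ← mul_add]
    refine mul_le_mul_of_nonneg_left ?_ (Real.exp_pos _).le
    nlinarith [Real.add_one_le_exp (-y), Real.add_one_le_exp b, Real.add_one_le_exp (-b),
      Real.exp_pos (-y)]
  have h2 : Real.exp (-x) * (2 * y) ≤ 2 / r ^ 2 * ‖h‖ ^ 2 := by
    calc Real.exp (-x) * (2 * y) ≤ Real.exp (-x) * (2 * (x * (‖h‖ ^ 2 / r ^ 2))) := by gcongr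
      _ = Real.exp (-x) * x * (2 / r ^ 2 * ‖h‖ ^ 2) := by ring
      _ ≤ 1 * (2 / r ^ 2 * ‖h‖ ^ 2) := by gcongr
      _ = _ := one_mul _
  simp only [gaussTerm, ← hv, e1, e2, e3]
  have hA : 0 ≤ lam ^ (γ * ((k : ℝ) + 1)) := by positivity
  have h3 : 2 * Real.exp (-x) - Real.exp (-x + -y + -b) - Real.exp (-x + -y + b)
      ≤ 2 / r ^ 2 * ‖h‖ ^ 2 := by linarith
  simp only [ne_eq, OfNat.ofNat_ne_zero, not_false_eq_true, zero_pow, neg_zero, zero_div,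
    Real.exp_zero, mul_one]
  nlinarith [mul_le_mul_of_nonneg_left h3 hA]

theorem realPotential_second_difference (hα : (d : ℝ) < α) (hα2 : α < d + 2) (hc : 0 < cW)
    (hl : 0 < lam) (hl1 : lam < 1) {r : ℝ} (hr : 0 < r) (R : ℝ) :
    ∃ C : ℝ, 0 ≤ C ∧ ∀ z h : EuclideanSpace ℝ (Fin d), r ≤ ‖z‖ → ‖z‖ ≤ R → ‖h‖ ≤ r / 8 →
      realPotential d α cW lam (z + h) + realPotential d α cW lam (z - h)
        - 2 * realPotential d α cW lam z ≤ C * ‖h‖ ^ 2 := by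
  have hneg := rieszConst_neg hα hα2
  have hs := summable_gaussTerm_of_pos (sub_pos.2 hα) hl hl1
  have hS0 : 0 ≤ ∑' k : ℕ, gaussTerm (α - d) lam k 0 :=
    tsum_nonneg fun k => gaussTerm_nonneg hl _ _ _
  refine ⟨-rieszConst d α * (|R| ^ (α - d) * (10 / r ^ 2)) + 1 +
    cW * (∑' k : ℕ, gaussTerm (α - d) lam k 0) * (2 / r ^ 2), ?_, fun z h hz hzR hh => ?_⟩
  · have : 0 < -rieszConst d α := neg_pos.2 hneg
    positivity
  · have h1 := norm_rpow_second_difference (γ := α - d) (by linarith) (by linarith) hr hz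
      (hzR.trans (le_abs_self R)) hh
    have h2 : 2 * (∑' k : ℕ, gaussTerm (α - d) lam k ‖z‖)
        - (∑' k : ℕ, gaussTerm (α - d) lam k ‖z + h‖) - ∑' k : ℕ, gaussTerm (α - d) lam k ‖z - h‖
        ≤ (∑' k : ℕ, gaussTerm (α - d) lam k 0) * (2 / r ^ 2 * ‖h‖ ^ 2) := by
      rw [← tsum_mul_left, ← ((hs _).mul_left 2).tsum_sub (hs _),
        ← (((hs _).mul_left 2).sub (hs _)).tsum_sub (hs _), ← tsum_mul_right]
      exact ((((hs _).mul_left 2).sub (hs _)).sub (hs _)).tsum_le_tsum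
        (fun k => gaussTerm_second_difference hl hr hz k) ((hs 0).mul_right _)
    have h3 : ‖z + h‖ ^ 2 + ‖z - h‖ ^ 2 = 2 * ‖z‖ ^ 2 + 2 * ‖h‖ ^ 2 := by
      rw [norm_add_sq_real, norm_sub_sq_real]; ring
    simp only [realPotential, rieszKernel, if_neg hα.ne']
    have h4 := mul_le_mul_of_nonneg_left h1 (neg_pos.2 hneg).le
    have h5 := mul_le_mul_of_nonneg_left h2 hc.le
    nlinarith

theorem realPotential_neg (x : EuclideanSpace ℝ (Fin d)) :
    realPotential d α cW lam (-x) = realPotential d α cW lam x := by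
  simp [realPotential, rieszKernel]

/-! ### Splitting an isolated atom -/

/-- The self-interaction of a finite measure plus two equal point masses. -/
theorem integral_prod_add_dirac {w : EuclideanSpace ℝ (Fin d) → ℝ} (hw : Measurable w)
    (heven : ∀ x, w (-x) = w x) (hbd : ∀ R : ℝ, ∃ B, ∀ x, ‖x‖ ≤ R → |w x| ≤ B)
    {ρ : Measure (EuclideanSpace ℝ (Fin d))} [IsFiniteMeasure ρ] {R : ℝ}
    (hρ : ∀ᵐ x ∂ρ, ‖x‖ ≤ R) (c : ℝ≥0∞) (hc : c ≠ ⊤) {a b : EuclideanSpace ℝ (Fin d)}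
    (ha : ‖a‖ ≤ R) (hb : ‖b‖ ≤ R) (ν : Measure (EuclideanSpace ℝ (Fin d)))
    (hν : ν = ρ + c • (Measure.dirac a + Measure.dirac b)) :
    Integrable (fun p => w (p.1 - p.2)) (ν.prod ν) ∧
    ∫ p, w (p.1 - p.2) ∂ν.prod ν = ∫ p, w (p.1 - p.2) ∂ρ.prod ρ
      + 2 * c.toReal * (∫ y, w (a - y) ∂ρ + ∫ y, w (b - y) ∂ρ)
      + c.toReal ^ 2 * (2 * w 0 + 2 * w (a - b)) := by
  obtain ⟨B, hB⟩ := hbd (2 * R)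
  obtain ⟨τ, hτ⟩ : ∃ τ : Measure (EuclideanSpace ℝ (Fin d)),
    τ = c • (Measure.dirac a + Measure.dirac b) := ⟨_, rfl⟩
  have : IsFiniteMeasure τ := hτ ▸ Measure.smul_finite _ hc
  have hτR : ∀ᵐ x ∂τ, ‖x‖ ≤ R := by
    rw [hτ]
    refine Measure.ae_smul_measure ?_ _
    rw [ae_add_measure_iff]
    simp [ae_dirac_eq, ha, hb]
  have hm : Measurable fun p : EuclideanSpace ℝ (Fin d) × EuclideanSpace ℝ (Fin d) =>
    w (p.1 - p.2) := hw.comp (measurable_fst.sub measurable_snd)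
  have hint : ∀ μ μ' : Measure (EuclideanSpace ℝ (Fin d)), IsFiniteMeasure μ → IsFiniteMeasure μ' →
      (∀ᵐ x ∂μ, ‖x‖ ≤ R) → (∀ᵐ x ∂μ', ‖x‖ ≤ R) →
      Integrable (fun p => w (p.1 - p.2)) (μ.prod μ') := fun μ μ' _ _ h h' => by
    refine Integrable.of_bound hm.aestronglyMeasurable B ?_
    filter_upwards [Measure.quasiMeasurePreserving_fst.ae h,
      Measure.quasiMeasurePreserving_snd.ae h'] with p hp1 hp2
    exact hB _ ((norm_sub_le _ _).trans (by linarith))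
  have hτint : ∀ f : EuclideanSpace ℝ (Fin d) → ℝ, ∫ x, f x ∂τ = c.toReal * (f a + f b) := fun f => by
    rw [hτ, integral_smul_measure, integral_add_measure, integral_dirac, integral_dirac,
      smul_eq_mul]
    · exact integrable_dirac (by simp)
    · exact integrable_dirac (by simp)
  have i1 := hint ρ ρ ‹_› ‹_› hρ hρ
  have i2 := hint τ ρ ‹_› ‹_› hτR hρ
  have i3 := hint ρ τ ‹_› ‹_› hρ hτR
  have i4 := hint τ τ ‹_› ‹_› hτR hτR
  rw [← hτ] at hν
  rw [hν, Measure.prod_add, Measure.add_prod, Measure.add_prod]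
  refine ⟨(i1.add_measure i2).add_measure (i3.add_measure i4), ?_⟩
  rw [integral_add_measure (i1.add_measure i2) (i3.add_measure i4), integral_add_measure i1 i2,
    integral_add_measure i3 i4]
  have e2 : ∫ p, w (p.1 - p.2) ∂τ.prod ρ
      = c.toReal * (∫ y, w (a - y) ∂ρ + ∫ y, w (b - y) ∂ρ) := by
    rw [integral_prod _ i2, hτint]
  have e3 : ∫ p, w (p.1 - p.2) ∂ρ.prod τ
      = c.toReal * (∫ y, w (a - y) ∂ρ + ∫ y, w (b - y) ∂ρ) := by
    rw [integral_prod_symm _ i3, hτint]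
    have : ∀ x y, w (y - x) = w (x - y) := fun x y => by rw [← heven, neg_sub]
    simp_rw [this]
  have e4 : ∫ p, w (p.1 - p.2) ∂τ.prod τ = c.toReal ^ 2 * (2 * w 0 + 2 * w (a - b)) := by
    rw [integral_prod _ i4, hτint, hτint, hτint]
    have : w (b - a) = w (a - b) := by rw [← heven, neg_sub]
    simp only [sub_self, this]
    ring
  rw [e2, e3, e4]
  ring

theorem exists_isolated_atom {ρ : Measure (EuclideanSpace ℝ (Fin d))}
    (h : ¬ Preperfect ρ.support) :
    ∃ x₀ : EuclideanSpace ℝ (Fin d), ∃ r : ℝ, 0 < r ∧ x₀ ∈ ρ.support ∧ ρ {x₀} ≠ 0 ∧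
      ∀ᵐ x ∂ρ, x ≠ x₀ → r ≤ ‖x₀ - x‖ := by
  rw [Preperfect] at h
  push Not at h
  obtain ⟨x₀, hx₀, hacc⟩ := h
  rw [accPt_iff_nhds] at hacc
  push Not at hacc
  obtain ⟨U, hU, hUx⟩ := hacc
  obtain ⟨r, hr, hrU⟩ := Metric.mem_nhds_iff.1 hU
  refine ⟨x₀, r, hr, hx₀, fun h0 => ?_, ?_⟩
  · have h1 : 0 < ρ (Metric.ball x₀ r) :=
      (Measure.mem_support_iff_forall x₀).1 hx₀ _ (Metric.ball_mem_nhds x₀ hr)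
    refine h1.ne' (measure_mono_null (t := {x₀} ∪ ρ.supportᶜ) (fun x hx => ?_)
      (measure_union_null h0 Measure.measure_compl_support))
    by_cases hxs : x ∈ ρ.support
    · exact Or.inl (hUx x ⟨hrU hx, hxs⟩)
    · exact Or.inr hxs
  · filter_upwards [Measure.support_mem_ae (μ := ρ)] with x hx hne
    by_contra! hlt
    refine hne (hUx x ⟨hrU ?_, hx⟩)
    rwa [Metric.mem_ball, dist_comm, dist_eq_norm]

/-- For `α ≤ d` an atom would charge the diagonal, which is null for a local minimizer. For `α > d`
the splitting costs `O(‖v‖²)` against the remainder and gains a multiple of `‖v‖^(α-d)` in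
self-interaction, a larger quantity for small `v`. -/
theorem IsCompactlySupportedDInftyLocalMinimizer.preperfect_support (hd : 1 ≤ d) (hα0 : 0 < α)
    (hα2 : α < d + 2) (hl : 0 < lam) (hl1 : lam < 1) (hc : 0 < cW)
    (hlow : α ≤ d → ∃ C : ℝ, ∀ x : EuclideanSpace ℝ (Fin d), x ≠ 0 →
      -C ≤ realPotential d α cW lam x)
    (hdrop : (d : ℝ) < α → ∃ δ : ℝ, 0 < δ ∧ ∀ (n : ℕ) (x : EuclideanSpace ℝ (Fin d)),
      ‖x‖ = lam ^ ((n : ℝ) + 1 / 2) →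
        realPotential d α cW lam x - realPotential d α cW lam 0
          ≤ -δ * ‖x‖ ^ (α - d) + ‖x‖ ^ 2 / 2)
    {ρ : Measure (EuclideanSpace ℝ (Fin d))}
    (hρ : IsCompactlySupportedDInftyLocalMinimizer (potential d α cW lam) ρ) :
    Preperfect ρ.support := by
  by_contra hnp
  obtain ⟨x₀, r, hr, hx₀, hatom, hfar⟩ := exists_isolated_atom hnp
  rcases le_or_gt α d with h | h
  · have hne := (hρ.integrable hd hα0 hl hl1 hc hlow).1 h
    have hprob := hρ.1
    have h0 : (ρ.prod ρ) ({x₀} ×ˢ {x₀}) = 0 := by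
      refine measure_mono_null (fun p hp => ?_) hne
      rw [singleton_prod_singleton, mem_singleton_iff] at hp
      simp [hp]
    rw [Measure.prod_prod, mul_self_eq_zero] at h0
    exact hatom h0
  obtain ⟨hprob, hcomp, ε, hε, hmin⟩ := hρ
  obtain ⟨R₀, hR₀, hR₀'⟩ := ae_norm_le_of_isCompact_support hcomp
  obtain ⟨R, hR⟩ : ∃ R, R = R₀ + ‖x₀‖ + 1 := ⟨_, rfl⟩
  obtain ⟨δ, hδ, hdrop⟩ := hdrop h
  obtain ⟨C, hC0, hC⟩ := realPotential_second_difference h hα2 hc hl hl1 hr (‖x₀‖ + R₀)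
  -- The atom is seen as two coincident masses `c`, so the split and unsplit energies come from the
  -- same formula.
  obtain ⟨c, hcdef⟩ : ∃ c : ℝ≥0∞, c = ρ {x₀} / 2 := ⟨_, rfl⟩
  have hct : c ≠ ⊤ := hcdef ▸ ENNReal.div_ne_top (measure_ne_top _ _) (by norm_num)
  have hc0 : c ≠ 0 := hcdef ▸ ENNReal.div_ne_zero.2 ⟨hatom, by norm_num⟩
  have hcr : 0 < c.toReal := ENNReal.toReal_pos hc0 hct
  set ρ' := ρ.restrict {x₀}ᶜ with hρ'
  have hsplit : ρ' + c • (Measure.dirac x₀ + Measure.dirac x₀) = ρ := by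
    have h1 : c • (Measure.dirac x₀ + Measure.dirac x₀) = ρ.restrict {x₀} := by
      rw [Measure.restrict_singleton, ← two_smul ℝ≥0∞ (Measure.dirac x₀), smul_smul, hcdef,
        ENNReal.div_mul_cancel (by norm_num) (by norm_num)]
    rw [h1, add_comm]
    exact Measure.restrict_add_restrict_compl (measurableSet_singleton x₀)
  have hfar' : ∀ᵐ y ∂ρ', r ≤ ‖x₀ - y‖ := by
    filter_upwards [ae_restrict_of_ae hfar, ae_restrict_mem (measurableSet_singleton x₀).compl]
      with y hy hy' using hy hy'
  have hρ'R₀ : ∀ᵐ y ∂ρ', ‖y‖ ≤ R₀ := ae_restrict_of_ae hR₀'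
  have hρ'R : ∀ᵐ y ∂ρ', ‖y‖ ≤ R := hρ'R₀.mono fun y hy => by linarith [norm_nonneg x₀]
  set w := realPotential d α cW lam with hw
  have hwm : Measurable w := measurable_realPotential hl
  have hbd : ∀ R : ℝ, ∃ B, ∀ x, ‖x‖ ≤ R → |w x| ≤ B := fun R =>
    ⟨_, fun x hx => abs_realPotential_le_of_lt h hl hl1 hc hx⟩
  have hform := fun a b (ha : ‖a‖ ≤ R) (hb : ‖b‖ ≤ R) =>
    integral_prod_add_dirac hwm realPotential_neg hbd hρ'R c hct ha hb _ rfl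
  have hWw : ∀ ν : Measure (EuclideanSpace ℝ (Fin d)), ∀ᵐ p ∂ν.prod ν,
      potential d α cW lam (p.1 - p.2) = (w (p.1 - p.2) : EReal) := fun ν =>
    Eventually.of_forall fun p => potential_of_lt h _
  have hR1 : ‖x₀‖ ≤ R := by linarith
  have hEρ := energy_eq_of_integrable (hform x₀ x₀ hR1 hR1).1 (hWw _)
  rw [(hform x₀ x₀ hR1 hR1).2, hsplit] at hEρ
  -- the energy comparison for the split atom
  have hcompare : ∀ v : EuclideanSpace ℝ (Fin d), ‖v‖ ≤ 1 → ‖v‖ ≤ r / 8 →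
      ENNReal.ofReal (2 * ‖v‖) < ε →
      0 ≤ c.toReal * (C * ‖v‖ ^ 2 * ρ'.real univ) + c.toReal ^ 2 * (w ((2 : ℝ) • v) - w 0) := by
    intro v hv1 hvr hvε
    have ha : ‖x₀ + v‖ ≤ R := (norm_add_le _ _).trans (by linarith)
    have hb : ‖x₀ - v‖ ≤ R := (norm_sub_le _ _).trans (by linarith)
    obtain ⟨hI, hE⟩ := hform (x₀ + v) (x₀ - v) ha hb
    obtain ⟨ν, hν⟩ : ∃ ν, ν = ρ' + c • (Measure.dirac (x₀ + v) + Measure.dirac (x₀ - v)) := ⟨_, rfl⟩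
    have hEν := energy_eq_of_integrable hI (hWw _)
    rw [hE, ← hν] at hEν
    have hfin : IsFiniteMeasure (c • (Measure.dirac x₀ + Measure.dirac x₀)) :=
      Measure.smul_finite _ hct
    have hfin' : IsFiniteMeasure (c • (Measure.dirac (x₀ + v) + Measure.dirac (x₀ - v))) :=
      Measure.smul_finite _ hct
    have hmass : (c • (Measure.dirac x₀ + Measure.dirac x₀)) univ
        = (c • (Measure.dirac (x₀ + v) + Measure.dirac (x₀ - v))) univ := by simp
    have hνp : IsProbabilityMeasure ν := ⟨by
      rw [hν, Measure.add_apply, ← hmass, ← Measure.add_apply, hsplit, measure_univ]⟩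
    have hνR : ∀ᵐ x ∂ν, ‖x‖ ≤ R := by
      rw [hν, ae_add_measure_iff]
      refine ⟨hρ'R, Measure.ae_smul_measure ?_ _⟩
      rw [ae_add_measure_iff]
      simp [ae_dirac_eq, ha, hb]
    have hdist : dInfty ρ ν ≤ ENNReal.ofReal (2 * ‖v‖) := by
      have hp : IsProbabilityMeasure (ρ' + c • (Measure.dirac x₀ + Measure.dirac x₀)) := by
        rw [hsplit]; exact hprob
      rw [hν, ← hsplit]
      refine dInfty_add_le hmass ?_ (s := Metric.closedBall x₀ ‖v‖) ?_ ?_ ?_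
      · simp [hc0]
      · refine Measure.ae_smul_measure ?_ _
        rw [ae_add_measure_iff]
        simp [ae_dirac_eq]
      · refine Measure.ae_smul_measure ?_ _
        rw [ae_add_measure_iff]
        simp [ae_dirac_eq]
      · intro x hx y hy
        rw [edist_dist]
        refine ENNReal.ofReal_le_ofReal ?_
        have := dist_triangle_right x y x₀
        rw [Metric.mem_closedBall] at hx hy
        linarith
    have hle := hmin ν hνp (isCompact_support_of_ae_norm_le hνR) (hdist.trans_lt hvε)
    rw [hEν, hEρ, EReal.coe_le_coe_iff] at hle
    have hint : ∀ a : EuclideanSpace ℝ (Fin d), Integrable (fun y => w (a - y)) ρ' := fun a => by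
      obtain ⟨B, hB⟩ := hbd (‖a‖ + R)
      refine Integrable.of_bound (hwm.comp (measurable_const.sub measurable_id)).aestronglyMeasurable
        B (hρ'R.mono fun y hy => hB _ ((norm_sub_le _ _).trans (by linarith)))
    have hsecond : ∫ y, w (x₀ + v - y) ∂ρ' + ∫ y, w (x₀ - v - y) ∂ρ' - 2 * ∫ y, w (x₀ - y) ∂ρ'
        ≤ C * ‖v‖ ^ 2 * ρ'.real univ := by
      have hadd : Integrable (fun y => w (x₀ + v - y) + w (x₀ - v - y)) ρ' :=
        (hint _).add (hint _)
      rw [← integral_const_mul, ← integral_add (hint _) (hint _),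
        ← integral_sub hadd ((hint _).const_mul 2)]
      calc _ ≤ ∫ _, C * ‖v‖ ^ 2 ∂ρ' := by
            refine integral_mono_ae (hadd.sub ((hint _).const_mul 2)) (integrable_const _) ?_
            filter_upwards [hfar', hρ'R₀] with y hy1 hy2
            have := hC (x₀ - y) v hy1 ((norm_sub_le _ _).trans (by linarith)) hvr
            rwa [sub_add_eq_add_sub, sub_right_comm] at this
        _ = _ := by rw [integral_const, smul_eq_mul, mul_comm]
    have e0 : x₀ + v - (x₀ - v) = (2 : ℝ) • v := by rw [two_smul]; abel
    rw [e0, sub_self] at hle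
    nlinarith [mul_le_mul_of_nonneg_left hsecond hcr.le]
  -- contradiction along a sequence of splittings
  obtain ⟨i⟩ : Nonempty (Fin d) := ⟨⟨0, hd⟩⟩
  have hlim : Tendsto (fun n : ℕ => lam ^ ((n : ℝ) + 1 / 2)) atTop (𝓝 0) := by
    have := ((tendsto_pow_atTop_nhds_zero_of_lt_one hl.le hl1).mul_const (lam ^ (1 / 2 : ℝ)))
    rw [zero_mul] at this
    refine this.congr fun n => ?_
    rw [Real.rpow_add hl, Real.rpow_natCast]
  have hγ : 0 < 2 - (α - d) := by linarith
  have hlim2 : Tendsto (fun n : ℕ => (c.toReal * C * ρ'.real univ + c.toReal ^ 2) *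
      (lam ^ ((n : ℝ) + 1 / 2)) ^ (2 - (α - d))) atTop (𝓝 0) := by
    have := (((Real.continuousAt_rpow_const 0 (2 - (α - d)) (Or.inr hγ.le)).tendsto.comp
      hlim).const_mul (c.toReal * C * ρ'.real univ + c.toReal ^ 2))
    rwa [Real.zero_rpow hγ.ne', mul_zero] at this
  have hε' : ∀ᶠ n : ℕ in atTop, ENNReal.ofReal (lam ^ ((n : ℝ) + 1 / 2)) < ε := by
    have := ENNReal.tendsto_ofReal hlim
    rw [ENNReal.ofReal_zero] at this
    exact this.eventually_lt_const hε
  -- The first condition says that all terms of order `t²`, including the confining term of the two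
  -- halves, are smaller than the gain `c² δ t^(α-d)`.
  obtain ⟨n, hn1, hn2, hnr, hnε⟩ := ((hlim2.eventually_lt_const (by positivity :
    0 < c.toReal ^ 2 * δ)).and ((hlim.eventually_lt_const one_pos).and
      ((hlim.eventually_lt_const (by positivity : 0 < r / 8)).and hε'))).exists
  obtain ⟨t, ht⟩ : ∃ t : ℝ, t = lam ^ ((n : ℝ) + 1 / 2) := ⟨_, rfl⟩
  rw [← ht] at hn1 hn2 hnr hnε
  have ht0 : 0 < t := ht ▸ by positivity
  -- The halves end up at distance `2‖v‖ = t`, exactly a favourable radius.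
  set v : EuclideanSpace ℝ (Fin d) := EuclideanSpace.single i (t / 2) with hv
  have hvn : ‖v‖ = t / 2 :=
    (PiLp.norm_single 2 (fun _ => ℝ) i (t / 2)).trans (Real.norm_of_nonneg (by positivity))
  have h2v : ‖(2 : ℝ) • v‖ = t := by rw [norm_smul, hvn, Real.norm_two]; ring
  have h1 := hcompare v (by linarith) (by linarith) (by rw [hvn]; convert hnε using 2; ring)
  have h2 := hdrop n ((2 : ℝ) • v) (h2v.trans ht)
  rw [h2v] at h2
  rw [hvn] at h1
  have h3 : t ^ (α - (d : ℝ)) * t ^ (2 - (α - (d : ℝ))) = t ^ 2 := by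
    rw [← Real.rpow_add ht0, ← Real.rpow_natCast]; congr 1; push_cast; ring
  have h4 : 0 < t ^ (α - (d : ℝ)) := by positivity
  have h5 := mul_lt_mul_of_pos_left hn1 h4
  have h6 := mul_le_mul_of_nonneg_left h2 (sq_nonneg c.toReal)
  have h7 : t ^ (α - (d : ℝ)) * ((c.toReal * C * ρ'.real univ + c.toReal ^ 2) *
      t ^ (2 - (α - (d : ℝ)))) = (c.toReal * C * ρ'.real univ + c.toReal ^ 2) * t ^ 2 := by
    rw [← h3]; ring
  rw [h7] at h5
  have h8 : 0 ≤ c.toReal * C * ρ'.real univ * t ^ 2 := by positivity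
  have h9 : 0 < c.toReal ^ 2 * t ^ 2 := by positivity
  nlinarith

/-! ### The Riesz kernel as a superposition of Gaussians -/

open scoped FourierTransform ComplexConjugate

/-- Subtracting `exp(-s)` removes the singularity at `s = 0`, so the formula covers `p > 0`, `p = 0`
(a logarithm) and `-1 < p < 0` together. The difference of exponentials is an integral over `v`
between `1` and `u`, and Fubini gives the result. -/
theorem integral_gamma_difference {p u : ℝ} (hp : -1 < p) (hu : 0 < u) :
    IntegrableOn (fun s : ℝ => s ^ (p - 1) * (Real.exp (-(u * s)) - Real.exp (-s))) (Ioi 0) ∧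
    ∫ s in Ioi (0 : ℝ), s ^ (p - 1) * (Real.exp (-(u * s)) - Real.exp (-s))
      = -(Real.Gamma (p + 1) * ∫ v in (1 : ℝ)..u, v ^ (-(p + 1))) := by
  have hm : 0 < min 1 u := lt_min one_pos hu
  have hgam : ∀ b : ℝ, 0 < b →
      IntegrableOn (fun s : ℝ => s ^ p * Real.exp (-(b * s))) (Ioi 0) := fun b hb => by
    have := integrableOn_rpow_mul_exp_neg_mul_rpow (p := 1) (s := p) hp one_pos hb
    simpa using this
  have hpt : ∀ s : ℝ, 0 < s → s ^ (p - 1) * (Real.exp (-(u * s)) - Real.exp (-s))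
      = -∫ v in (1 : ℝ)..u, s ^ p * Real.exp (-(v * s)) := fun s hs => by
    have hd : ∀ v ∈ uIcc 1 u, HasDerivAt (fun v : ℝ => -(s ^ (p - 1)) * Real.exp (-(v * s)))
        (s ^ p * Real.exp (-(v * s))) v := fun v _ => by
      have h1 : HasDerivAt (fun v : ℝ => -(v * s)) (-(1 * s)) v :=
        ((hasDerivAt_id v).mul_const s).neg
      have h2 := (h1.exp.const_mul (-(s ^ (p - 1))))
      have : s ^ p = s ^ (p - 1) * s := by
        rw [← Real.rpow_add_one hs.ne']; congr 1; ring
      exact h2.congr_deriv (by rw [this]; ring)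
    rw [intervalIntegral.integral_eq_sub_of_hasDerivAt hd
      (Continuous.intervalIntegrable (by fun_prop) _ _)]
    rw [one_mul]; ring
  have hF : Integrable (Function.uncurry fun v s : ℝ => s ^ p * Real.exp (-(v * s)))
      ((volume.restrict (uIoc 1 u)).prod (volume.restrict (Ioi 0))) := by
    have hdom : Integrable (fun z : ℝ × ℝ => (1 : ℝ) * (z.2 ^ p * Real.exp (-(min 1 u * z.2))))
        ((volume.restrict (uIoc 1 u)).prod (volume.restrict (Ioi 0))) := by
      refine Integrable.mul_prod (f := fun _ : ℝ => (1 : ℝ)) ?_ (hgam _ hm)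
      exact integrableOn_const (by simp [uIoc])
    refine hdom.mono' ?_ ?_
    · exact Measurable.aestronglyMeasurable (by unfold Function.uncurry; fun_prop)
    · rw [Measure.prod_restrict]
      filter_upwards [ae_restrict_mem (measurableSet_uIoc.prod measurableSet_Ioi)] with z hz
      obtain ⟨h1, h2⟩ := hz
      have h2 : 0 < z.2 := h2
      have h1 : min 1 u < z.1 := h1.1
      rw [Function.uncurry, one_mul, Real.norm_of_nonneg (by positivity)]
      gcongr
  constructor
  · have h1 := hF.integral_prod_right.neg
    rcases le_total 1 u with h | h
    · refine IntegrableOn.congr_fun h1 (fun s hs => ?_) measurableSet_Ioi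
      rw [hpt s hs, intervalIntegral.integral_of_le h, uIoc_of_le h]
      rfl
    · refine IntegrableOn.congr_fun h1.neg (fun s hs => ?_) measurableSet_Ioi
      rw [hpt s hs, intervalIntegral.integral_of_ge h, uIoc_of_ge h]
      simp
  · rw [setIntegral_congr_fun measurableSet_Ioi fun s hs => hpt s hs, integral_neg,
      ← intervalIntegral_integral_swap hF, ← intervalIntegral.integral_const_mul]
    congr 1
    refine intervalIntegral.integral_congr fun v hv => ?_
    have hv0 : 0 < v := hm.trans_le hv.1
    have := Real.integral_rpow_mul_exp_neg_mul_Ioi (a := p + 1) (by linarith) hv0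
    rw [add_sub_cancel_right] at this
    rw [this, one_div, Real.inv_rpow hv0.le, ← Real.rpow_neg hv0.le, mul_comm]

/-- The additive constant in the heat-kernel representation of the Riesz kernel. -/
noncomputable def rieszShift (d : ℕ) (α : ℝ) : ℝ := if α = d then 0 else rieszConst d α

/-- The prefactor in the heat-kernel representation of the Riesz kernel. -/
noncomputable def heatConst (d : ℕ) (α : ℝ) : ℝ :=
  1 / (Real.pi ^ ((d : ℝ) / 2) * (2 : ℝ) ^ α * Real.Gamma (α / 2))

theorem heatConst_pos (hα : 0 < α) : 0 < heatConst d α := by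
  have := Real.Gamma_pos_of_pos (half_pos hα)
  unfold heatConst
  positivity

/-- The shift is the value of the kernel on the unit sphere. With `p = (d - α) / 2`, the condition
`p > -1` is `α < d + 2`. -/
theorem rieszKernel_sub_shift (hα2 : α < d + 2)
    {x : EuclideanSpace ℝ (Fin d)} (hx : x ≠ 0) :
    rieszKernel d α x - rieszShift d α = heatConst d α * ∫ s in Ioi (0 : ℝ),
      s ^ (((d : ℝ) - α) / 2 - 1) * (Real.exp (-(‖x‖ ^ 2 * s)) - Real.exp (-s)) := by
  have hx0 : 0 < ‖x‖ := norm_pos_iff.2 hx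
  have h0 : (0 : ℝ) ∉ uIcc 1 (‖x‖ ^ 2) := fun h =>
    absurd h.1 (not_le.2 (lt_min one_pos (by positivity)))
  rw [(integral_gamma_difference (by linarith) (by positivity)).2, rieszKernel, rieszShift]
  split_ifs with h
  · have hp : ((d : ℝ) - α) / 2 = 0 := by rw [h]; simp
    rw [hp, zero_add, Real.Gamma_one, one_mul]
    simp_rw [Real.rpow_neg_one]
    rw [integral_inv h0, div_one, Real.log_pow, logConst, heatConst]
    push_cast
    ring
  · have hp : ((d : ℝ) - α) / 2 ≠ 0 := by
      intro h1; apply h; linarith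
    have hG := Real.Gamma_add_one hp
    have e1 : (‖x‖ ^ 2) ^ (-(((d : ℝ) - α) / 2 + 1) + 1) = ‖x‖ ^ (α - (d : ℝ)) := by
      rw [← Real.rpow_natCast, ← Real.rpow_mul hx0.le]; congr 1; push_cast; ring
    rw [integral_rpow (Or.inr ⟨fun h1 => hp (by linarith), h0⟩), hG, e1, Real.one_rpow, rieszConst,
      heatConst]
    have e2 : -(((d : ℝ) - α) / 2 + 1) + 1 = -(((d : ℝ) - α) / 2) := by ring
    rw [e2]
    field_simp

theorem integral_rpow_mul_exp_neg_div {a b : ℝ} (ha : 0 < a) (hb : 0 < b) :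
    IntegrableOn (fun s : ℝ => s ^ (-a - 1) * Real.exp (-(b / s))) (Ioi 0) ∧
    ∫ s in Ioi (0 : ℝ), s ^ (-a - 1) * Real.exp (-(b / s)) = Real.Gamma a * b ^ (-a) := by
  have hI : IntegrableOn (fun t : ℝ => t ^ (a - 1) * Real.exp (-(b * t))) (Ioi 0) := by
    have := integrableOn_rpow_mul_exp_neg_mul_rpow (p := 1) (s := a - 1) (by linarith) one_pos hb
    simpa using this
  have hE : ∀ s ∈ Ioi (0 : ℝ), (|(-1 : ℝ)| * s ^ ((-1 : ℝ) - 1)) •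
      ((s ^ (-1 : ℝ)) ^ (a - 1) * Real.exp (-(b * s ^ (-1 : ℝ))))
      = s ^ (-a - 1) * Real.exp (-(b / s)) := fun s hs => by
    have hs : 0 < s := hs
    rw [smul_eq_mul, abs_neg, abs_one, one_mul, ← mul_assoc, ← Real.rpow_mul hs.le,
      ← Real.rpow_add hs, Real.rpow_neg_one s, div_eq_mul_inv]
    congr 2; ring
  constructor
  · have := (integrableOn_Ioi_comp_rpow_iff _ (by norm_num : (-1 : ℝ) ≠ 0)).2 hI
    exact this.congr_fun hE measurableSet_Ioi
  · have := integral_comp_rpow_Ioi (fun t : ℝ => t ^ (a - 1) * Real.exp (-(b * t)))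
      (by norm_num : (-1 : ℝ) ≠ 0)
    rw [setIntegral_congr_fun measurableSet_Ioi hE] at this
    rw [this, Real.integral_rpow_mul_exp_neg_mul_Ioi ha hb, one_div, Real.inv_rpow hb.le,
      ← Real.rpow_neg hb.le, mul_comm]

/-! ### Quadratic forms of the kernels on the Fourier side -/

/-- The real part of `φ(x) conj φ(y)`. -/
noncomputable def pairing (φ : EuclideanSpace ℝ (Fin d) → ℂ)
    (p : EuclideanSpace ℝ (Fin d) × EuclideanSpace ℝ (Fin d)) : ℝ :=
  (φ p.1 * conj (φ p.2)).re

theorem abs_pairing_le (φ : EuclideanSpace ℝ (Fin d) → ℂ)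
    (p : EuclideanSpace ℝ (Fin d) × EuclideanSpace ℝ (Fin d)) :
    |pairing φ p| ≤ ‖φ p.1‖ * ‖φ p.2‖ := by
  refine (Complex.abs_re_le_norm _).trans ?_
  rw [norm_mul, RCLike.norm_conj]

theorem integrable_gaussian {b : ℝ} (hb : 0 < b) :
    Integrable fun ξ : EuclideanSpace ℝ (Fin d) => Real.exp (-(b * ‖ξ‖ ^ 2)) := by
  have h := (GaussianFourier.integrable_cexp_neg_mul_sq_norm_add (b := (b : ℂ))
    (V := EuclideanSpace ℝ (Fin d)) (by simpa using hb) 0 0).re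
  refine h.congr (Eventually.of_forall fun ξ => ?_)
  have : Complex.exp (-(b : ℂ) * ‖ξ‖ ^ 2 + 0 * ((inner ℝ (0 : EuclideanSpace ℝ (Fin d)) ξ : ℝ) : ℂ))
      = ((Real.exp (-(b * ‖ξ‖ ^ 2)) : ℝ) : ℂ) := by
    push_cast
    simp
  exact (congrArg Complex.re this).trans (Complex.ofReal_re _)

theorem integrable_gaussian_mul_norm_sq_fourier {φ : EuclideanSpace ℝ (Fin d) → ℂ}
    (hφ : Integrable φ) {b : ℝ} (hb : 0 < b) :
    Integrable fun ξ => Real.exp (-(b * ‖ξ‖ ^ 2)) * ‖𝓕 φ ξ‖ ^ 2 := by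
  have hc : Continuous (𝓕 φ) :=
    VectorFourier.fourierIntegral_continuous Real.continuous_fourierChar
      (by exact continuous_inner) hφ
  refine (integrable_gaussian hb).mul_bdd (c := (∫ x, ‖φ x‖) ^ 2)
    (hc.norm.pow 2).aestronglyMeasurable (Eventually.of_forall fun ξ => ?_)
  rw [norm_pow, norm_norm]
  gcongr
  exact VectorFourier.norm_fourierIntegral_le_integral_norm _ _ _ _ _

/-- A Gaussian is the Fourier transform of a Gaussian, and `‖𝓕 φ ξ‖²` is a double integral of
characters against `φ ⊗ conj φ`; the two are exchanged by Fubini. -/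
theorem integral_gaussian_mul_pairing {φ : EuclideanSpace ℝ (Fin d) → ℂ} (hφ : Integrable φ)
    {s : ℝ} (hs : 0 < s) :
    ∫ p, Real.exp (-(‖p.1 - p.2‖ ^ 2 * s)) * pairing φ p
      = (Real.pi / s) ^ ((d : ℝ) / 2) *
        ∫ ξ, Real.exp (-(Real.pi ^ 2 / s * ‖ξ‖ ^ 2)) * ‖𝓕 φ ξ‖ ^ 2 := by
  have hπ := Real.pi_pos
  obtain ⟨b, hb⟩ : ∃ b : ℝ, b = Real.pi ^ 2 / s := ⟨_, rfl⟩
  have hb0 : 0 < b := by rw [hb]; positivity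
  have hΦ : Integrable (fun p : EuclideanSpace ℝ (Fin d) × EuclideanSpace ℝ (Fin d) =>
      φ p.1 * conj (φ p.2)) := hφ.mul_prod (Complex.conjLIE.integrable_comp_iff.2 hφ)
  have hg : Integrable fun ξ : EuclideanSpace ℝ (Fin d) => Complex.exp (-(b : ℂ) * ‖ξ‖ ^ 2) := by
    simpa using GaussianFourier.integrable_cexp_neg_mul_sq_norm_add (b := (b : ℂ))
      (V := EuclideanSpace ℝ (Fin d)) (by simpa using hb0) 0 0
  have hsq : ∀ ξ, ((‖𝓕 φ ξ‖ ^ 2 : ℝ) : ℂ)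
      = ∫ p : EuclideanSpace ℝ (Fin d) × EuclideanSpace ℝ (Fin d),
        Complex.exp (((-2 * Real.pi * inner ℝ ξ (p.1 - p.2) : ℝ) : ℂ) * Complex.I) *
          (φ p.1 * conj (φ p.2)) := fun ξ => by
    rw [Complex.ofReal_pow, ← Complex.mul_conj', Real.fourier_eq', ← integral_conj,
      ← integral_prod_mul]
    refine integral_congr_ae (Eventually.of_forall fun p => ?_)
    simp only [smul_eq_mul, map_mul, ← Complex.exp_conj, Complex.conj_ofReal, Complex.conj_I]
    rw [mul_mul_mul_comm, ← Complex.exp_add]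
    congr 2
    rw [inner_sub_right, real_inner_comm ξ, real_inner_comm ξ]
    push_cast
    ring
  have hint : Integrable (Function.uncurry fun (ξ : EuclideanSpace ℝ (Fin d))
      (p : EuclideanSpace ℝ (Fin d) × EuclideanSpace ℝ (Fin d)) =>
      Complex.exp (-(b : ℂ) * ‖ξ‖ ^ 2) *
      (Complex.exp (((-2 * Real.pi * inner ℝ ξ (p.1 - p.2) : ℝ) : ℂ) * Complex.I) *
          (φ p.1 * conj (φ p.2)))) (volume.prod volume) := by
    have h1 := hg.mul_prod hΦ
    have h2 : AEStronglyMeasurable (fun z : EuclideanSpace ℝ (Fin d) ×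
        (EuclideanSpace ℝ (Fin d) × EuclideanSpace ℝ (Fin d)) =>
        Complex.exp (((-2 * Real.pi * inner ℝ z.1 (z.2.1 - z.2.2) : ℝ) : ℂ) * Complex.I))
        (volume.prod volume) := Continuous.aestronglyMeasurable (by fun_prop)
    refine (h1.bdd_mul h2 (c := 1) (Eventually.of_forall fun z => ?_)).congr
      (Eventually.of_forall fun z => ?_)
    · rw [Complex.norm_exp_ofReal_mul_I]
    · simp only [Function.uncurry]; ring
  have hswap := integral_integral_swap hint
  have hL : ∫ ξ : EuclideanSpace ℝ (Fin d), ∫ p : EuclideanSpace ℝ (Fin d) ×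
      EuclideanSpace ℝ (Fin d), Complex.exp (-(b : ℂ) * ‖ξ‖ ^ 2) *
      (Complex.exp (((-2 * Real.pi * inner ℝ ξ (p.1 - p.2) : ℝ) : ℂ) * Complex.I) *
          (φ p.1 * conj (φ p.2)))
      = ((∫ ξ, Real.exp (-(b * ‖ξ‖ ^ 2)) * ‖𝓕 φ ξ‖ ^ 2 : ℝ) : ℂ) := by
    rw [← integral_complex_ofReal]
    refine integral_congr_ae (Eventually.of_forall fun ξ => ?_)
    simp only
    rw [integral_const_mul, ← hsq, Complex.ofReal_mul, Complex.ofReal_exp]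
    push_cast
    ring_nf
  have hR : ∀ p : EuclideanSpace ℝ (Fin d) × EuclideanSpace ℝ (Fin d),
      ∫ ξ : EuclideanSpace ℝ (Fin d), Complex.exp (-(b : ℂ) * ‖ξ‖ ^ 2) *
      (Complex.exp (((-2 * Real.pi * inner ℝ ξ (p.1 - p.2) : ℝ) : ℂ) * Complex.I) *
          (φ p.1 * conj (φ p.2)))
      = ((Real.pi / b) ^ ((d : ℝ) / 2) * Real.exp (-(‖p.1 - p.2‖ ^ 2 * s)) : ℝ) *
        (φ p.1 * conj (φ p.2)) := fun p => by
    have h1 := fourier_gaussian_innerProductSpace (b := (b : ℂ)) (by simpa using hb0) (p.1 - p.2)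
    rw [Real.fourier_eq'] at h1
    simp_rw [← mul_assoc]
    rw [integral_mul_const, integral_mul_const]
    congr 2
    simp only [smul_eq_mul] at h1
    simp_rw [mul_comm (Complex.exp (-(b : ℂ) * _))]
    rw [h1, finrank_euclideanSpace_fin, Complex.ofReal_mul, Complex.ofReal_exp,
      Complex.ofReal_cpow (by positivity)]
    push_cast
    congr 2
    rw [hb]
    push_cast
    have : (Real.pi : ℂ) ≠ 0 := by exact_mod_cast hπ.ne'
    have : (s : ℂ) ≠ 0 := by exact_mod_cast hs.ne'
    field_simp
  rw [hL] at hswap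
  simp_rw [hR] at hswap
  have hre := congrArg Complex.re hswap
  have hΦ' : Integrable (fun p : EuclideanSpace ℝ (Fin d) × EuclideanSpace ℝ (Fin d) =>
      ((((Real.pi / b) ^ ((d : ℝ) / 2) * Real.exp (-(‖p.1 - p.2‖ ^ 2 * s)) : ℝ) : ℂ) *
        (φ p.1 * conj (φ p.2)))) := hint.integral_prod_right.congr (Eventually.of_forall hR)
  rw [Complex.ofReal_re] at hre
  have hre2 : (∫ p : EuclideanSpace ℝ (Fin d) × EuclideanSpace ℝ (Fin d),
      ((((Real.pi / b) ^ ((d : ℝ) / 2) * Real.exp (-(‖p.1 - p.2‖ ^ 2 * s)) : ℝ) : ℂ) *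
        (φ p.1 * conj (φ p.2)))).re
      = (Real.pi / b) ^ ((d : ℝ) / 2) * ∫ p, Real.exp (-(‖p.1 - p.2‖ ^ 2 * s)) * pairing φ p := by
    rw [← integral_const_mul]
    refine (integral_re hΦ').symm.trans (integral_congr_ae (Eventually.of_forall fun p => ?_))
    simp only [RCLike.re_to_complex, Complex.re_ofReal_mul, pairing]
    ring
  rw [hre2] at hre
  rw [← hb, hre, ← mul_assoc, ← Real.mul_rpow (by positivity) (by positivity)]
  have : Real.pi / s * (Real.pi / b) = 1 := by rw [hb]; field_simp
  rw [this, Real.one_rpow, one_mul]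

theorem integrable_pairing {φ : EuclideanSpace ℝ (Fin d) → ℂ} (hφ : Integrable φ) :
    Integrable (pairing φ) (volume.prod volume) := by
  have h : Integrable (fun p : EuclideanSpace ℝ (Fin d) × EuclideanSpace ℝ (Fin d) =>
    φ p.1 * conj (φ p.2)) (volume.prod volume) :=
    hφ.mul_prod (Complex.conjLIE.integrable_comp_iff.2 hφ)
  exact h.re

theorem integral_pairing {φ : EuclideanSpace ℝ (Fin d) → ℂ} (hφ : Integrable φ)
    (h0 : ∫ x, φ x = 0) : ∫ p, pairing φ p ∂volume.prod volume = 0 := by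
  have h : Integrable (fun p : EuclideanSpace ℝ (Fin d) × EuclideanSpace ℝ (Fin d) =>
    φ p.1 * conj (φ p.2)) (volume.prod volume) :=
    hφ.mul_prod (Complex.conjLIE.integrable_comp_iff.2 hφ)
  have h1 := integral_re h
  have h2 := integral_prod_mul (μ := volume) (ν := volume) φ (fun y => conj (φ y))
  rw [h0, zero_mul] at h2
  rw [h2] at h1
  exact h1.trans (map_zero _)

theorem integrable_kernel_mul_pairing {k : EuclideanSpace ℝ (Fin d) → ℝ} (hk : Measurable k)
    {φ : EuclideanSpace ℝ (Fin d) → ℂ} (hφ : Integrable φ) {B R : ℝ} (hB : ∀ x, ‖φ x‖ ≤ B)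
    (hR : ∀ x, R < ‖x‖ → φ x = 0) (hkR : IntegrableOn k (Metric.ball 0 (2 * R + 1))) :
    Integrable (fun p => k (p.1 - p.2) * pairing φ p) (volume.prod volume) := by
  have hg : Integrable ((Metric.ball 0 (2 * R + 1)).indicator k) :=
    (integrable_indicator_iff Metric.isOpen_ball.measurableSet).2 hkR
  have h1 := (hφ.norm.convolution_integrand (ContinuousLinearMap.mul ℝ ℝ) hg).norm.const_mul B
  refine h1.mono' ((hk.comp (measurable_fst.sub measurable_snd)).aestronglyMeasurable.mul
    (integrable_pairing hφ).aestronglyMeasurable) (Eventually.of_forall fun p => ?_)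
  rw [norm_mul, Real.norm_eq_abs (pairing φ p)]
  have hp := abs_pairing_le φ p
  by_cases h : R < ‖p.1‖ ∨ R < ‖p.2‖
  · have : pairing φ p = 0 := by
      rcases h with h | h <;> simp [pairing, hR _ h]
    rw [this, abs_zero, mul_zero]
    have : 0 ≤ B := (norm_nonneg _).trans (hB 0)
    positivity
  · push Not at h
    have hmem : p.1 - p.2 ∈ Metric.ball (0 : EuclideanSpace ℝ (Fin d)) (2 * R + 1) := by
      rw [mem_ball_zero_iff]
      exact (norm_sub_le _ _).trans_lt (by linarith [h.1, h.2])
    simp only [ContinuousLinearMap.mul_apply', indicator_of_mem hmem, norm_mul, norm_norm]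
    calc ‖k (p.1 - p.2)‖ * |pairing φ p| ≤ ‖k (p.1 - p.2)‖ * (B * ‖φ p.2‖) := by
          gcongr
          exact hp.trans (by gcongr; exact hB _)
      _ = _ := by ring

theorem ae_prod_sub_ne_zero (hd : 1 ≤ d) :
    ∀ᵐ p : EuclideanSpace ℝ (Fin d) × EuclideanSpace ℝ (Fin d) ∂volume.prod volume,
      p.1 - p.2 ≠ 0 := by
  have : Nontrivial (EuclideanSpace ℝ (Fin d)) :=
    Module.nontrivial_of_finrank_pos (R := ℝ) (by rw [finrank_euclideanSpace_fin]; omega)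
  exact (quasiMeasurePreserving_sub_of_right_invariant volume volume).ae
    (Measure.ae_ne volume (0 : EuclideanSpace ℝ (Fin d)))

/-- The integrand has constant sign. This turns the absolute integrability needed for Fubini into
that of the shifted Riesz kernel. -/
theorem integral_norm_gamma_difference (p u : ℝ) :
    ∫ s in Ioi (0 : ℝ), ‖s ^ (p - 1) * (Real.exp (-(u * s)) - Real.exp (-s))‖
      = |∫ s in Ioi (0 : ℝ), s ^ (p - 1) * (Real.exp (-(u * s)) - Real.exp (-s))| := by
  rcases le_total u 1 with h | h
  · have h1 : ∀ s ∈ Ioi (0 : ℝ), 0 ≤ s ^ (p - 1) * (Real.exp (-(u * s)) - Real.exp (-s)) :=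
      fun s hs => by
        have hs : 0 < s := hs
        refine mul_nonneg (by positivity) (sub_nonneg.2 (Real.exp_le_exp.2 ?_))
        nlinarith
    rw [abs_of_nonneg (setIntegral_nonneg measurableSet_Ioi h1)]
    exact setIntegral_congr_fun measurableSet_Ioi fun s hs => Real.norm_of_nonneg (h1 s hs)
  · have h1 : ∀ s ∈ Ioi (0 : ℝ), s ^ (p - 1) * (Real.exp (-(u * s)) - Real.exp (-s)) ≤ 0 :=
      fun s hs => by
        have hs : 0 < s := hs
        refine mul_nonpos_of_nonneg_of_nonpos (by positivity)
          (sub_nonpos.2 (Real.exp_le_exp.2 ?_))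
        nlinarith
    rw [abs_of_nonpos (setIntegral_nonpos measurableSet_Ioi h1), ← integral_neg]
    exact setIntegral_congr_fun measurableSet_Ioi fun s hs => Real.norm_of_nonpos (h1 s hs)

/-- The mean-zero condition kills both the constant shift and the subtracted `exp(-s)`. Each
Gaussian then passes to the Fourier side, where integrating over `s` produces the symbol
`(2π‖ξ‖)^(-α)`. -/
theorem integral_rieszKernel_mul_pairing (hd : 1 ≤ d) (hα0 : 0 < α) (hα2 : α < d + 2)
    {φ : EuclideanSpace ℝ (Fin d) → ℂ} (hφ : Integrable φ) {B R : ℝ} (hB : ∀ x, ‖φ x‖ ≤ B)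
    (hR : ∀ x, R < ‖x‖ → φ x = 0) (h0 : ∫ x, φ x = 0)
    (hfin : Integrable fun ξ => (2 * Real.pi * ‖ξ‖) ^ (-α) * ‖𝓕 φ ξ‖ ^ 2) :
    ∫ p, rieszKernel d α (p.1 - p.2) * pairing φ p ∂volume.prod volume
      = ∫ ξ, (2 * Real.pi * ‖ξ‖) ^ (-α) * ‖𝓕 φ ξ‖ ^ 2 := by
  have hπ := Real.pi_pos
  have hA : 0 < heatConst d α := heatConst_pos hα0
  have hβ := integrable_pairing hφ
  have hβ0 := integral_pairing hφ h0
  have hK := integrable_kernel_mul_pairing (measurable_rieszKernel d α) hφ hB hR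
    (rieszKernel_integrableOn_ball hd hα0 _)
  have hne := ae_prod_sub_ne_zero hd
  obtain ⟨q, hq⟩ : ∃ q : ℝ, q = ((d : ℝ) - α) / 2 := ⟨_, rfl⟩
  have hq1 : -1 < q := by rw [hq]; linarith
  -- the kernel minus a constant
  have hKs : Integrable (fun p : EuclideanSpace ℝ (Fin d) × EuclideanSpace ℝ (Fin d) =>
      (rieszKernel d α (p.1 - p.2) - rieszShift d α) * pairing φ p) (volume.prod volume) := by
    simp_rw [sub_mul]
    exact hK.sub (hβ.const_mul _)
  have hshift : ∫ p, rieszKernel d α (p.1 - p.2) * pairing φ p ∂volume.prod volume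
      = ∫ p, (rieszKernel d α (p.1 - p.2) - rieszShift d α) * pairing φ p ∂volume.prod volume := by
    simp_rw [sub_mul]
    rw [integral_sub hK (hβ.const_mul _), integral_const_mul, hβ0, mul_zero, sub_zero]
  -- first use of Fubini
  obtain ⟨G, hG⟩ : ∃ G : EuclideanSpace ℝ (Fin d) × EuclideanSpace ℝ (Fin d) → ℝ → ℝ,
    G = fun p s => s ^ (q - 1) * (Real.exp (-(‖p.1 - p.2‖ ^ 2 * s)) - Real.exp (-s)) *
      pairing φ p := ⟨_, rfl⟩
  have hGint : Integrable (Function.uncurry G)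
      ((volume.prod volume).prod (volume.restrict (Ioi (0 : ℝ)))) := by
    have hmeas : AEStronglyMeasurable (Function.uncurry G)
        ((volume.prod volume).prod (volume.restrict (Ioi (0 : ℝ)))) := by
      rw [hG]
      refine AEStronglyMeasurable.mul (f := fun z : (EuclideanSpace ℝ (Fin d) ×
        EuclideanSpace ℝ (Fin d)) × ℝ => z.2 ^ (q - 1) *
          (Real.exp (-(‖z.1.1 - z.1.2‖ ^ 2 * z.2)) - Real.exp (-z.2))) ?_
        hβ.aestronglyMeasurable.comp_fst
      exact Measurable.aestronglyMeasurable (by fun_prop)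
    rw [integrable_prod_iff hmeas]
    constructor
    · filter_upwards [hne] with p hp
      have := (integral_gamma_difference (u := ‖p.1 - p.2‖ ^ 2) hq1
        (by have := norm_pos_iff.2 hp; positivity)).1
      simp only [Function.uncurry, hG]
      exact this.mul_const _
    · refine (hKs.norm.const_mul (heatConst d α)⁻¹).congr (hne.mono fun p hp => ?_)
      simp only [Function.uncurry, hG, norm_mul (_ * _) (pairing φ p)]
      rw [integral_mul_const, integral_norm_gamma_difference, rieszKernel_sub_shift hα2 hp,
        ← hq, norm_mul _ (pairing φ p), norm_mul (heatConst d α), Real.norm_of_nonneg hA.le, Real.norm_eq_abs]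
      field_simp
  have hswap : ∫ p, (rieszKernel d α (p.1 - p.2) - rieszShift d α) * pairing φ p ∂volume.prod volume
      = heatConst d α * ∫ s in Ioi (0 : ℝ), ∫ p, G p s ∂volume.prod volume := by
    rw [← integral_integral_swap hGint, ← integral_const_mul]
    refine integral_congr_ae (hne.mono fun p hp => ?_)
    simp only [hG]
    rw [rieszKernel_sub_shift hα2 hp, integral_mul_const, ← hq, mul_assoc]
  -- second use of Fubini
  obtain ⟨H, hH⟩ : ∃ H : EuclideanSpace ℝ (Fin d) → ℝ → ℝ,
    H = fun ξ s => s ^ (-(α / 2) - 1) * Real.exp (-(Real.pi ^ 2 * ‖ξ‖ ^ 2 / s)) * ‖𝓕 φ ξ‖ ^ 2 :=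
    ⟨_, rfl⟩
  have hGs : ∀ s ∈ Ioi (0 : ℝ), ∫ p, G p s ∂volume.prod volume
      = Real.pi ^ ((d : ℝ) / 2) * ∫ ξ, H ξ s := fun s hs => by
    have hs : 0 < s := hs
    have e1 : ∀ p, G p s = s ^ (q - 1) * (Real.exp (-(‖p.1 - p.2‖ ^ 2 * s)) * pairing φ p
        - Real.exp (-s) * pairing φ p) := fun p => by rw [hG]; ring
    have hi : Integrable (fun p => Real.exp (-(‖p.1 - p.2‖ ^ 2 * s)) * pairing φ p)
        (volume.prod volume) := by
      refine hβ.bdd_mul (c := 1) (Continuous.aestronglyMeasurable (by fun_prop))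
        (Eventually.of_forall fun p => ?_)
      rw [Real.norm_of_nonneg (Real.exp_pos _).le]
      exact Real.exp_le_one_iff.2 (neg_nonpos.2 (by positivity))
    simp_rw [e1]
    have hgauss := integral_gaussian_mul_pairing hφ hs
    rw [Measure.volume_eq_prod] at hgauss
    rw [integral_const_mul, integral_sub hi (hβ.const_mul _), integral_const_mul, hβ0, mul_zero,
      sub_zero, hgauss, Real.div_rpow hπ.le hs.le, ← integral_const_mul, ← integral_const_mul,
      ← integral_const_mul]
    refine integral_congr_ae (Eventually.of_forall fun ξ => ?_)
    have e2 : s ^ (-(α / 2) - 1) = s ^ (q - 1) / s ^ ((d : ℝ) / 2) := by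
      rw [← Real.rpow_sub hs, hq]; congr 1; ring
    simp only [hH, e2]
    rw [div_mul_eq_mul_div (Real.pi ^ 2) s]
    field_simp
  have hξ : ∀ᵐ ξ : EuclideanSpace ℝ (Fin d), ξ ≠ 0 := by
    have : Nontrivial (EuclideanSpace ℝ (Fin d)) :=
      Module.nontrivial_of_finrank_pos (R := ℝ) (by rw [finrank_euclideanSpace_fin]; omega)
    exact Measure.ae_ne volume 0
  have hinner : ∀ ξ : EuclideanSpace ℝ (Fin d), ξ ≠ 0 →
      Integrable (H ξ) (volume.restrict (Ioi 0)) ∧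
      ∫ s in Ioi (0 : ℝ), H ξ s = Real.Gamma (α / 2) * (2 : ℝ) ^ α *
        ((2 * Real.pi * ‖ξ‖) ^ (-α) * ‖𝓕 φ ξ‖ ^ 2) := fun ξ hξ => by
    have hξ0 := norm_pos_iff.2 hξ
    obtain ⟨i1, i2⟩ := integral_rpow_mul_exp_neg_div (a := α / 2) (b := Real.pi ^ 2 * ‖ξ‖ ^ 2)
      (by positivity) (by positivity)
    simp only [hH]
    refine ⟨i1.mul_const _, ?_⟩
    rw [integral_mul_const, i2]
    have e3 : (Real.pi ^ 2 * ‖ξ‖ ^ 2) ^ (-(α / 2)) = (2 : ℝ) ^ α * (2 * Real.pi * ‖ξ‖) ^ (-α) := by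
      rw [mul_assoc 2, Real.mul_rpow two_pos.le (by positivity), ← mul_assoc,
        ← Real.rpow_add two_pos, add_neg_cancel, Real.rpow_zero, one_mul, ← mul_pow,
        ← Real.rpow_natCast, ← Real.rpow_mul (by positivity)]
      congr 1; push_cast; ring
    rw [e3]; ring
  have hHint : Integrable (Function.uncurry H) (volume.prod (volume.restrict (Ioi (0 : ℝ)))) := by
    have hc : Continuous (𝓕 φ) :=
      VectorFourier.fourierIntegral_continuous Real.continuous_fourierChar
        (by exact continuous_inner) hφ
    have hmeas : AEStronglyMeasurable (Function.uncurry H)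
        (volume.prod (volume.restrict (Ioi (0 : ℝ)))) := by
      rw [hH]
      have := hc.measurable
      refine Measurable.aestronglyMeasurable ?_
      unfold Function.uncurry
      fun_prop
    rw [integrable_prod_iff hmeas]
    refine ⟨hξ.mono fun ξ h => (hinner ξ h).1, ?_⟩
    refine (hfin.const_mul (Real.Gamma (α / 2) * (2 : ℝ) ^ α)).congr (hξ.mono fun ξ h => ?_)
    simp only [Function.uncurry]
    rw [← (hinner ξ h).2]
    refine setIntegral_congr_fun measurableSet_Ioi fun s hs => ?_
    have hs : 0 < s := hs
    simp only [hH]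
    rw [Real.norm_of_nonneg (by positivity)]
  rw [hshift, hswap, setIntegral_congr_fun measurableSet_Ioi hGs, integral_const_mul,
    ← integral_integral_swap hHint, integral_congr_ae (hξ.mono fun ξ h => (hinner ξ h).2),
    integral_const_mul, heatConst]
  have := Real.Gamma_pos_of_pos (half_pos hα0)
  field_simp

/-- Expand `‖x - y‖²`: the pure squares vanish since `φ` has mean zero, and the cross term gives
`-2` times the squared norm of the first moment of `φ`. -/
theorem integral_norm_sq_mul_pairing_nonpos {φ : EuclideanSpace ℝ (Fin d) → ℂ} (hφ : Integrable φ)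
    {R : ℝ} (hR : ∀ x, R < ‖x‖ → φ x = 0) (h0 : ∫ x, φ x = 0) :
    ∫ p, ‖p.1 - p.2‖ ^ 2 * pairing φ p ∂volume.prod volume ≤ 0 := by
  have hI : ∀ f : EuclideanSpace ℝ (Fin d) → ℝ, Continuous f →
      Integrable fun x => (f x : ℂ) * φ x := fun f hf => by
    obtain ⟨C, hC⟩ := (isCompact_closedBall (0 : EuclideanSpace ℝ (Fin d)) R).exists_bound_of_continuousOn
      hf.continuousOn
    refine (hφ.norm.const_mul |C|).mono'
      ((Complex.continuous_ofReal.comp hf).aestronglyMeasurable.mul hφ.aestronglyMeasurable)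
      (Eventually.of_forall fun x => ?_)
    rcases lt_or_ge R ‖x‖ with h | h
    · simp [hR x h]
    · rw [norm_mul, Complex.norm_real]
      gcongr
      exact (hC x (by simpa using h)).trans (le_abs_self C)
  have hP : ∀ f g : EuclideanSpace ℝ (Fin d) → ℝ, Continuous f → Continuous g →
      Integrable (fun p : EuclideanSpace ℝ (Fin d) × EuclideanSpace ℝ (Fin d) =>
        f p.1 * g p.2 * pairing φ p) (volume.prod volume) ∧
      ∫ p, f p.1 * g p.2 * pairing φ p ∂volume.prod volume
        = ((∫ x, (f x : ℂ) * φ x) * conj (∫ x, (g x : ℂ) * φ x)).re := fun f g hf hg => by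
    have h1 : Integrable (fun p : EuclideanSpace ℝ (Fin d) × EuclideanSpace ℝ (Fin d) =>
        ((f p.1 : ℂ) * φ p.1) * conj ((g p.2 : ℂ) * φ p.2)) (volume.prod volume) :=
      (hI f hf).mul_prod (Complex.conjLIE.integrable_comp_iff.2 (hI g hg))
    have e : ∀ p : EuclideanSpace ℝ (Fin d) × EuclideanSpace ℝ (Fin d),
        (((f p.1 : ℂ) * φ p.1) * conj ((g p.2 : ℂ) * φ p.2)).re = f p.1 * g p.2 * pairing φ p :=
      fun p => by
        rw [map_mul, Complex.conj_ofReal, mul_mul_mul_comm, ← Complex.ofReal_mul,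
          Complex.re_ofReal_mul, pairing]
    refine ⟨h1.re.congr (Eventually.of_forall e), ?_⟩
    rw [← integral_conj, ← integral_prod_mul]
    refine Eq.trans ?_ (integral_re h1)
    exact integral_congr_ae (Eventually.of_forall fun p => (e p).symm)
  have hc : ∀ i : Fin d, Continuous fun x : EuclideanSpace ℝ (Fin d) => x i := fun i => by fun_prop
  have hone := hP (fun x => ‖x‖ ^ 2) (fun _ => 1) (by fun_prop) (by fun_prop)
  have htwo := hP (fun _ => 1) (fun x => ‖x‖ ^ 2) (by fun_prop) (by fun_prop)
  have hi := fun i : Fin d => hP (fun x => x i) (fun x => x i) (hc i) (hc i)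
  have hsum : Integrable (fun p : EuclideanSpace ℝ (Fin d) × EuclideanSpace ℝ (Fin d) =>
      ∑ i, p.1 i * p.2 i * pairing φ p) (volume.prod volume) :=
    integrable_finsetSum _ fun i _ => (hi i).1
  have e : ∀ p : EuclideanSpace ℝ (Fin d) × EuclideanSpace ℝ (Fin d),
      ‖p.1 - p.2‖ ^ 2 * pairing φ p = (‖p.1‖ ^ 2 * 1 * pairing φ p + 1 * ‖p.2‖ ^ 2 * pairing φ p)
        - 2 * ∑ i, p.1 i * p.2 i * pairing φ p := fun p => by
    have : inner ℝ p.1 p.2 = ∑ i, p.1 i * p.2 i := by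
      rw [PiLp.inner_apply]
      exact Finset.sum_congr rfl fun i _ => by simp [mul_comm]
    rw [norm_sub_sq_real, this, ← Finset.sum_mul]
    ring
  have h12 : Integrable (fun p : EuclideanSpace ℝ (Fin d) × EuclideanSpace ℝ (Fin d) =>
    ‖p.1‖ ^ 2 * 1 * pairing φ p + 1 * ‖p.2‖ ^ 2 * pairing φ p) (volume.prod volume) :=
    hone.1.add htwo.1
  have h1 : ∫ x, ((1 : ℝ) : ℂ) * φ x = 0 := by simpa using h0
  simp_rw [e]
  rw [integral_sub h12 (hsum.const_mul 2), integral_add hone.1 htwo.1, hone.2, htwo.2, h1,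
    integral_const_mul, integral_finsetSum _ fun i _ => (hi i).1]
  have hnn : 0 ≤ ∑ i, ∫ p : EuclideanSpace ℝ (Fin d) × EuclideanSpace ℝ (Fin d),
      p.1 i * p.2 i * pairing φ p ∂volume.prod volume := Finset.sum_nonneg fun i _ => by
    rw [(hi i).2, Complex.mul_conj, Complex.ofReal_re]
    exact Complex.normSq_nonneg _
  simp only [map_zero, mul_zero, zero_mul, Complex.zero_re, add_zero]
  linarith

theorem gaussTerm_eq (hl : 0 < lam) (γ : ℝ) (k : ℕ) (r : ℝ) :
    gaussTerm γ lam k r =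
      (lam ^ (k + 1)) ^ γ * Real.exp (-(r ^ 2 * (1 / (2 * (lam ^ (k + 1)) ^ 2)))) := by
  have e1 : lam ^ (2 * (k + 1)) = (lam ^ (k + 1)) ^ 2 := by rw [← pow_mul, mul_comm]
  have e2 : lam ^ (γ * ((k : ℝ) + 1)) = (lam ^ (k + 1)) ^ γ := by
    rw [← Real.rpow_natCast, ← Real.rpow_mul hl.le]
    congr 1; push_cast; ring
  rw [gaussTerm, e1, e2, neg_div, mul_one_div]

theorem integral_gaussTerm_mul_pairing (hl : 0 < lam) {φ : EuclideanSpace ℝ (Fin d) → ℂ}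
    (hφ : Integrable φ) (k : ℕ) :
    ∫ p, gaussTerm (α - d) lam k ‖p.1 - p.2‖ * pairing φ p ∂volume.prod volume
      = (2 * Real.pi) ^ ((d : ℝ) / 2) * (lam ^ (k + 1)) ^ α *
        ∫ ξ, Real.exp (-(2 * Real.pi ^ 2 * (lam ^ (k + 1)) ^ 2 * ‖ξ‖ ^ 2)) * ‖𝓕 φ ξ‖ ^ 2 := by
  have hπ := Real.pi_pos
  obtain ⟨v, hv⟩ : ∃ v : ℝ, v = lam ^ (k + 1) := ⟨_, rfl⟩
  have hv0 : 0 < v := hv ▸ by positivity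
  simp_rw [gaussTerm_eq hl, ← hv, mul_assoc]
  have h := integral_gaussian_mul_pairing hφ (s := 1 / (2 * v ^ 2)) (by positivity)
  rw [Measure.volume_eq_prod] at h
  have e1 : Real.pi / (1 / (2 * v ^ 2)) = 2 * Real.pi * v ^ 2 := by field_simp
  have e2 : Real.pi ^ 2 / (1 / (2 * v ^ 2)) = 2 * Real.pi ^ 2 * v ^ 2 := by field_simp
  have e3 : v ^ (α - d) * (v ^ 2) ^ ((d : ℝ) / 2) = v ^ α := by
    rw [← Real.rpow_natCast, ← Real.rpow_mul hv0.le, ← Real.rpow_add hv0]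
    congr 1; push_cast; ring
  rw [integral_const_mul, h, e1, e2, Real.mul_rpow (by positivity) (by positivity), ← e3]
  simp only [mul_assoc]
  ring

/-- The `k`-th term has integral `(2π)^(d/2) lam^(α(k+1))`: the volume factor turns the exponent `α
- d` into `α > 0`. -/
theorem integrable_tsum_gaussTerm (hd : 1 ≤ d) (hα0 : 0 < α) (hl : 0 < lam) (hl1 : lam < 1) :
    Integrable fun x : EuclideanSpace ℝ (Fin d) => ∑' k : ℕ, gaussTerm (α - d) lam k ‖x‖ := by
  have hπ := Real.pi_pos
  have : Nontrivial (EuclideanSpace ℝ (Fin d)) :=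
    Module.nontrivial_of_finrank_pos (R := ℝ) (by rw [finrank_euclideanSpace_fin]; omega)
  have hmk : ∀ k, Measurable fun x : EuclideanSpace ℝ (Fin d) => gaussTerm (α - d) lam k ‖x‖ :=
    fun k => (measurable_gaussTerm _ _ k).comp measurable_norm
  have hne : ∀ᵐ x : EuclideanSpace ℝ (Fin d), x ≠ 0 := Measure.ae_ne volume 0
  have hnn : ∀ k (x : EuclideanSpace ℝ (Fin d)), 0 ≤ gaussTerm (α - d) lam k ‖x‖ :=
    fun k x => gaussTerm_nonneg hl _ _ _
  have hq1 : lam ^ α < 1 := Real.rpow_lt_one hl.le hl1 hα0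
  have hterm : ∀ k : ℕ, ∫⁻ x : EuclideanSpace ℝ (Fin d),
      ENNReal.ofReal (gaussTerm (α - d) lam k ‖x‖)
      = ENNReal.ofReal ((2 * Real.pi) ^ ((d : ℝ) / 2) * (lam ^ α) ^ (k + 1)) := fun k => by
    obtain ⟨v, hv⟩ : ∃ v : ℝ, v = lam ^ (k + 1) := ⟨_, rfl⟩
    have hv0 : 0 < v := hv ▸ by positivity
    have hb : 0 < 1 / (2 * v ^ 2) := by positivity
    have hfun : (fun x : EuclideanSpace ℝ (Fin d) => gaussTerm (α - d) lam k ‖x‖)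
        = fun x => v ^ (α - d) * Real.exp (-(1 / (2 * v ^ 2)) * ‖x‖ ^ 2) := by
      funext x
      rw [gaussTerm_eq hl, ← hv, neg_mul, mul_comm (‖x‖ ^ 2)]
    have hint : Integrable fun x : EuclideanSpace ℝ (Fin d) => gaussTerm (α - d) lam k ‖x‖ := by
      rw [hfun]
      simp_rw [neg_mul]
      exact (integrable_gaussian hb).const_mul _
    rw [← ofReal_integral_eq_lintegral_ofReal hint (Eventually.of_forall (hnn k)), hfun,
      integral_const_mul, GaussianFourier.integral_rexp_neg_mul_sq_norm hb,
      finrank_euclideanSpace_fin]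
    congr 1
    have e1 : Real.pi / (1 / (2 * v ^ 2)) = 2 * Real.pi * v ^ 2 := by field_simp
    have e3 : v ^ (α - d) * (v ^ 2) ^ ((d : ℝ) / 2) = v ^ α := by
      rw [← Real.rpow_natCast, ← Real.rpow_mul hv0.le, ← Real.rpow_add hv0]
      congr 1; push_cast; ring
    have e4 : (lam ^ α) ^ (k + 1) = v ^ α := by
      rw [hv, ← Real.rpow_natCast, ← Real.rpow_natCast, ← Real.rpow_mul hl.le,
        ← Real.rpow_mul hl.le, mul_comm]
    rw [e1, Real.mul_rpow (by positivity) (by positivity), e4, ← e3]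
    ring
  have hmeas : Measurable fun x : EuclideanSpace ℝ (Fin d) =>
      ∑' k : ℕ, gaussTerm (α - d) lam k ‖x‖ := by
    have h : ∀ x : EuclideanSpace ℝ (Fin d), ∑' k : ℕ, gaussTerm (α - d) lam k ‖x‖
        = (∑' k : ℕ, ENNReal.ofReal (gaussTerm (α - d) lam k ‖x‖)).toReal := fun x => by
      rw [ENNReal.tsum_toReal_eq fun _ => ENNReal.ofReal_ne_top]
      exact tsum_congr fun k => (ENNReal.toReal_ofReal (hnn k x)).symm
    simp_rw [h]
    exact (Measurable.tsum fun k => (hmk k).ennreal_ofReal).ennreal_toReal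
  refine ⟨hmeas.aestronglyMeasurable, ?_⟩
  have hsumm : Summable fun k : ℕ => (2 * Real.pi) ^ ((d : ℝ) / 2) * (lam ^ α) ^ (k + 1) :=
    ((summable_geometric_of_lt_one (by positivity) hq1).comp_injective
      (add_left_injective 1)).mul_left _
  calc ∫⁻ x : EuclideanSpace ℝ (Fin d), ‖∑' k : ℕ, gaussTerm (α - d) lam k ‖x‖‖ₑ
      = ∫⁻ x : EuclideanSpace ℝ (Fin d), ∑' k : ℕ,
          ENNReal.ofReal (gaussTerm (α - d) lam k ‖x‖) := by
        refine lintegral_congr_ae (hne.mono fun x hx => ?_)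
        simp only
        rw [Real.enorm_of_nonneg (tsum_nonneg fun k => hnn k x),
          ENNReal.ofReal_tsum_of_nonneg (fun k => hnn k x)
            (summable_gaussTerm_of_ne _ hl hl1 (norm_ne_zero_iff.2 hx))]
    _ = ∑' k : ℕ, ENNReal.ofReal ((2 * Real.pi) ^ ((d : ℝ) / 2) * (lam ^ α) ^ (k + 1)) := by
        rw [lintegral_tsum fun k => (hmk k).ennreal_ofReal.aemeasurable]
        exact tsum_congr hterm
    _ = ENNReal.ofReal (∑' k : ℕ, (2 * Real.pi) ^ ((d : ℝ) / 2) * (lam ^ α) ^ (k + 1)) :=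
        (ENNReal.ofReal_tsum_of_nonneg (fun k => by positivity) hsumm).symm
    _ < ⊤ := ENNReal.ofReal_lt_top

/-- Each Gaussian is positive definite and enters with a minus sign, so dropping all but the `n`-th
only increases the form; so does dropping the quadratic term. -/
theorem integral_realPotential_mul_pairing_le (hd : 1 ≤ d) (hα0 : 0 < α) (hα2 : α < d + 2)
    (hl : 0 < lam) (hl1 : lam < 1) (hc : 0 < cW)
    {φ : EuclideanSpace ℝ (Fin d) → ℂ} (hφ : Integrable φ) {B R : ℝ} (hB : ∀ x, ‖φ x‖ ≤ B)
    (hR : ∀ x, R < ‖x‖ → φ x = 0) (h0 : ∫ x, φ x = 0)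
    (hfin : Integrable fun ξ => (2 * Real.pi * ‖ξ‖) ^ (-α) * ‖𝓕 φ ξ‖ ^ 2) (n : ℕ) :
    ∫ p, realPotential d α cW lam (p.1 - p.2) * pairing φ p ∂volume.prod volume
      ≤ ∫ ξ, ((2 * Real.pi * ‖ξ‖) ^ (-α) - cW * ((2 * Real.pi) ^ ((d : ℝ) / 2) *
        (lam ^ (n + 1)) ^ α * Real.exp (-(2 * Real.pi ^ 2 * (lam ^ (n + 1)) ^ 2 * ‖ξ‖ ^ 2)))) *
          ‖𝓕 φ ξ‖ ^ 2 := by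
  have hπ := Real.pi_pos
  have hS := integrable_tsum_gaussTerm (d := d) (α := α) hd hα0 hl hl1
  obtain ⟨S, hSdef⟩ : ∃ S : EuclideanSpace ℝ (Fin d) → ℝ,
    S = fun x => ∑' k : ℕ, gaussTerm (α - d) lam k ‖x‖ := ⟨_, rfl⟩
  rw [← hSdef] at hS
  have hβ := integrable_pairing hφ
  have i1 := integrable_kernel_mul_pairing (measurable_rieszKernel d α) hφ hB hR
    (rieszKernel_integrableOn_ball hd hα0 _)
  have i2 : Integrable (fun p : EuclideanSpace ℝ (Fin d) × EuclideanSpace ℝ (Fin d) =>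
      ‖p.1 - p.2‖ ^ 2 * pairing φ p) (volume.prod volume) :=
    integrable_kernel_mul_pairing (k := fun x => ‖x‖ ^ 2) (by fun_prop) hφ hB hR
      ((continuous_norm.pow 2).continuousOn.integrableOn_compact
        (isCompact_closedBall 0 _) |>.mono_set Metric.ball_subset_closedBall)
  have hSm : Measurable S := by
    have h1 := measurable_realPotential (d := d) (α := α) (cW := 1) hl
    have h2 := measurable_rieszKernel d α
    have : S = fun x => rieszKernel d α x + ‖x‖ ^ 2 / 2 - realPotential d α 1 lam x := by
      funext x
      rw [hSdef, realPotential]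
      ring
    rw [this]
    fun_prop
  have i3 := integrable_kernel_mul_pairing hSm hφ hB hR hS.integrableOn
  have hne := ae_prod_sub_ne_zero hd
  have hsum : HasSum (fun k : ℕ => ∫ p, gaussTerm (α - d) lam k ‖p.1 - p.2‖ * pairing φ p
      ∂volume.prod volume) (∫ p, S (p.1 - p.2) * pairing φ p ∂volume.prod volume) := by
    have hsm : ∀ p : EuclideanSpace ℝ (Fin d) × EuclideanSpace ℝ (Fin d), p.1 - p.2 ≠ 0 →
        Summable fun k => gaussTerm (α - d) lam k ‖p.1 - p.2‖ := fun p hp =>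
      summable_gaussTerm_of_ne _ hl hl1 (norm_ne_zero_iff.2 hp)
    refine hasSum_integral_of_dominated_convergence
      (fun k p => gaussTerm (α - d) lam k ‖p.1 - p.2‖ * |pairing φ p|) (fun k => ?_) (fun k => ?_)
      (hne.mono fun p hp => (hsm p hp).mul_right _) ?_ (hne.mono fun p hp => ?_)
    · exact ((measurable_gaussTerm _ _ k).comp (by fun_prop)).aestronglyMeasurable.mul
        hβ.aestronglyMeasurable
    · refine Eventually.of_forall fun p => ?_
      rw [norm_mul, Real.norm_of_nonneg (gaussTerm_nonneg hl _ _ _), Real.norm_eq_abs]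
    · refine i3.norm.congr (Eventually.of_forall fun p => ?_)
      simp only
      rw [tsum_mul_right, norm_mul, hSdef, Real.norm_of_nonneg
        (tsum_nonneg fun k => gaussTerm_nonneg hl _ _ _), Real.norm_eq_abs]
    · rw [hSdef]
      exact (hsm p hp).hasSum.mul_right _
  have hge : ∫ p, gaussTerm (α - d) lam n ‖p.1 - p.2‖ * pairing φ p ∂volume.prod volume
      ≤ ∫ p, S (p.1 - p.2) * pairing φ p ∂volume.prod volume := by
    refine le_hasSum hsum n fun k _ => ?_
    rw [integral_gaussTerm_mul_pairing hl hφ]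
    exact mul_nonneg (by positivity) (integral_nonneg fun ξ => by positivity)
  have hq := integral_norm_sq_mul_pairing_nonpos hφ hR h0
  have hr := integral_rieszKernel_mul_pairing hd hα0 hα2 hφ hB hR h0 hfin
  have hw : ∀ p : EuclideanSpace ℝ (Fin d) × EuclideanSpace ℝ (Fin d),
      realPotential d α cW lam (p.1 - p.2) * pairing φ p
      = (rieszKernel d α (p.1 - p.2) * pairing φ p + 1 / 2 * (‖p.1 - p.2‖ ^ 2 * pairing φ p))
        - cW * (S (p.1 - p.2) * pairing φ p) := fun p => by
    rw [realPotential, hSdef]; ring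
  have i12 : Integrable (fun p : EuclideanSpace ℝ (Fin d) × EuclideanSpace ℝ (Fin d) =>
      rieszKernel d α (p.1 - p.2) * pairing φ p + 1 / 2 * (‖p.1 - p.2‖ ^ 2 * pairing φ p))
      (volume.prod volume) := i1.add (i2.const_mul _)
  have hg : Integrable fun ξ =>
      Real.exp (-(2 * Real.pi ^ 2 * (lam ^ (n + 1)) ^ 2 * ‖ξ‖ ^ 2)) * ‖𝓕 φ ξ‖ ^ 2 :=
    integrable_gaussian_mul_norm_sq_fourier hφ (by positivity)
  simp_rw [hw]
  rw [integral_sub i12 (i3.const_mul _), integral_add i1 (i2.const_mul _), integral_const_mul,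
    integral_const_mul, hr]
  have hrhs : ∫ ξ, ((2 * Real.pi * ‖ξ‖) ^ (-α) - cW * ((2 * Real.pi) ^ ((d : ℝ) / 2) *
        (lam ^ (n + 1)) ^ α * Real.exp (-(2 * Real.pi ^ 2 * (lam ^ (n + 1)) ^ 2 * ‖ξ‖ ^ 2)))) *
          ‖𝓕 φ ξ‖ ^ 2
      = (∫ ξ, (2 * Real.pi * ‖ξ‖) ^ (-α) * ‖𝓕 φ ξ‖ ^ 2) - cW * ((2 * Real.pi) ^ ((d : ℝ) / 2) *
        (lam ^ (n + 1)) ^ α * ∫ ξ,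
          Real.exp (-(2 * Real.pi ^ 2 * (lam ^ (n + 1)) ^ 2 * ‖ξ‖ ^ 2)) * ‖𝓕 φ ξ‖ ^ 2) := by
    rw [← integral_const_mul, ← integral_const_mul,
      ← integral_sub hfin ((hg.const_mul _).const_mul _)]
    refine integral_congr_ae (Eventually.of_forall fun ξ => ?_)
    simp only
    ring
  rw [hrhs, ← integral_gaussTerm_mul_pairing hl hφ n]
  nlinarith [mul_le_mul_of_nonneg_left hge hc.le]

/-! ### A test function oscillating at one small scale -/

/-- The backward difference of a function with step `v`. -/
def backwardDiff (v : EuclideanSpace ℝ (Fin d)) (f : EuclideanSpace ℝ (Fin d) → ℂ) :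
    EuclideanSpace ℝ (Fin d) → ℂ := fun x => f x - f (x - v)

theorem integrable_iterate_backwardDiff (v : EuclideanSpace ℝ (Fin d))
    {f : EuclideanSpace ℝ (Fin d) → ℂ} (hf : Integrable f) (m : ℕ) :
    Integrable ((backwardDiff v)^[m] f) := by
  induction m with
  | zero => exact hf
  | succ m ih =>
    rw [Function.iterate_succ_apply']
    exact ih.sub (ih.comp_sub_right v)

theorem continuous_iterate_backwardDiff (v : EuclideanSpace ℝ (Fin d))
    {f : EuclideanSpace ℝ (Fin d) → ℂ} (hf : Continuous f) (m : ℕ) :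
    Continuous ((backwardDiff v)^[m] f) := by
  induction m with
  | zero => exact hf
  | succ m ih =>
    rw [Function.iterate_succ_apply']
    exact ih.sub (ih.comp (continuous_sub_right v))

theorem norm_iterate_backwardDiff_le (v : EuclideanSpace ℝ (Fin d))
    {f : EuclideanSpace ℝ (Fin d) → ℂ} {B : ℝ} (hf : ∀ x, ‖f x‖ ≤ B) (m : ℕ) (x) :
    ‖(backwardDiff v)^[m] f x‖ ≤ 2 ^ m * B := by
  induction m generalizing x with
  | zero => simpa using hf x
  | succ m ih =>
    rw [Function.iterate_succ_apply']
    refine (norm_sub_le _ _).trans ?_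
    rw [pow_succ]
    linarith [ih x, ih (x - v)]

theorem iterate_backwardDiff_eq_zero (v x₁ : EuclideanSpace ℝ (Fin d))
    {f : EuclideanSpace ℝ (Fin d) → ℂ} {r : ℝ} (hf : ∀ x, r < ‖x - x₁‖ → f x = 0) (m : ℕ) (x)
    (hx : r + m * ‖v‖ < ‖x - x₁‖) : (backwardDiff v)^[m] f x = 0 := by
  induction m generalizing x with
  | zero => exact hf x (by simpa using hx)
  | succ m ih =>
    rw [Function.iterate_succ_apply']
    push_cast at hx
    have h1 : ‖x - x₁‖ ≤ ‖x - v - x₁‖ + ‖v‖ := by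
      have := norm_add_le (x - v - x₁) v
      rwa [show x - v - x₁ + v = x - x₁ by abel] at this
    have h2 := norm_nonneg v
    rw [backwardDiff, ih x (by linarith), ih (x - v) (by linarith), sub_zero]

theorem norm_sq_fourier_backwardDiff (v : EuclideanSpace ℝ (Fin d))
    {f : EuclideanSpace ℝ (Fin d) → ℂ} (hf : Integrable f) (ξ : EuclideanSpace ℝ (Fin d)) :
    ‖𝓕 (backwardDiff v f) ξ‖ ^ 2
      = (2 * Real.sin (Real.pi * inner ℝ v ξ)) ^ 2 * ‖𝓕 f ξ‖ ^ 2 := by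
  have hi : ∀ g : EuclideanSpace ℝ (Fin d) → ℂ, Integrable g →
      Integrable fun x => Complex.exp (↑(-2 * Real.pi * inner ℝ x ξ) * Complex.I) • g x := by
    intro g hg
    refine hg.norm.mono' ((by fun_prop : Continuous fun x : EuclideanSpace ℝ (Fin d) =>
      Complex.exp (↑(-2 * Real.pi * inner ℝ x ξ) * Complex.I)).aestronglyMeasurable.smul
        hg.aestronglyMeasurable) (Eventually.of_forall fun x => ?_)
    rw [norm_smul, Complex.norm_exp_ofReal_mul_I, one_mul]
  have h1 : 𝓕 (backwardDiff v f) ξ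
      = -((Complex.exp (Complex.I * ↑(-2 * Real.pi * inner ℝ v ξ)) - 1) * 𝓕 f ξ) := by
    have h2 : ∫ x, Complex.exp (↑(-2 * Real.pi * inner ℝ x ξ) * Complex.I) • f (x - v)
        = Complex.exp (Complex.I * ↑(-2 * Real.pi * inner ℝ v ξ)) * 𝓕 f ξ := by
      rw [Real.fourier_eq', ← integral_const_mul, ← integral_sub_right_eq_self (fun x =>
        Complex.exp (Complex.I * ↑(-2 * Real.pi * inner ℝ v ξ)) *
          Complex.exp (↑(-2 * Real.pi * inner ℝ x ξ) * Complex.I) • f x) v]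
      refine integral_congr_ae (Eventually.of_forall fun x => ?_)
      simp only [smul_eq_mul]
      rw [← mul_assoc, ← Complex.exp_add, inner_sub_left]
      congr 2
      push_cast
      ring
    rw [Real.fourier_eq']
    simp only [backwardDiff, smul_sub]
    rw [integral_sub (hi f hf) (hi _ (hf.comp_sub_right v)), h2, Real.fourier_eq']
    ring
  rw [h1, norm_neg, norm_mul, mul_pow, Complex.norm_exp_I_mul_ofReal_sub_one,
    Real.norm_eq_abs, sq_abs, show -2 * Real.pi * inner ℝ v ξ / 2 = -(Real.pi * inner ℝ v ξ) by ring,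
    Real.sin_neg]
  ring

/-- Repeated differences force the transform to vanish to high order at the origin, where the Riesz
symbol is singular, and keep the support bounded. -/
theorem norm_sq_fourier_iterate_backwardDiff (v : EuclideanSpace ℝ (Fin d))
    {f : EuclideanSpace ℝ (Fin d) → ℂ} (hf : Integrable f) (m : ℕ)
    (ξ : EuclideanSpace ℝ (Fin d)) :
    ‖𝓕 ((backwardDiff v)^[m] f) ξ‖ ^ 2
      = (2 * Real.sin (Real.pi * inner ℝ v ξ)) ^ (2 * m) * ‖𝓕 f ξ‖ ^ 2 := by
  induction m with
  | zero => simp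
  | succ m ih =>
    rw [Function.iterate_succ_apply',
      norm_sq_fourier_backwardDiff v (integrable_iterate_backwardDiff v hf m), ih]
    ring

theorem fourier_modulate (f : EuclideanSpace ℝ (Fin d) → ℂ) (ξ₀ ξ : EuclideanSpace ℝ (Fin d)) :
    𝓕 (fun x => Complex.exp (↑(2 * Real.pi * inner ℝ x ξ₀) * Complex.I) * f x) ξ
      = 𝓕 f (ξ - ξ₀) := by
  rw [Real.fourier_eq', Real.fourier_eq']
  refine integral_congr_ae (Eventually.of_forall fun x => ?_)
  simp only [smul_eq_mul]
  rw [← mul_assoc, ← Complex.exp_add, inner_sub_right]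
  congr 2
  push_cast
  ring

/-- The multiplier `(|ζ|^{-α} - c e^{-|ζ|²/2}) (2 sin(⟨u,ζ⟩/2))^{2m}`. -/
noncomputable def testMultiplier (α c : ℝ) (u : EuclideanSpace ℝ (Fin d)) (m : ℕ)
    (ζ : EuclideanSpace ℝ (Fin d)) : ℝ :=
  (‖ζ‖ ^ (-α) - c * Real.exp (-(‖ζ‖ ^ 2 / 2))) * (2 * Real.sin (inner ℝ u ζ / 2)) ^ (2 * m)

theorem measurable_testMultiplier (α c : ℝ) (u : EuclideanSpace ℝ (Fin d)) (m : ℕ) :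
    Measurable (testMultiplier α c u m) := by
  have h : Measurable fun ζ : EuclideanSpace ℝ (Fin d) => inner ℝ u ζ :=
    (by fun_prop : Continuous fun ζ : EuclideanSpace ℝ (Fin d) => inner ℝ u ζ).measurable
  unfold testMultiplier
  fun_prop

theorem continuousAt_testMultiplier (α c : ℝ) (u : EuclideanSpace ℝ (Fin d)) (m : ℕ)
    {ζ : EuclideanSpace ℝ (Fin d)} (hζ : ζ ≠ 0) : ContinuousAt (testMultiplier α c u m) ζ := by
  have h : ContinuousAt (fun ζ : EuclideanSpace ℝ (Fin d) => ‖ζ‖ ^ (-α)) ζ :=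
    continuous_norm.continuousAt.rpow_const (Or.inl (norm_ne_zero_iff.2 hζ))
  unfold testMultiplier
  exact (h.sub (by fun_prop)).mul (by fun_prop)

/-- For `‖ζ‖ < 1` the bound `|2 sin(⟨u,ζ⟩/2)| ≤ ‖u‖‖ζ‖` absorbs `‖ζ‖^(-α)`, as `2m ≥ α`. -/
theorem abs_testMultiplier_le {c : ℝ} (hc : 0 ≤ c) (hα0 : 0 < α)
    (u : EuclideanSpace ℝ (Fin d)) {m : ℕ} (hm : α ≤ 2 * m) (ζ : EuclideanSpace ℝ (Fin d)) :
    |testMultiplier α c u m ζ| ≤ (1 + c) * 4 ^ m + (‖u‖ ^ 2) ^ m := by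
  have hs4 : (2 * Real.sin (inner ℝ u ζ / 2)) ^ 2 ≤ 4 := by
    nlinarith [Real.sin_sq_add_cos_sq (inner ℝ u ζ / 2), sq_nonneg (Real.cos (inner ℝ u ζ / 2))]
  have hsu : (2 * Real.sin (inner ℝ u ζ / 2)) ^ 2 ≤ ‖u‖ ^ 2 * ‖ζ‖ ^ 2 := by
    have h1 := Real.abs_sin_le_abs (x := inner ℝ u ζ / 2)
    have h2 := abs_real_inner_le_norm u ζ
    rw [← mul_pow, ← sq_abs]
    gcongr
    rw [abs_mul, abs_two]
    rw [abs_div, abs_two] at h1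
    linarith
  have h4 : (2 * Real.sin (inner ℝ u ζ / 2)) ^ (2 * m) ≤ 4 ^ m := by
    rw [pow_mul]; gcongr
  have hu : (2 * Real.sin (inner ℝ u ζ / 2)) ^ (2 * m) ≤ (‖u‖ ^ 2) ^ m * ‖ζ‖ ^ (2 * m) := by
    rw [pow_mul, pow_mul, ← mul_pow]; gcongr
  have h0 : 0 ≤ (2 * Real.sin (inner ℝ u ζ / 2)) ^ (2 * m) := by
    rw [pow_mul]; positivity
  have hexp : Real.exp (-(‖ζ‖ ^ 2 / 2)) ≤ 1 := Real.exp_le_one_iff.2 (by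
    have := sq_nonneg ‖ζ‖; linarith)
  have hz0 : 0 ≤ ‖ζ‖ ^ (-α) := by positivity
  have hU : 0 ≤ (‖u‖ ^ 2) ^ m := by positivity
  have hmain : ‖ζ‖ ^ (-α) * (2 * Real.sin (inner ℝ u ζ / 2)) ^ (2 * m)
      ≤ 4 ^ m + (‖u‖ ^ 2) ^ m := by
    rcases le_or_gt 1 ‖ζ‖ with h | h
    · have : ‖ζ‖ ^ (-α) ≤ 1 := Real.rpow_le_one_of_one_le_of_nonpos h (by linarith)
      nlinarith
    · rcases eq_or_lt_of_le (norm_nonneg ζ) with hz | hz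
      · rw [← hz, Real.zero_rpow (by linarith), zero_mul]
        positivity
      · have : ‖ζ‖ ^ (-α) * ‖ζ‖ ^ (2 * m) ≤ 1 := by
          rw [← Real.rpow_natCast, ← Real.rpow_add hz]
          exact Real.rpow_le_one hz.le h.le (by push_cast; linarith)
        have h5 := mul_le_mul_of_nonneg_left hu hz0
        have h6 := mul_le_mul_of_nonneg_left this hU
        have : (0 : ℝ) ≤ 4 ^ m := by positivity
        nlinarith
  have hsec : c * Real.exp (-(‖ζ‖ ^ 2 / 2)) * (2 * Real.sin (inner ℝ u ζ / 2)) ^ (2 * m)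
      ≤ c * 4 ^ m := by
    have := mul_le_mul hexp h4 h0 zero_le_one
    nlinarith
  have hsec0 : 0 ≤ c * Real.exp (-(‖ζ‖ ^ 2 / 2)) *
      (2 * Real.sin (inner ℝ u ζ / 2)) ^ (2 * m) := by positivity
  have hf0 := mul_nonneg hz0 h0
  rw [testMultiplier, sub_mul, abs_le]
  have h7 : (0 : ℝ) ≤ c * 4 ^ m := by positivity
  have h8 : (0 : ℝ) ≤ 4 ^ m := by positivity
  constructor <;> nlinarith

/-- The radius `√α` maximizes `‖ζ‖^α exp(-‖ζ‖²/2)`, the ratio of the Gaussian to the Riesz symbol;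
negativity there is the lower threshold. The choice `⟨u,ζ⟩ = π` makes the sine equal to `1`. -/
theorem testMultiplier_neg (hα0 : 0 < α) (h : lowerThreshold d α < cW)
    {u ζ : EuclideanSpace ℝ (Fin d)} (hζ : ‖ζ‖ = √α) (hu : inner ℝ u ζ = Real.pi) (m : ℕ) :
    testMultiplier α (cW * (2 * Real.pi) ^ ((d : ℝ) / 2)) u m ζ < 0 := by
  have hπ := Real.pi_pos
  rw [testMultiplier, hu, Real.sin_pi_div_two, hζ, Real.sq_sqrt hα0.le]
  refine mul_neg_of_neg_of_pos (sub_neg.2 ?_) (by positivity)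
  have h1 : √α ^ (-α) = α ^ (-α / 2) := by
    rw [Real.sqrt_eq_rpow, ← Real.rpow_mul hα0.le]
    congr 1; ring
  have h2 := mul_lt_mul_of_pos_right h
    (show 0 < (2 * Real.pi) ^ ((d : ℝ) / 2) * Real.exp (-(α / 2)) by positivity)
  have h3 : lowerThreshold d α * ((2 * Real.pi) ^ ((d : ℝ) / 2) * Real.exp (-(α / 2)))
      = α ^ (-α / 2) := by
    have e1 : Real.exp (α / 2) * Real.exp (-(α / 2)) = 1 := by
      rw [← Real.exp_add, add_neg_cancel, Real.exp_zero]
    have e2 : (2 * Real.pi) ^ (-(d : ℝ) / 2) * (2 * Real.pi) ^ ((d : ℝ) / 2) = 1 := by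
      rw [← Real.rpow_add (by positivity), neg_div, neg_add_cancel, Real.rpow_zero]
    rw [lowerThreshold]
    linear_combination α ^ (-α / 2) * e1 + α ^ (-α / 2) * Real.exp (α / 2) *
      Real.exp (-(α / 2)) * e2
  rw [h1]
  linarith

/-- A fixed bump is modulated to frequency `ζ₀ / (2πt)`, `t = lam^(n+1)`, and differenced with step
`t • u`. In the rescaled variable `ζ = 2πtξ` its spectrum concentrates at `ζ₀` as `t → 0`, so the
form has the sign of the multiplier at `ζ₀`. -/
theorem exists_integral_pairing_neg (hd : 1 ≤ d) (hα0 : 0 < α) (hα2 : α < d + 2)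
    (hl : 0 < lam) (hl1 : lam < 1) (h : lowerThreshold d α < cW)
    (x₁ : EuclideanSpace ℝ (Fin d)) {r : ℝ} (hr : 0 < r) :
    ∃ (φ : EuclideanSpace ℝ (Fin d) → ℂ) (B : ℝ), Continuous φ ∧ Integrable φ ∧ (∀ x, ‖φ x‖ ≤ B) ∧
      (∀ x, r < ‖x - x₁‖ → φ x = 0) ∧ ∫ x, φ x = 0 ∧
      ∫ p, realPotential d α cW lam (p.1 - p.2) * pairing φ p ∂volume.prod volume < 0 := by
  have hπ := Real.pi_pos
  have hc : 0 < cW := (lowerThreshold_pos hα0).trans h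
  obtain ⟨e, he⟩ : ∃ e : EuclideanSpace ℝ (Fin d), ‖e‖ = 1 :=
    ⟨EuclideanSpace.single ⟨0, hd⟩ 1, by simp⟩
  have hsα : 0 < √α := Real.sqrt_pos.2 hα0
  obtain ⟨ζ₀, hζ₀⟩ : ∃ ζ₀, ζ₀ = √α • e := ⟨_, rfl⟩
  obtain ⟨u, hu⟩ : ∃ u, u = (Real.pi / √α) • e := ⟨_, rfl⟩
  have hζn : ‖ζ₀‖ = √α := by rw [hζ₀, norm_smul, he, Real.norm_of_nonneg hsα.le, mul_one]
  have huζ : inner ℝ u ζ₀ = Real.pi := by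
    rw [hu, hζ₀, real_inner_smul_left, real_inner_smul_right, real_inner_self_eq_norm_sq, he]
    field_simp
  have hζ0 : ζ₀ ≠ 0 := norm_ne_zero_iff.1 (by rw [hζn]; exact hsα.ne')
  obtain ⟨m, hm⟩ := exists_nat_ge (α / 2)
  have hm2 : α ≤ 2 * m := by linarith
  have hm0 : m ≠ 0 := by rintro rfl; simp at hm2; linarith
  -- the bump
  let b : ContDiffBump x₁ := ⟨r / 4, r / 2, by positivity, by linarith⟩
  have hbs : HasCompactSupport (fun x => ((b x : ℝ) : ℂ)) :=
    b.hasCompactSupport.comp_left Complex.ofReal_zero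
  have hbc : ContDiff ℝ (↑(⊤ : ℕ∞)) (fun x => ((b x : ℝ) : ℂ)) :=
    Complex.ofRealCLM.contDiff.comp b.contDiff
  let χ : SchwartzMap (EuclideanSpace ℝ (Fin d)) ℂ := hbs.toSchwartzMap hbc
  have hχ : ∀ x, χ x = ((b x : ℝ) : ℂ) := fun x => rfl
  have hχi : Integrable χ := χ.integrable
  obtain ⟨N, hN⟩ : ∃ N : EuclideanSpace ℝ (Fin d) → ℝ, N = fun ξ => ‖𝓕 (χ : _ → ℂ) ξ‖ ^ 2 :=
    ⟨_, rfl⟩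
  have hNi : Integrable N := by
    have h1 := ((𝓕 χ).memLp 2 volume).integrable_norm_pow (by norm_num)
    rw [hN, ← SchwartzMap.fourier_coe]
    exact h1
  have hNpos : 0 < ∫ ξ, N ξ := by
    have h1 := χ.integral_norm_sq_fourier
    rw [SchwartzMap.fourier_coe] at h1
    rw [hN, h1]
    have hcont : Continuous fun x => ‖χ x‖ ^ 2 := by fun_prop
    refine hcont.integral_pos_of_hasCompactSupport_nonneg_nonzero ?_ (fun x => sq_nonneg _)
      (x := x₁) ?_
    · exact hbs.comp_left (g := fun z : ℂ => ‖z‖ ^ 2) (by simp)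
    · rw [hχ, b.one_of_mem_closedBall (Metric.mem_closedBall_self (by positivity))]
      simp
  have hNnn : ∀ ξ, 0 ≤ N ξ := fun ξ => by rw [hN]; positivity
  -- the scales
  obtain ⟨H, hH⟩ : ∃ H : ℝ → EuclideanSpace ℝ (Fin d) → ℝ,
    H = fun c => testMultiplier α c u m := ⟨_, rfl⟩
  have hHb : ∀ c, 0 ≤ c → ∀ ζ, |H c ζ| ≤ (1 + c) * 4 ^ m + (‖u‖ ^ 2) ^ m := fun c hc' ζ => by
    rw [hH]; exact abs_testMultiplier_le hc' hα0 u hm2 ζ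
  have hHm : ∀ c, Measurable (H c) := fun c => by rw [hH]; exact measurable_testMultiplier _ _ _ _
  obtain ⟨c, hcdef⟩ : ∃ c, c = cW * (2 * Real.pi) ^ ((d : ℝ) / 2) := ⟨_, rfl⟩
  have hc0 : 0 ≤ c := by rw [hcdef]; positivity
  have hHneg : H c ζ₀ < 0 := by rw [hH, hcdef]; exact testMultiplier_neg hα0 h hζn huζ m
  have ht : Tendsto (fun n : ℕ => lam ^ (n + 1)) atTop (𝓝 0) :=
    (tendsto_pow_atTop_nhds_zero_of_lt_one hl.le hl1).comp (tendsto_add_atTop_nat 1)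
  have hlim : Tendsto (fun n : ℕ => ∫ ξ, H c ((2 * Real.pi * lam ^ (n + 1)) • ξ + ζ₀) * N ξ)
      atTop (𝓝 (∫ ξ, H c ζ₀ * N ξ)) := by
    refine tendsto_integral_of_dominated_convergence
      (fun ξ => ((1 + c) * 4 ^ m + (‖u‖ ^ 2) ^ m) * N ξ) (fun n => ?_) (hNi.const_mul _)
      (fun n => Eventually.of_forall fun ξ => ?_) (Eventually.of_forall fun ξ => ?_)
    · exact ((hHm c).comp (by fun_prop)).aestronglyMeasurable.mul hNi.aestronglyMeasurable
    · rw [norm_mul, Real.norm_of_nonneg (hNnn ξ)]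
      exact mul_le_mul_of_nonneg_right (hHb c hc0 _) (hNnn ξ)
    · refine Tendsto.mul_const _ ?_
      have h1 : ContinuousAt (H c) ζ₀ := by rw [hH]; exact continuousAt_testMultiplier _ _ _ _ hζ0
      refine h1.tendsto.comp ?_
      have h2 := ((ht.const_mul (2 * Real.pi)).smul_const ξ).add_const ζ₀
      simpa using h2
  have hev1 := hlim.eventually_lt_const (show ∫ ξ, H c ζ₀ * N ξ < 0 by
    rw [integral_const_mul]; exact mul_neg_of_neg_of_pos hHneg hNpos)
  -- The `m` differences enlarge the support of radius `r / 2` by `m * t * ‖u‖`; it must stay within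
  -- radius `r`.
  have hev2 : ∀ᶠ n : ℕ in atTop, lam ^ (n + 1) * (m * ‖u‖) < r / 2 := by
    have := ht.mul_const (m * ‖u‖)
    rw [zero_mul] at this
    exact this.eventually_lt_const (by positivity)
  obtain ⟨n, hn1, hn2⟩ := (hev1.and hev2).exists
  obtain ⟨t, htdef⟩ : ∃ t, t = lam ^ (n + 1) := ⟨_, rfl⟩
  have ht0 : 0 < t := by rw [htdef]; positivity
  rw [← htdef] at hn1 hn2
  obtain ⟨ξt, hξt⟩ : ∃ ξt, ξt = (1 / (2 * Real.pi * t)) • ζ₀ := ⟨_, rfl⟩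
  obtain ⟨η, hη⟩ : ∃ η : EuclideanSpace ℝ (Fin d) → ℂ,
    η = fun x => Complex.exp (↑(2 * Real.pi * inner ℝ x ξt) * Complex.I) * χ x := ⟨_, rfl⟩
  have hηn : ∀ x, ‖η x‖ = ‖χ x‖ := fun x => by
    rw [hη, norm_mul, Complex.norm_exp_ofReal_mul_I, one_mul]
  have hηc : Continuous η := by rw [hη]; fun_prop
  have hηi : Integrable η :=
    hχi.norm.mono' hηc.aestronglyMeasurable (Eventually.of_forall fun x => (hηn x).le)
  have hηb : ∀ x, ‖η x‖ ≤ 1 := fun x => by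
    rw [hηn, hχ, Complex.norm_real, Real.norm_of_nonneg b.nonneg]
    exact b.le_one
  have hηs : ∀ x, r / 2 < ‖x - x₁‖ → η x = 0 := fun x hx => by
    rw [hη]
    simp only
    rw [hχ, b.zero_of_le_dist (by rw [dist_eq_norm]; exact hx.le)]
    simp
  obtain ⟨φ, hφ⟩ : ∃ φ, φ = (backwardDiff (t • u))^[m] η := ⟨_, rfl⟩
  have hφi : Integrable φ := by rw [hφ]; exact integrable_iterate_backwardDiff _ hηi m
  have hφb : ∀ x, ‖φ x‖ ≤ 2 ^ m * 1 := by rw [hφ]; exact norm_iterate_backwardDiff_le _ hηb m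
  have hφs : ∀ x, r < ‖x - x₁‖ → φ x = 0 := fun x hx => by
    rw [hφ]
    refine iterate_backwardDiff_eq_zero _ x₁ hηs m x ?_
    rw [norm_smul, Real.norm_of_nonneg ht0.le]
    linarith
  have hφF : ∀ ξ, ‖𝓕 φ ξ‖ ^ 2 = (2 * Real.sin (Real.pi * inner ℝ (t • u) ξ)) ^ (2 * m) *
      N (ξ - ξt) := fun ξ => by
    rw [hφ, norm_sq_fourier_iterate_backwardDiff _ hηi, hN, hη, fourier_modulate]
  have hφ0 : ∫ x, φ x = 0 := by
    have h1 := hφF 0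
    rw [inner_zero_right, mul_zero, Real.sin_zero, mul_zero, zero_pow (by omega), zero_mul] at h1
    have h2 : 𝓕 φ 0 = ∫ x, φ x := by rw [Real.fourier_eq']; simp
    rw [← h2]
    exact norm_eq_zero.1 (pow_eq_zero_iff two_ne_zero |>.1 h1)
  -- The coefficient `c'` is left free: `c' = 0` gives the integrability of the Riesz part, and `c'
  -- = c` the sign.
  have hkey : ∀ c' ξ, ((2 * Real.pi * ‖ξ‖) ^ (-α) - c' * (t ^ α *
      Real.exp (-(2 * Real.pi ^ 2 * t ^ 2 * ‖ξ‖ ^ 2)))) * ‖𝓕 φ ξ‖ ^ 2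
      = t ^ α * (H c' ((2 * Real.pi * t) • (ξ - ξt) + ζ₀) * N (ξ - ξt)) := fun c' ξ => by
    have e0 : (2 * Real.pi * t) • (ξ - ξt) + ζ₀ = (2 * Real.pi * t) • ξ := by
      rw [smul_sub, hξt, smul_smul, mul_one_div_cancel (by positivity), one_smul,
        sub_add_cancel]
    have e1 : ‖(2 * Real.pi * t) • ξ‖ = t * (2 * Real.pi * ‖ξ‖) := by
      rw [norm_smul, Real.norm_of_nonneg (by positivity)]; ring
    have e2 : t ^ α * t ^ (-α) = 1 := by
      rw [← Real.rpow_add ht0, add_neg_cancel, Real.rpow_zero]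
    have e3 : (t * (2 * Real.pi * ‖ξ‖)) ^ 2 / 2 = 2 * Real.pi ^ 2 * t ^ 2 * ‖ξ‖ ^ 2 := by ring
    have e4 : inner ℝ u ((2 * Real.pi * t) • ξ) / 2 = Real.pi * inner ℝ (t • u) ξ := by
      rw [real_inner_smul_left, real_inner_smul_right]; ring
    rw [hφF, e0, hH]
    simp only [testMultiplier]
    rw [e1, e3, e4, Real.mul_rpow ht0.le (by positivity)]
    linear_combination -(2 * Real.pi * ‖ξ‖) ^ (-α) *
      ((2 * Real.sin (Real.pi * inner ℝ (t • u) ξ)) ^ (2 * m) * N (ξ - ξt)) * e2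
  have hfin : Integrable fun ξ => (2 * Real.pi * ‖ξ‖) ^ (-α) * ‖𝓕 φ ξ‖ ^ 2 := by
    have h1 : Integrable fun ξ => H 0 ((2 * Real.pi * t) • ξ + ζ₀) * N ξ :=
      hNi.bdd_mul ((hHm 0).comp (by fun_prop)).aestronglyMeasurable
        (Eventually.of_forall fun ξ => hHb 0 le_rfl _)
    refine ((h1.comp_sub_right ξt).const_mul (t ^ α)).congr (Eventually.of_forall fun ξ => ?_)
    simp only
    rw [← hkey 0 ξ, zero_mul, sub_zero]
  have hR : ∀ x, ‖x₁‖ + r < ‖x‖ → φ x = 0 := fun x hx => hφs x (by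
    have := norm_sub_norm_le x x₁; linarith)
  refine ⟨φ, _, by rw [hφ]; exact continuous_iterate_backwardDiff _ hηc m, hφi, hφb, hφs, hφ0, (integral_realPotential_mul_pairing_le hd hα0 hα2 hl hl1 hc
    hφi hφb hR hφ0 hfin n).trans_lt ?_⟩
  have hfun : ∀ ξ, ((2 * Real.pi * ‖ξ‖) ^ (-α) - cW * ((2 * Real.pi) ^ ((d : ℝ) / 2) *
        t ^ α * Real.exp (-(2 * Real.pi ^ 2 * t ^ 2 * ‖ξ‖ ^ 2)))) * ‖𝓕 φ ξ‖ ^ 2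
      = t ^ α * (H c ((2 * Real.pi * t) • (ξ - ξt) + ζ₀) * N (ξ - ξt)) := fun ξ => by
    rw [← hkey, hcdef]
    ring
  rw [← htdef]
  simp_rw [hfun]
  rw [integral_const_mul, integral_sub_right_eq_self
    (fun ξ => H c ((2 * Real.pi * t) • ξ + ζ₀) * N ξ) ξt]
  exact mul_neg_of_pos_of_neg (by positivity) hn1

/-! ### The second variation at a local minimizer -/

/-- The measure with density `max f 0` with respect to Lebesgue measure. -/
noncomputable def densityMeasure (f : EuclideanSpace ℝ (Fin d) → ℝ) :
    Measure (EuclideanSpace ℝ (Fin d)) := volume.withDensity fun x => ENNReal.ofReal (f x)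

theorem densityMeasure_prod_integral {f : EuclideanSpace ℝ (Fin d) → ℝ} (hf : Measurable f)
    (hf0 : ∀ x, 0 ≤ f x) {k : EuclideanSpace ℝ (Fin d) × EuclideanSpace ℝ (Fin d) → ℝ}
    (hk : Integrable k ((densityMeasure f).prod (densityMeasure f))) :
    Integrable (fun p => f p.1 * f p.2 * k p) (volume.prod volume) ∧
      ∫ p, k p ∂(densityMeasure f).prod (densityMeasure f)
        = ∫ p, f p.1 * f p.2 * k p ∂volume.prod volume := by
  have hm : Measurable fun p : EuclideanSpace ℝ (Fin d) × EuclideanSpace ℝ (Fin d) =>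
      ENNReal.ofReal (f p.1) * ENNReal.ofReal (f p.2) := by fun_prop
  have hlt : ∀ᵐ p : EuclideanSpace ℝ (Fin d) × EuclideanSpace ℝ (Fin d) ∂volume.prod volume,
      ENNReal.ofReal (f p.1) * ENNReal.ofReal (f p.2) < ⊤ :=
    Eventually.of_forall fun p => ENNReal.mul_lt_top ENNReal.ofReal_lt_top ENNReal.ofReal_lt_top
  have hr : ∀ p : EuclideanSpace ℝ (Fin d) × EuclideanSpace ℝ (Fin d),
      (ENNReal.ofReal (f p.1) * ENNReal.ofReal (f p.2)).toReal • k p = f p.1 * f p.2 * k p :=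
    fun p => by
      rw [ENNReal.toReal_mul, ENNReal.toReal_ofReal (hf0 _), ENNReal.toReal_ofReal (hf0 _),
        smul_eq_mul]
  rw [densityMeasure, prod_withDensity hf.ennreal_ofReal hf.ennreal_ofReal] at hk ⊢
  rw [integrable_withDensity_iff_integrable_smul' hm hlt] at hk
  rw [integral_withDensity_eq_integral_toReal_smul hm hlt]
  simp_rw [hr] at hk ⊢
  exact ⟨hk, trivial⟩

theorem densityMeasure_add_densityMeasure_sub {f g : EuclideanSpace ℝ (Fin d) → ℝ}
    (hf : Measurable f) (hg : Measurable g) (h : ∀ x, |g x| ≤ f x) :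
    densityMeasure (f + g) + densityMeasure (f - g) = densityMeasure f + densityMeasure f := by
  rw [densityMeasure, densityMeasure, densityMeasure, ← withDensity_add_left (by fun_prop),
    ← withDensity_add_left (by fun_prop)]
  congr 1
  funext x
  have := abs_le.1 (h x)
  simp only [Pi.add_apply, Pi.sub_apply]
  rw [← ENNReal.ofReal_add (by linarith) (by linarith),
    ← ENNReal.ofReal_add (by linarith) (by linarith)]
  congr 1
  ring

/-- This is the parallelogram identity for the energy: adding the perturbations by `g` and `-g`
removes the first-order terms. -/
theorem integral_prod_add_densityMeasure {τ : Measure (EuclideanSpace ℝ (Fin d))} [SFinite τ]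
    {f g : EuclideanSpace ℝ (Fin d) → ℝ} (hf : Measurable f) (hg : Measurable g)
    (h : ∀ x, |g x| ≤ f x) {k : EuclideanSpace ℝ (Fin d) × EuclideanSpace ℝ (Fin d) → ℝ}
    (hk : Integrable k ((τ + densityMeasure f).prod (τ + densityMeasure f))) :
    Integrable k ((τ + densityMeasure (f + g)).prod (τ + densityMeasure (f + g))) ∧
    Integrable k ((τ + densityMeasure (f - g)).prod (τ + densityMeasure (f - g))) ∧
    Integrable (fun p => g p.1 * g p.2 * k p) (volume.prod volume) ∧
    ∫ p, k p ∂(τ + densityMeasure (f + g)).prod (τ + densityMeasure (f + g))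
      + ∫ p, k p ∂(τ + densityMeasure (f - g)).prod (τ + densityMeasure (f - g))
      = 2 * ∫ p, k p ∂(τ + densityMeasure f).prod (τ + densityMeasure f)
        + 2 * ∫ p, g p.1 * g p.2 * k p ∂volume.prod volume := by
  have hS : ∀ u : EuclideanSpace ℝ (Fin d) → ℝ, SFinite (densityMeasure u) :=
    fun u => by unfold densityMeasure; infer_instance
  have hsum := densityMeasure_add_densityMeasure_sub hf hg h
  have hf0 : ∀ x, 0 ≤ f x := fun x => (abs_nonneg _).trans (h x)
  have hp0 : ∀ x, 0 ≤ (f + g) x := fun x => by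
    have := abs_le.1 (h x); simp only [Pi.add_apply]; linarith
  have hm0 : ∀ x, 0 ≤ (f - g) x := fun x => by
    have := abs_le.1 (h x); simp only [Pi.sub_apply]; linarith
  have q0 := densityMeasure_prod_integral hf hf0 (k := k)
  have q1 := densityMeasure_prod_integral (hf.add hg) hp0 (k := k)
  have q2 := densityMeasure_prod_integral (hf.sub hg) hm0 (k := k)
  obtain ⟨σ, hσ⟩ : ∃ σ, σ = densityMeasure f := ⟨_, rfl⟩
  obtain ⟨σp, hσp⟩ : ∃ σ, σ = densityMeasure (f + g) := ⟨_, rfl⟩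
  obtain ⟨σm, hσm⟩ : ∃ σ, σ = densityMeasure (f - g) := ⟨_, rfl⟩
  have s0 : SFinite σ := hσ ▸ hS _
  have s1 : SFinite σp := hσp ▸ hS _
  have s2 : SFinite σm := hσm ▸ hS _
  rw [← hσ] at q0 hk hsum ⊢
  rw [← hσp] at q1 hsum ⊢
  rw [← hσm] at q2 hsum ⊢
  rw [Measure.prod_add, Measure.add_prod, Measure.add_prod, integrable_add_measure,
    integrable_add_measure, integrable_add_measure] at hk
  obtain ⟨⟨i1, i2⟩, i3, i4⟩ := hk
  have e1 : τ.prod σp + τ.prod σm = τ.prod σ + τ.prod σ := by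
    rw [← Measure.prod_add, hsum, Measure.prod_add]
  have e2 : σp.prod τ + σm.prod τ = σ.prod τ + σ.prod τ := by
    rw [← Measure.add_prod, hsum, Measure.add_prod]
  have e3 : (σp.prod σp + σm.prod σp) + (σp.prod σm + σm.prod σm)
      = (σ.prod σ + σ.prod σ) + (σ.prod σ + σ.prod σ) := by
    rw [← Measure.add_prod, ← Measure.add_prod, ← Measure.prod_add, hsum, Measure.prod_add,
      Measure.add_prod]
  -- Integrability for the perturbed measures is inherited from the unperturbed one, since they are
  -- summands of its multiples.
  have j1 := integrable_add_measure.1 (e1 ▸ i3.add_measure i3)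
  have j2 := integrable_add_measure.1 (e2 ▸ i2.add_measure i2)
  have j3 := integrable_add_measure.1 (e3 ▸ (i4.add_measure i4).add_measure (i4.add_measure i4))
  have j4 := (integrable_add_measure.1 j3.1).1
  have j5 := (integrable_add_measure.1 j3.2).2
  have v1 := congrArg (fun ν => ∫ p, k p ∂ν) e1
  have v2 := congrArg (fun ν => ∫ p, k p ∂ν) e2
  beta_reduce at v1 v2
  rw [integral_add_measure j1.1 j1.2, integral_add_measure i3 i3] at v1
  rw [integral_add_measure j2.1 j2.2, integral_add_measure i2 i2] at v2
  obtain ⟨k0, w0⟩ := q0 i4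
  obtain ⟨k1, w1⟩ := q1 j4
  obtain ⟨k2, w2⟩ := q2 j5
  have hpt : ∀ p : EuclideanSpace ℝ (Fin d) × EuclideanSpace ℝ (Fin d), g p.1 * g p.2 * k p
      = 1 / 2 * ((f + g) p.1 * (f + g) p.2 * k p + (f - g) p.1 * (f - g) p.2 * k p)
        - f p.1 * f p.2 * k p := fun p => by
    simp only [Pi.add_apply, Pi.sub_apply]; ring
  have k12 : Integrable (fun p => 1 / 2 * ((f + g) p.1 * (f + g) p.2 * k p
      + (f - g) p.1 * (f - g) p.2 * k p)) (volume.prod volume) := (k1.add k2).const_mul _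
  refine ⟨?_, ?_, ?_, ?_⟩
  · rw [Measure.prod_add, Measure.add_prod, Measure.add_prod]
    exact (i1.add_measure j2.1).add_measure (j1.1.add_measure j4)
  · rw [Measure.prod_add, Measure.add_prod, Measure.add_prod]
    exact (i1.add_measure j2.2).add_measure (j1.2.add_measure j5)
  · simp_rw [hpt]
    exact k12.sub k0
  · simp_rw [hpt]
    rw [integral_sub k12 k0, integral_const_mul, integral_add k1 k2,
      ← w0, ← w1, ← w2]
    simp only [Measure.prod_add, Measure.add_prod]
    rw [integral_add_measure (i1.add_measure j2.1) (j1.1.add_measure j4),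
      integral_add_measure (i1.add_measure j2.2) (j1.2.add_measure j5),
      integral_add_measure (i1.add_measure i2) (i3.add_measure i4),
      integral_add_measure i1 j2.1, integral_add_measure j1.1 j4,
      integral_add_measure i1 j2.2, integral_add_measure j1.2 j5,
      integral_add_measure i1 i2, integral_add_measure i3 i4]
    linarith

theorem densityMeasure_univ {f : EuclideanSpace ℝ (Fin d) → ℝ} (hf : Integrable f)
    (hf0 : ∀ x, 0 ≤ f x) : densityMeasure f univ = ENNReal.ofReal (∫ x, f x) := by
  rw [densityMeasure, withDensity_apply _ MeasurableSet.univ, Measure.restrict_univ,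
    ofReal_integral_eq_lintegral_ofReal hf (Eventually.of_forall hf0)]

theorem ae_densityMeasure_mem {f : EuclideanSpace ℝ (Fin d) → ℝ} (hf : Measurable f)
    {s : Set (EuclideanSpace ℝ (Fin d))} (hs : ∀ x, x ∉ s → f x = 0) :
    ∀ᵐ x ∂densityMeasure f, x ∈ s := by
  rw [densityMeasure, ae_withDensity_iff hf.ennreal_ofReal]
  refine Eventually.of_forall fun x hx => ?_
  by_contra h
  exact hx (by rw [hs x h, ENNReal.ofReal_zero])

/-- Nonnegativity of the second variation of the energy at a local minimizer. -/
theorem IsCompactlySupportedDInftyLocalMinimizer.exists_second_variation_nonneg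
    (hd : 1 ≤ d) (hα0 : 0 < α) (hl : 0 < lam) (hl1 : lam < 1) (hc : 0 < cW)
    (hlow : α ≤ d → ∃ C : ℝ, ∀ x : EuclideanSpace ℝ (Fin d), x ≠ 0 →
      -C ≤ realPotential d α cW lam x)
    {ρ : Measure (EuclideanSpace ℝ (Fin d))}
    (hρ : IsCompactlySupportedDInftyLocalMinimizer (potential d α cW lam) ρ) :
    ∃ r₀ : ℝ, 0 < r₀ ∧ ∀ (f g : EuclideanSpace ℝ (Fin d) → ℝ)
      (s : Set (EuclideanSpace ℝ (Fin d))), Measurable f → Measurable g → Integrable f →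
      (∀ x, |g x| ≤ f x) → 0 < ∫ x, f x → ∫ x, g x = 0 → densityMeasure f ≤ ρ →
      (∀ x, x ∉ s → f x = 0) → (∀ x ∈ s, ∀ y ∈ s, dist x y ≤ r₀) →
      Integrable (fun p => g p.1 * g p.2 * realPotential d α cW lam (p.1 - p.2))
        (volume.prod volume) ∧
      0 ≤ ∫ p, g p.1 * g p.2 * realPotential d α cW lam (p.1 - p.2) ∂volume.prod volume := by
  obtain ⟨hne, hint⟩ := hρ.integrable hd hα0 hl hl1 hc hlow
  obtain ⟨hprob, hcomp, ε, hε, hmin⟩ := hρ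
  obtain ⟨r₀, hr0, hr₀⟩ : ∃ r : ℝ, 0 < r ∧ ENNReal.ofReal r < ε := by
    obtain ⟨r, hr0, hr⟩ := ENNReal.lt_iff_exists_nnreal_btwn.1 hε
    exact ⟨r, by simpa using hr0, by simpa using hr⟩
  refine ⟨r₀, hr0, fun f g s hf hg hfi hgf hf0 hg0 hle hs hdist => ?_⟩
  have hnn : ∀ x, 0 ≤ f x := fun x => (abs_nonneg _).trans (hgf x)
  have hgi : Integrable g := hfi.mono' hg.aestronglyMeasurable (Eventually.of_forall hgf)
  have hσ0 := densityMeasure_univ hfi hnn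
  have hfin : IsFiniteMeasure (densityMeasure f) := ⟨by rw [hσ0]; exact ENNReal.ofReal_lt_top⟩
  obtain ⟨τ, hτ⟩ : ∃ τ, τ = ρ - densityMeasure f := ⟨_, rfl⟩
  have hρτ : τ + densityMeasure f = ρ := by rw [hτ]; exact Measure.sub_add_cancel_of_le hle
  have hτf : IsFiniteMeasure τ := by rw [hτ]; infer_instance
  have hW : ∀ ν : Measure (EuclideanSpace ℝ (Fin d)), SFinite ν → ν ≪ ρ →
      ∀ᵐ p ∂ν.prod ν, potential d α cW lam (p.1 - p.2)
        = (realPotential d α cW lam (p.1 - p.2) : EReal) := fun ν _ hν => by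
    rcases le_or_gt α d with h | h
    · exact (hν.prod hν).ae_le ((hne h).mono fun p hp => potential_of_ne hp)
    · exact Eventually.of_forall fun p => potential_of_lt h _
  obtain ⟨R, hR0, hR⟩ := ae_norm_le_of_isCompact_support hcomp
  have key : ∀ u : EuclideanSpace ℝ (Fin d) → ℝ, Measurable u → (∀ x, |u x| ≤ f x) →
      ∫ x, u x = 0 → Integrable (fun p => realPotential d α cW lam (p.1 - p.2))
        ((τ + densityMeasure (f + u)).prod (τ + densityMeasure (f + u))) →
      ∫ p, realPotential d α cW lam (p.1 - p.2) ∂ρ.prod ρ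
        ≤ ∫ p, realPotential d α cW lam (p.1 - p.2)
          ∂(τ + densityMeasure (f + u)).prod (τ + densityMeasure (f + u)) := by
    intro u hu huf hu0 hui
    have hi : Integrable u := hfi.mono' hu.aestronglyMeasurable (Eventually.of_forall huf)
    have hnn' : ∀ x, 0 ≤ (f + u) x := fun x => by
      have := abs_le.1 (huf x); simp only [Pi.add_apply]; linarith
    have hmass : densityMeasure f univ = densityMeasure (f + u) univ := by
      rw [hσ0, densityMeasure_univ (hfi.add hi) hnn']
      simp only [Pi.add_apply]
      rw [integral_add hfi hi, hu0, add_zero]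
    have hfin' : IsFiniteMeasure (densityMeasure (f + u)) :=
      ⟨by rw [← hmass, hσ0]; exact ENNReal.ofReal_lt_top⟩
    -- Absolute continuity transfers from `ρ` the bounded support and, for `α ≤ d`, the nullity of
    -- the diagonal.
    have hac : τ + densityMeasure (f + u) ≪ ρ := by
      have h1 : densityMeasure (f + u) ≪ densityMeasure f := by
        intro t ht
        have h2 : densityMeasure (f + u) t ≤ densityMeasure f t + densityMeasure f t := by
          rw [← Measure.add_apply, ← densityMeasure_add_densityMeasure_sub hf hu huf,
            Measure.add_apply]
          exact le_self_add
        rwa [ht, add_zero, nonpos_iff_eq_zero] at h2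
      rw [← hρτ]
      exact Measure.AbsolutelyContinuous.add Measure.AbsolutelyContinuous.rfl h1
    have hp1 : IsProbabilityMeasure (τ + densityMeasure f) := by rw [hρτ]; exact hprob
    have hp2 : IsProbabilityMeasure (τ + densityMeasure (f + u)) := ⟨by
      rw [Measure.add_apply, ← hmass, ← Measure.add_apply, measure_univ]⟩
    have hdd : dInfty ρ (τ + densityMeasure (f + u)) < ε := by
      refine lt_of_le_of_lt ?_ hr₀
      have h1 := dInfty_add_le (ρ := τ) (σ := densityMeasure f) (σ' := densityMeasure (f + u))
        hmass (by rw [hσ0]; exact (ENNReal.ofReal_pos.2 hf0).ne') (s := s)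
        (ae_densityMeasure_mem hf hs) (ae_densityMeasure_mem (hf.add hu) fun x hx => by
          have h2 := huf x
          rw [hs x hx] at h2
          simp only [Pi.add_apply]
          rw [hs x hx, abs_nonpos_iff.1 h2, add_zero]) (r := ENNReal.ofReal r₀)
        (fun x hx y hy => by
          rw [edist_dist]; exact ENNReal.ofReal_le_ofReal (hdist x hx y hy))
      rwa [hρτ] at h1
    have hcs : IsCompact (τ + densityMeasure (f + u)).support :=
      isCompact_support_of_ae_norm_le (hac.ae_le hR)
    have h1 := hmin _ hp2 hcs hdd
    rw [energy_eq_of_integrable hint (hW ρ inferInstance Measure.AbsolutelyContinuous.rfl),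
      energy_eq_of_integrable hui (hW _ inferInstance hac), EReal.coe_le_coe_iff] at h1
    linarith
  obtain ⟨ip, im, iq, hid⟩ := integral_prod_add_densityMeasure (τ := τ) hf hg hgf
    (k := fun p => realPotential d α cW lam (p.1 - p.2)) (by rw [hρτ]; exact hint)
  refine ⟨iq, ?_⟩
  have h1 := key g hg hgf hg0 ip
  have h2 := key (-g) hg.neg (fun x => by simpa using hgf x)
    (by simp only [Pi.neg_apply]; rw [integral_neg, hg0, neg_zero])
    (by rw [← sub_eq_add_neg]; exact im)
  rw [← sub_eq_add_neg] at h2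
  rw [hρτ] at hid
  linarith

/-! ### Conclusion -/

/-- A ball inside the superlevel set leaves room for a small multiple of the negative test function,
against the second variation inequality. -/
theorem IsCompactlySupportedDInftyLocalMinimizer.interior_superlevel_eq_empty
    (hd : 1 ≤ d) (hα0 : 0 < α) (hα2 : α < d + 2) (hl : 0 < lam) (hl1 : lam < 1)
    (h : lowerThreshold d α < cW)
    (hlow : α ≤ d → ∃ C : ℝ, ∀ x : EuclideanSpace ℝ (Fin d), x ≠ 0 →
      -C ≤ realPotential d α cW lam x)
    {ρ : Measure (EuclideanSpace ℝ (Fin d))}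
    (hρ : IsCompactlySupportedDInftyLocalMinimizer (potential d α cW lam) ρ)
    {g : EuclideanSpace ℝ (Fin d) → ℝ} (hg : g =ᵐ[volume] fun x => (ρ.rnDeriv volume x).toReal)
    {ε : ℝ} (hε : 0 < ε) : interior {x | ε ≤ g x} = ∅ := by
  have hc : 0 < cW := (lowerThreshold_pos hα0).trans h
  obtain ⟨r₀, hr0, hmin⟩ := hρ.exists_second_variation_nonneg hd hα0 hl hl1 hc hlow
  by_contra hne
  obtain ⟨x₁, hx₁⟩ := nonempty_iff_ne_empty.2 hne
  obtain ⟨r₁, hr1, hsub⟩ := Metric.isOpen_iff.1 isOpen_interior x₁ hx₁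
  obtain ⟨r, hr, hrr0, hrr1⟩ : ∃ r : ℝ, 0 < r ∧ 2 * r ≤ r₀ ∧ r < r₁ :=
    ⟨min (r₀ / 2) (r₁ / 2), by positivity, by linarith [min_le_left (r₀ / 2) (r₁ / 2)],
      by linarith [min_le_right (r₀ / 2) (r₁ / 2)]⟩
  obtain ⟨φ, B, hφc, hφi, hφB, hφs, hφ0, hφneg⟩ :=
    exists_integral_pairing_neg hd hα0 hα2 hl hl1 h x₁ hr
  obtain ⟨s, hs⟩ : ∃ s, s = Metric.closedBall x₁ r := ⟨_, rfl⟩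
  have hsm : MeasurableSet s := hs ▸ Metric.isClosed_closedBall.measurableSet
  have hsv : volume s ≠ ⊤ := hs ▸ measure_closedBall_lt_top.ne
  have hsg : ∀ x ∈ s, ε ≤ g x := fun x hx => by
    rw [hs] at hx
    have h1 : x ∈ {x | ε ≤ g x} :=
      interior_subset (hsub (Metric.closedBall_subset_ball hrr1 hx))
    exact h1
  obtain ⟨f, hf⟩ : ∃ f : EuclideanSpace ℝ (Fin d) → ℝ, f = s.indicator fun _ => ε := ⟨_, rfl⟩
  have hfm : Measurable f := hf ▸ measurable_const.indicator hsm
  have hfi : Integrable f := by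
    rw [hf, integrable_indicator_iff hsm]
    exact integrableOn_const hsv
  have hfpos : 0 < ∫ x, f x := by
    rw [hf, integral_indicator_const ε hsm, smul_eq_mul]
    refine mul_pos (ENNReal.toReal_pos ?_ hsv) hε
    rw [hs]
    exact (Metric.measure_closedBall_pos volume x₁ hr).ne'
  have hfs : ∀ x, x ∉ s → f x = 0 := fun x hx => by rw [hf, indicator_of_notMem hx]
  have hle : densityMeasure f ≤ ρ := by
    refine (withDensity_mono ?_).trans (Measure.withDensity_rnDeriv_le ρ volume)
    filter_upwards [hg] with x hx
    by_cases hxs : x ∈ s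
    · rw [hf, indicator_of_mem hxs]
      refine ENNReal.ofReal_le_of_le_toReal ?_
      rw [← hx]
      exact hsg x hxs
    · rw [hfs x hxs, ENNReal.ofReal_zero]
      exact zero_le
  have hdist : ∀ x ∈ s, ∀ y ∈ s, dist x y ≤ r₀ := fun x hx y hy => by
    rw [hs, Metric.mem_closedBall] at hx hy
    linarith [dist_triangle_right x y x₁]
  have hB : 0 ≤ B := (norm_nonneg _).trans (hφB 0)
  -- This amplitude keeps the perturbation below `ε`; the summand `1` avoids division by zero.
  obtain ⟨c, hcdef⟩ : ∃ c, c = ε / (B + 1) := ⟨_, rfl⟩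
  have hc0 : 0 < c := by rw [hcdef]; positivity
  have hcB : c * B ≤ ε := by
    rw [hcdef, div_mul_eq_mul_div, div_le_iff₀ (by positivity)]
    nlinarith
  have hbound : ∀ (L : ℂ → ℝ), (∀ z, |L z| ≤ ‖z‖) → ∀ x, |c * L (φ x)| ≤ f x := by
    intro L hL x
    rw [abs_mul, abs_of_pos hc0]
    by_cases hxs : x ∈ s
    · rw [hf, indicator_of_mem hxs]
      exact (mul_le_mul_of_nonneg_left ((hL _).trans (hφB x)) hc0.le).trans hcB
    · have h0 : φ x = 0 := hφs x (by
        rw [hs, Metric.mem_closedBall, dist_eq_norm, not_le] at hxs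
        exact hxs)
      have h1 := hL (φ x)
      rw [h0, norm_zero] at h1
      rw [hfs x hxs, h0, le_antisymm h1 (abs_nonneg _), mul_zero]
  have hre0 : ∫ x, c * (φ x).re = 0 := by
    have h1 := integral_re hφi
    rw [hφ0] at h1
    rw [integral_const_mul]
    exact mul_eq_zero_of_right _ h1
  have him0 : ∫ x, c * (φ x).im = 0 := by
    have h1 := integral_im hφi
    rw [hφ0] at h1
    rw [integral_const_mul]
    exact mul_eq_zero_of_right _ h1
  -- Perturbations must be real. The real part of `φ(x) conj φ(y)` is the sum of the products of the
  -- real and of the imaginary parts, so the two inequalities add up to one for `φ`.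
  obtain ⟨i1, n1⟩ := hmin f (fun x => c * (φ x).re) s hfm (by fun_prop) hfi
    (hbound Complex.re Complex.abs_re_le_norm) hfpos hre0 hle hfs hdist
  obtain ⟨i2, n2⟩ := hmin f (fun x => c * (φ x).im) s hfm (by fun_prop) hfi
    (hbound Complex.im Complex.abs_im_le_norm) hfpos him0 hle hfs hdist
  have hsum : ∫ p, (c * (φ p.1).re * (c * (φ p.2).re) * realPotential d α cW lam (p.1 - p.2)
        + c * (φ p.1).im * (c * (φ p.2).im) * realPotential d α cW lam (p.1 - p.2))
          ∂volume.prod volume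
      = c ^ 2 * ∫ p, realPotential d α cW lam (p.1 - p.2) * pairing φ p ∂volume.prod volume := by
    rw [← integral_const_mul]
    refine integral_congr_ae (Eventually.of_forall fun p => ?_)
    simp only [pairing, Complex.mul_re, Complex.conj_re, Complex.conj_im]
    ring
  rw [integral_add i1 i2] at hsum
  have : 0 < c ^ 2 := by positivity
  nlinarith

theorem almostFractal_of_thresholds (hd : 1 ≤ d) (hα0 : 0 < α) (hα2 : α < d + 2)
    (hlower : lowerThreshold d α < cW) (hupper : cW < upperThreshold d α) :
    ∃ lam₀ : ℝ, 0 < lam₀ ∧ ∀ lam : ℝ, 0 < lam → lam < 1 → lam ≤ lam₀ →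
      ∀ ρ : Measure (EuclideanSpace ℝ (Fin d)),
        IsCompactlySupportedDInftyLocalMinimizer (potential d α cW lam) ρ → AlmostFractal ρ := by
  have hc : 0 < cW := (lowerThreshold_pos hα0).trans hlower
  have hev : ∀ᶠ lam : ℝ in 𝓝[>] 0,
      (α ≤ d → ∃ C : ℝ, ∀ x : EuclideanSpace ℝ (Fin d), x ≠ 0 →
        -C ≤ realPotential d α cW lam x) ∧
      ((d : ℝ) < α → ∃ δ : ℝ, 0 < δ ∧ ∀ (n : ℕ) (x : EuclideanSpace ℝ (Fin d)),
        ‖x‖ = lam ^ ((n : ℝ) + 1 / 2) →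
          realPotential d α cW lam x - realPotential d α cW lam 0
            ≤ -δ * ‖x‖ ^ (α - d) + ‖x‖ ^ 2 / 2) := by
    rcases lt_trichotomy α d with h | h | h
    · filter_upwards [eventually_realPotential_nonneg h hc hupper] with lam hlam
      exact ⟨fun _ => ⟨0, by simpa using hlam⟩, fun h' => absurd h h'.not_gt⟩
    · filter_upwards [eventually_realPotential_ge hα0 h hc] with lam hlam
      exact ⟨fun _ => hlam, fun h' => absurd h h'.ne'⟩
    · filter_upwards [eventually_realPotential_sub_le h hα2 hc] with lam hlam
      exact ⟨fun h' => absurd h h'.not_gt, fun _ => hlam⟩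
  obtain ⟨b, hb, hlam⟩ := mem_nhdsGT_iff_exists_Ioo_subset.1 hev
  have hb : 0 < b := hb
  refine ⟨b / 2, by positivity, fun lam hl hl1 hle ρ hρ => ?_⟩
  obtain ⟨h1, h2⟩ := hlam ⟨hl, by linarith⟩
  exact ⟨hρ.preperfect_support hd hα0 hα2 hl hl1 hc h1 h2, fun g hg ε hε =>
    hρ.interior_superlevel_eq_empty hd hα0 hα2 hl hl1 hlower h1 hg hε⟩

end InteractionEnergy

theorem mainTheorem10 (d : ℕ) (α cW : ℝ)
    (hα : (2 ≤ d ∧ ((d : ℝ) + 2) / 2 < α ∧ α < (d : ℝ) + 2) ∨ (d = 1 ∧ 2 ≤ α ∧ α < 3))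
    (hlower : InteractionEnergy.lowerThreshold d α < cW)
    (hupper : cW < InteractionEnergy.upperThreshold d α) :
    ∃ lam₀ : ℝ, 0 < lam₀ ∧ ∀ lam : ℝ, 0 < lam → lam < 1 → lam ≤ lam₀ →
      ∀ ρ : Measure (EuclideanSpace ℝ (Fin d)),
        InteractionEnergy.IsCompactlySupportedDInftyLocalMinimizer
            (InteractionEnergy.potential d α cW lam) ρ →
          InteractionEnergy.AlmostFractal ρ := by
  have hd0 : (0 : ℝ) ≤ d := d.cast_nonneg
  refine InteractionEnergy.almostFractal_of_thresholds ?_ ?_ ?_ hlower hupper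
  · rcases hα with h | h <;> omega
  · rcases hα with h | h <;> linarith
  · rcases hα with h | ⟨h, _, h3⟩
    · exact h.2.2
    · rw [h]; norm_num; exact h3
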